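/- **Conventions.** Let $n\ge 1$ and let $\Theta_{n-1}$ be Joyal's cell category: $\Theta_0$ is the terminal category and $\Theta_{k+1}=\Delta\wr\Theta_k$. A $\Theta_{n-1}$-space is an object of $\mathcal V=s\mathrm{Set}^{\Theta_{n-1}^{op}}=\mathrm{Set}^{(\Theta_{n-1}\times\Delta)^{op}}$; it is connected if its image under the left adjoint $\pi_0$ of the inclusion of sets as constant objects is a point. For $m\ge0$ and $X\in\mathcal V$ write $F[m,X]=F[m]\times X\in s\mathrm{Set}^{\Theta_{n-1}^{op}\times\Delta^{op}}$, where $F[m]$ is represented by $[m]\in\Delta$, and $F[m,\theta,k]$ for the representable on $([m],\theta,[k])$. Let $\mathcal P$ be the full subcategory of those $W\in s\mathrm{Set}^{\Theta_{n-1}^{op}\times\Delta^{op}}$ with $W_0$ discrete (a constant $\Theta_{n-1}$-space), and $L$ the left adjoint of its inclusion. Let $c^h$ be the left adjoint of the homotopy coherent nerve $s\mathrm{Set}\text{-}\mathrm{Cat}\to s\mathrm{Set}$. For $W\in\mathcal P$, $\mathfrak C W$ is the $\mathcal V$-enriched category with object set $W_0$ and $\mathrm{Hom}_{\mathfrak C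 W}(a,b)_{\theta,k}=\mathrm{Hom}_{c^h(W_{-,\theta,k})}(a,b)_k$. The straightening functor $$\mathrm{St}_W\colon s\mathrm{Set}^{\Theta_{n-1}^{op}\times\Delta^{op}}_{/W}\to[\mathfrak C W^{op},\mathcal V]$$ is the colimit-preserving functor with $\mathrm{St}_W(\sigma)=\mathrm{Hom}_{\mathfrak C W_\sigma}(-,\top)\circ\mathfrak C(\iota_\sigma)$ for $\sigma\colon F[p,\theta,k]\to W$. Here $W_\sigma$ is the pushout in $\mathcal P$ of $W\leftarrow LF[p,\theta,k]\to LF[p+1,\theta,k]$ (the second map being induced by $d^{p+1}$), $\iota_\sigma\colon W\to W_\sigma$ is the canonical map, and $\top$ is the image of the vertex $p+1$. A necklace is a wedge $T=\Delta[m_0]\vee\dots\vee\Delta[m_t]$, last vertex glued to first vertex, with all $m_j>0$ if $t>0$; $\alpha,\omega$ denote its first and last vertices, $B(T)$ its set of beads, $B^T_\omega$ its last bead. For $0\le i\le m$, $\mathcal N$ denotes the category of totally non-degenerate necklaces in $\Delta[m+1]$ from $i$ to $m+1$: its objects are necklaces $T$ with a map $T\to\Delta[m+1]$ sending $\alpha\mapsto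 i$, $\omega\mapsto m+1$ and restricting to a non-degenerate simplex on each bead; its morphisms are the maps over $\Delta[m+1]$ preserving $\alpha$ and $\omega$. A map $g\colon U\to T$ of $\mathcal N$ maps every bead $b$ of $U$ into a unique bead $B(g)(b)$ of $T$, and $B(g)(B^U_\omega)=B^T_\omega$. **Proposition.** Let $\mu\colon[\ell]\to[m]$ be an injective map in $\Delta$, let $f\colon X\hookrightarrow Y$ be a monomorphism in $\mathcal V$ between connected $\Theta_{n-1}$-spaces, and write $[\mu,f]$ for the composite $F[\ell,X]\to F[m,Y]\to LF[m,Y]$. Let $\mu+1\colon[\ell+1]\to[m+1]$ extend $\mu$ by $\ell+1\mapsto m+1$. For $0\le i\le m$ define $G=G^i_\mu(f)\colon\mathcal N^{op}\to\mathcal V$ by $$G(T)=\begin{cases}\bigl(\prod_{B(T)\setminus\{B^T_\omega\}}Y\bigr)\times X&\text{if }B^T_\omega\subseteq\mathrm{im}(\mu+1),\\ \emptyset&\text{otherwise,}\end{cases}$$ where $g\colon U\to T$ sends $((y_c)_c,x)$ to $((y'_b)_b,x)$ with $y'_b=y_{B(g)(b)}$ if $B(g)(b)\neq B^T_\omega$,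 and $y'_b=f(x)$ if $B(g)(b)=B^T_\omega$. Let $H\colon\mathcal N\to s\mathrm{Set}$ be the functor $T\mapsto\mathrm{Hom}_{c^hT}(\alpha,\omega)$. Then there is an isomorphism in $\mathcal V$ $$\mathrm{St}_{LF[m,Y]}([\mu,f])(i)\;\cong\;\mathrm{diag}\bigl(\mathrm{colim}^{H}_{\mathcal N^{op}}\,\iota G\bigr).$$ Here $\iota\colon\mathcal V\to s\mathrm{Set}^{\Theta_{n-1}^{op}\times\Delta^{op}}$ regards $G(T)_{\theta,k}$ as a discrete simplicial set, the colimit is the $s\mathrm{Set}$-enriched colimit weighted by $H$, i.e. the coend $\int^{T\in\mathcal N}H(T)\otimes\iota G(T)$ (with levelwise tensors), and $\mathrm{diag}(Z)_{\theta,k}=(Z_{\theta,k})_k$. For fixed $m$, $Y$, $i$ these isomorphisms can be chosen natural in $(\mu,f)$, with respect to the pairs of maps $[\ell]\to[\ell']$ over $[m]$ and $X\to X'$ over $Y$. -/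

import Mathlib

open CategoryTheory CategoryTheory.Limits Opposite MonoidalCategory

namespace StNec

section

open Simplicial

/-! ### Joyal's cell categories -/

/-- Objects `[len](lbl 1, …, lbl len)` of the wreath product `Δ ≀ A`. -/
structure Wreath (A : Type) where
  len : ℕ
  lbl : Fin len → A

/-- With zero-based `i` and `j`, this is the condition `φ (i - 1) < j ≤ φ i` of the one-based
convention: the `j`-th elementary edge of `[q]` is covered by the image of the `i`-th one of `[p]`. -/
def Covers {p q : ℕ} (φ : ⦋p⦌ ⟶ ⦋q⦌) (i : Fin p) (j : Fin q) : Prop :=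
  (φ.toOrderHom i.castSucc : ℕ) ≤ j ∧ (j : ℕ) < φ.toOrderHom i.succ

/-- A morphism of `Δ ≀ A`: a map `φ : [p] ⟶ [q]` of `Δ` and maps `a_i ⟶ b_j` of `A` for all
`i`, `j` with `φ (i - 1) < j ≤ φ i`. -/
@[ext]
structure Wreath.Hom {A : Type} [SmallCategory A] (x y : Wreath A) where
  base : ⦋x.len⦌ ⟶ ⦋y.len⦌
  fib : ∀ (i : Fin x.len) (j : Fin y.len), Covers base i j → (x.lbl i ⟶ y.lbl j)

lemma Covers.id_eq {p : ℕ} {i j : Fin p} (h : Covers (𝟙 ⦋p⦌) i j) : i = j := by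
  obtain ⟨h1, h2⟩ := h
  simp at h1 h2
  ext; omega

lemma Covers.id_self {p : ℕ} (i : Fin p) : Covers (𝟙 ⦋p⦌) i i := by
  simp [Covers]

lemma Covers.comp {p q r : ℕ} {φ : ⦋p⦌ ⟶ ⦋q⦌} {ψ : ⦋q⦌ ⟶ ⦋r⦌} {i : Fin p} {j : Fin q} {k : Fin r}
    (h : Covers φ i j) (h' : Covers ψ j k) : Covers (φ ≫ ψ) i k := by
  obtain ⟨h1, h2⟩ := h
  obtain ⟨h3, h4⟩ := h'
  refine ⟨le_trans (b := (ψ.toOrderHom j.castSucc : ℕ)) ?_ h3,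
    lt_of_lt_of_le (b := (ψ.toOrderHom j.succ : ℕ)) h4 ?_⟩
  · exact ψ.toOrderHom.monotone (Fin.le_def.2 (by simpa using h1))
  · exact ψ.toOrderHom.monotone (Fin.le_def.2 (by simpa using h2))

lemma Covers.exists_mid {p q r : ℕ} {φ : ⦋p⦌ ⟶ ⦋q⦌} {ψ : ⦋q⦌ ⟶ ⦋r⦌} {i : Fin p} {k : Fin r}
    (h : Covers (φ ≫ ψ) i k) : ∃ j, Covers φ i j ∧ Covers ψ j k := by
  classical
  obtain ⟨h1, h2⟩ := h
  have hex : ∃ b : ℕ, ∃ hb : b < q + 1, (k : ℕ) < ψ.toOrderHom ⟨b, hb⟩ :=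
    ⟨_, (φ.toOrderHom i.succ).2, h2⟩
  set b := Nat.find hex with hbdef
  obtain ⟨hb, hkb⟩ := Nat.find_spec hex
  have hpos : (φ.toOrderHom i.castSucc : ℕ) < b := by
    by_contra hcon
    have : ψ.toOrderHom ⟨b, hb⟩ ≤ ψ.toOrderHom (φ.toOrderHom i.castSucc) :=
      ψ.toOrderHom.monotone (Fin.le_def.2 (by simpa using hcon))
    have h1' : (ψ.toOrderHom (φ.toOrderHom i.castSucc) : ℕ) ≤ k := h1
    have h3 := Fin.le_def.1 this
    have h4 : (k : ℕ) < ψ.toOrderHom ⟨b, hb⟩ := hkb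
    omega
  have hble : b ≤ φ.toOrderHom i.succ := Nat.find_min' hex ⟨(φ.toOrderHom i.succ).2, h2⟩
  have hmin := Nat.find_min hex (m := b - 1) (by omega)
  push Not at hmin
  refine ⟨⟨b - 1, by omega⟩, ⟨?_, ?_⟩, ?_, ?_⟩
  · simp; omega
  · simp; omega
  · exact hmin (by omega)
  · have : (⟨b - 1, by omega⟩ : Fin q).succ = ⟨b, hb⟩ := by ext; simp; omega
    rw [this]; exact hkb

lemma Covers.unique_mid {p q r : ℕ} {φ : ⦋p⦌ ⟶ ⦋q⦌} {ψ : ⦋q⦌ ⟶ ⦋r⦌} {i : Fin p} {k : Fin r}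
    {j j' : Fin q} (_ : Covers φ i j) (h : Covers ψ j k) (_ : Covers φ i j') (h' : Covers ψ j' k) :
    j = j' := by
  obtain ⟨h1, h2⟩ := h
  obtain ⟨h3, h4⟩ := h'
  by_contra hne
  rcases lt_or_gt_of_ne hne with hlt | hlt
  · have : ψ.toOrderHom j.succ ≤ ψ.toOrderHom j'.castSucc :=
      ψ.toOrderHom.monotone (Fin.le_def.2 (by simpa using hlt))
    have := Fin.le_def.1 this
    omega
  · have : ψ.toOrderHom j'.succ ≤ ψ.toOrderHom j.castSucc :=
      ψ.toOrderHom.monotone (Fin.le_def.2 (by simpa using hlt))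
    have := Fin.le_def.1 this
    omega

namespace Wreath

variable {A : Type} [SmallCategory A]

/-- The identity of `[p](a_1, …, a_p)`. -/
def Hom.id (x : Wreath A) : Hom x x where
  base := 𝟙 _
  fib _ _ h := eqToHom (congrArg x.lbl h.id_eq)

/-- Composition: `(ψ ∘ φ)_{ik} = ψ_{jk} ∘ φ_{ij}` for the unique `j` in between. -/
noncomputable def Hom.comp {x y z : Wreath A} (f : Hom x y) (g : Hom y z) : Hom x z where
  base := f.base ≫ g.base
  fib i k h :=
    f.fib i h.exists_mid.choose h.exists_mid.choose_spec.1 ≫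
      g.fib h.exists_mid.choose k h.exists_mid.choose_spec.2

lemma Hom.comp_fib {x y z : Wreath A} (f : Hom x y) (g : Hom y z) {i : Fin x.len}
    {j : Fin y.len} {k : Fin z.len} (h : Covers f.base i j) (h' : Covers g.base j k)
    (hik : Covers (f.base ≫ g.base) i k) :
    (Hom.comp f g).fib i k hik = f.fib i j h ≫ g.fib j k h' := by
  have e : hik.exists_mid.choose = j :=
    Covers.unique_mid hik.exists_mid.choose_spec.1 hik.exists_mid.choose_spec.2 h h'
  subst e
  rfl

lemma Hom.ext_fib {x y : Wreath A} {f g : Hom x y} (hb : f.base = g.base)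
    (hf : ∀ i j (h : Covers f.base i j) (h' : Covers g.base i j), f.fib i j h = g.fib i j h') :
    f = g := by
  obtain ⟨fb, ff⟩ := f
  obtain ⟨gb, gf⟩ := g
  obtain rfl : fb = gb := hb
  congr
  funext i j h
  exact hf i j h h

noncomputable instance : SmallCategory (Wreath A) where
  Hom := Hom
  id := Hom.id
  comp := Hom.comp
  id_comp {x y} f := Hom.ext_fib (Category.id_comp _) fun i j h h' => by
    rw [Hom.comp_fib (Hom.id x) f (Covers.id_self i) h' h]
    simp [Hom.id]
  comp_id {x y} f := Hom.ext_fib (Category.comp_id _) fun i j h h' => by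
    rw [Hom.comp_fib f (Hom.id y) h' (Covers.id_self j) h]
    simp [Hom.id]
  assoc {w x y z} f g k := Hom.ext_fib (Category.assoc _ _ _) fun i j h h' => by
    obtain ⟨b, hb, hbj⟩ := Covers.exists_mid h
    obtain ⟨a, ha, hab⟩ := Covers.exists_mid hb
    rw [Hom.comp_fib (Hom.comp f g) k hb hbj h, Hom.comp_fib f g ha hab hb,
      Hom.comp_fib f (Hom.comp g k) ha (hab.comp hbj) h', Hom.comp_fib g k hab hbj,
      Category.assoc]

end Wreath

/-- Joyal's cell categories: `Θ₀` is the terminal category and `Θ_{n+1} = Δ ≀ Θ_n`. -/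
noncomputable def Theta (n : ℕ) : Cat.{0, 0} :=
  match n with
  | 0 => Cat.of (Discrete PUnit)
  | n + 1 => Cat.of (Wreath (Theta n))

/-- The terminal object `[0]` of `Θ_n`. -/
noncomputable def Theta.pt (n : ℕ) : Theta n :=
  match n with
  | 0 => (⟨⟨⟩⟩ : Discrete PUnit)
  | n + 1 => (⟨0, Fin.elim0⟩ : Wreath (Theta n))

/-- The map from a cell to the terminal object of `Θ_n`. -/
noncomputable def Theta.toPt (n : ℕ) (x : Theta n) : x ⟶ Theta.pt n :=
  match n, x with
  | 0, x => (⟨⟨Subsingleton.elim (α := PUnit) _ _⟩⟩ : (show Discrete PUnit from x) ⟶ ⟨⟨⟩⟩)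
  | n + 1, x =>
    ({ base := SimplexCategory.const _ _ 0, fib := fun _ j => j.elim0 } :
      Wreath.Hom (A := Theta n) x ⟨0, Fin.elim0⟩)

lemma Theta.toPt_unique (n : ℕ) (x : Theta n) (f g : x ⟶ Theta.pt n) : f = g := by
  cases n with
  | zero => exact Subsingleton.elim (α := ULift (PLift _)) f g
  | succ n =>
    exact Wreath.Hom.ext_fib (A := Theta n) (SimplexCategory.isTerminalZero.hom_ext _ _)
      fun i j => j.elim0

/-- A vertex of a cell. -/
noncomputable def Theta.fromPt (n : ℕ) (x : Theta n) : Theta.pt n ⟶ x :=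
  match n, x with
  | 0, x => (⟨⟨Subsingleton.elim (α := PUnit) _ _⟩⟩ : (⟨⟨⟩⟩ : Discrete PUnit) ⟶ x)
  | n + 1, x =>
    ({ base := SimplexCategory.const _ _ 0, fib := fun i => i.elim0 } :
      Wreath.Hom (A := Theta n) ⟨0, Fin.elim0⟩ x)

end

noncomputable section

open Simplicial

/-! ### `Θ`-spaces and precategory objects -/

/-- The category `Θ_n × Δ`, whose presheaves are the `Θ_n`-spaces. -/
abbrev Cell (n : ℕ) : Type := Theta n × SimplexCategory

/-- The terminal object `([0], [0])` of `Θ_n × Δ`. -/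
def Cell.pt (n : ℕ) : Cell n := (Theta.pt n, ⦋0⦌)

def Cell.toPt {n : ℕ} (d : Cell n) : d ⟶ Cell.pt n :=
  (Theta.toPt n d.1, SimplexCategory.const _ _ 0)

lemma Cell.toPt_unique {n : ℕ} {d : Cell n} (f g : d ⟶ Cell.pt n) : f = g :=
  Prod.ext (Theta.toPt_unique n _ _ _) (SimplexCategory.isTerminalZero.hom_ext _ _)

def Cell.fromPt {n : ℕ} (d : Cell n) : Cell.pt n ⟶ d :=
  (Theta.fromPt n d.1, SimplexCategory.const _ _ 0)

/-- `Θ_n`-spaces: the category `sSet^{Θ_nᵒᵖ}`, with its two variables uncurried. -/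
abbrev ThetaSpace (n : ℕ) := (Cell n)ᵒᵖ ⥤ Type

/-- The category `sSet^{Θ_nᵒᵖ × Δᵒᵖ}` of simplicial objects in `Θ_n`-spaces, uncurried. The first
factor `SimplexCategory` is the categorical direction, the one in `Cell n` the space direction. -/
abbrev DeltaThetaSpace (n : ℕ) := (SimplexCategory × Cell n)ᵒᵖ ⥤ Type

variable {n : ℕ}

/-- The set of connected components of a `Θ_n`-space; as a functor this is the left adjoint of the
inclusion of sets as constant `Θ_n`-spaces. -/
abbrev ThetaSpace.π₀ (X : ThetaSpace n) : Type := colimit X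

/-- A `Θ_n`-space is connected if its set of components is a point. -/
def ThetaSpace.Connected (X : ThetaSpace n) : Prop := Nonempty (X.π₀ ≃ PUnit.{1})

/-- The `Θ_n`-space `W_p`. -/
abbrev level (p : ℕ) : DeltaThetaSpace n ⥤ ThetaSpace n :=
  (Functor.whiskeringLeft _ _ _).obj (CategoryTheory.Prod.sectR ⦋p⦌ (Cell n)).op

/-- The simplicial set `W_{-,θ,k}` for `d = (θ, k)`. -/
abbrev DeltaThetaSpace.column (W : DeltaThetaSpace n) (d : Cell n) : SSet.{0} :=
  (CategoryTheory.Prod.sectL SimplexCategory d).op ⋙ W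

/-- The constant simplicial object on a `Θ_n`-space. -/
abbrev constSimp : ThetaSpace n ⥤ DeltaThetaSpace n :=
  (Functor.whiskeringLeft _ _ _).obj (CategoryTheory.Prod.snd SimplexCategory (Cell n)).op

/-- `W` is a precategory object if `W₀` is discrete, i.e. isomorphic to a constant `Θ_n`-space. -/
def isPcat (n : ℕ) : ObjectProperty (DeltaThetaSpace n) :=
  fun W => (Functor.const (Cell n)ᵒᵖ).essImage ((level 0).obj W)

/-- The category `PCat(sSet^{Θ_nᵒᵖ})`. -/
abbrev Pcat (n : ℕ) := (isPcat n).FullSubcategory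

/-! The left adjoint `L` of the inclusion: `L A` is the pushout of `A` along the map from `A₀` to
the constant `Θ_n`-space on `π₀ A₀`, both viewed as constant simplicial objects. -/

/-- The constant simplicial object on `W₀` maps to `W` by degeneracies. -/
def degen (W : DeltaThetaSpace n) : constSimp.obj ((level 0).obj W) ⟶ W where
  app x := W.map (Quiver.Hom.op ((SimplexCategory.const x.unop.1 ⦋0⦌ 0, 𝟙 x.unop.2) :
    x.unop ⟶ (⦋0⦌, x.unop.2)))
  naturality x y f := by
    dsimp
    rw [← W.map_comp, ← W.map_comp]
    congr 1
    apply Quiver.Hom.unop_inj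
    exact Prod.ext (SimplexCategory.isTerminalZero.hom_ext _ _)
      ((Category.id_comp _).trans (Category.comp_id _).symm)

/-- The unit `X ⟶ π₀ X`. -/
def toPi₀ (X : ThetaSpace n) : X ⟶ (Functor.const _).obj X.π₀ :=
  (colimit.cocone X).ι

def objL (A : DeltaThetaSpace n) : DeltaThetaSpace n :=
  pushout (degen A) (constSimp.map (toPi₀ ((level 0).obj A)))

instance (A : DeltaThetaSpace n) : IsIso ((level 0).map (degen A)) := by
  rw [NatTrans.isIso_iff_isIso_app]
  intro d
  have : ((level 0).map (degen A)).app d = 𝟙 (A.obj (op (⦋0⦌, d.unop))) := by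
    refine Eq.trans ?_ (A.map_id _)
    refine congrArg A.map (Quiver.Hom.unop_inj ?_)
    exact Prod.ext (SimplexCategory.isTerminalZero.hom_ext _ _) rfl
  exact this ▸ inferInstanceAs (IsIso (𝟙 (A.obj (op (⦋0⦌, d.unop)))))

lemma isPcat_objL (A : DeltaThetaSpace n) : isPcat n (objL A) := by
  have h := (IsPushout.of_hasPushout (degen A) (constSimp.map (toPi₀ ((level 0).obj A)))).map
    (level 0)
  have := h.isIso_inr_of_isIso
  exact ⟨((level 0).obj A).π₀,
    ⟨(asIso ((level 0).map (pushout.inr (degen A) (constSimp.map (toPi₀ ((level 0).obj A))))) :)⟩⟩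

instance (X : ThetaSpace n) : Epi (toPi₀ X) := by
  rw [NatTrans.epi_iff_epi_app]
  intro d
  rw [epi_iff_surjective]
  intro c
  obtain ⟨e, x, rfl⟩ := Types.jointly_surjective_of_isColimit (colimit.isColimit X) c
  let φ : e ⟶ d := (d.unop.toPt ≫ e.unop.fromPt).op
  exact ⟨X.map φ x, ConcreteCategory.congr_hom (colimit.w X φ) x⟩

instance (X : ThetaSpace n) : Epi (constSimp.map (toPi₀ X)) := by
  rw [NatTrans.epi_iff_epi_app]
  intro d
  exact (NatTrans.epi_iff_epi_app (toPi₀ X)).1 inferInstance (op d.unop.2)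

lemma exists_factor (X Z : ThetaSpace n) (hZ : (Functor.const (Cell n)ᵒᵖ).essImage Z) (f : X ⟶ Z) :
    ∃ g, toPi₀ X ≫ g = f := by
  obtain ⟨S, ⟨e⟩⟩ := hZ
  refine ⟨(Functor.const _).map (colimit.desc X ⟨S, f ≫ e.inv⟩) ≫ e.hom, ?_⟩
  rw [← Category.assoc, ← Iso.eq_comp_inv]
  ext d : 2
  exact colimit.ι_desc ⟨S, f ≫ e.inv⟩ d

/-- The unit `A ⟶ L A`. -/
def unitL (A : DeltaThetaSpace n) : A ⟶ objL A := pushout.inl _ _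

lemma objL_hom_ext {A B : DeltaThetaSpace n} {h h' : objL A ⟶ B}
    (e : unitL A ≫ h = unitL A ≫ h') : h = h' := by
  refine pushout.hom_ext e ?_
  refine (cancel_epi (constSimp.map (toPi₀ ((level 0).obj A)))).1 ?_
  have key (k : objL A ⟶ B) := pushout.condition_assoc (f := degen A)
    (g := constSimp.map (toPi₀ ((level 0).obj A))) k
  exact (key h).symm.trans ((congrArg (degen A ≫ ·) e).trans (key h'))

lemma degen_naturality {A B : DeltaThetaSpace n} (f : A ⟶ B) :
    degen A ≫ f = constSimp.map ((level 0).map f) ≫ degen B := by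
  ext x y
  exact (ConcreteCategory.congr_hom (f.naturality (Quiver.Hom.op
    ((SimplexCategory.const x.unop.1 ⦋0⦌ 0, 𝟙 x.unop.2) : x.unop ⟶ (⦋0⦌, x.unop.2)))) y)

lemma exists_desc (A B : DeltaThetaSpace n) (hB : isPcat n B) (f : A ⟶ B) :
    ∃ h : objL A ⟶ B, unitL A ≫ h = f := by
  obtain ⟨g, hg⟩ := exists_factor _ _ hB ((level 0).map f)
  refine ⟨pushout.desc f (constSimp.map g ≫ degen B) ?_, pushout.inl_desc _ _ _⟩
  rw [← Category.assoc, ← Functor.map_comp, hg]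
  exact degen_naturality f

lemma bijective_objL (A : DeltaThetaSpace n) (W : Pcat n) :
    Function.Bijective fun h : (⟨objL A, isPcat_objL A⟩ : Pcat n) ⟶ W =>
      (unitL A ≫ h.hom : A ⟶ W.obj) := by
  constructor
  · intro h h' e
    exact ObjectProperty.hom_ext _ (objL_hom_ext e)
  · intro f
    obtain ⟨h, hh⟩ := exists_desc A W.obj W.property f
    exact ⟨⟨h⟩, hh⟩

/-- Maps `L A ⟶ W` correspond to maps `A ⟶ W`. -/
def homEquivL (A : DeltaThetaSpace n) (W : Pcat n) :
    ((⟨objL A, isPcat_objL A⟩ : Pcat n) ⟶ W) ≃ (A ⟶ (isPcat n).ι.obj W) :=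
  Equiv.ofBijective _ (bijective_objL A W)

lemma homEquivL_naturality (A : DeltaThetaSpace n) (W W' : Pcat n) (g : W ⟶ W')
    (h : (⟨objL A, isPcat_objL A⟩ : Pcat n) ⟶ W) :
    homEquivL A W' (h ≫ g) = homEquivL A W h ≫ (isPcat n).ι.map g :=
  (Category.assoc (unitL A) h.hom g.hom).symm

/-- The left adjoint `L` of the inclusion of precategory objects. -/
def L (n : ℕ) : DeltaThetaSpace n ⥤ Pcat n :=
  Adjunction.leftAdjointOfEquiv (G := (isPcat n).ι) homEquivL homEquivL_naturality

/-- The adjunction `L ⊣ I`. -/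
def adjL (n : ℕ) : L n ⊣ (isPcat n).ι :=
  Adjunction.adjunctionOfEquivLeft (G := (isPcat n).ι) homEquivL homEquivL_naturality

instance : Reflective (isPcat n).ι where
  L := L n
  adj := adjL n

instance : HasPushouts (Pcat n) := hasColimitsOfShape_of_reflective (isPcat n).ι

/-! ### Basic objects -/

/-- The object `F[m, X] = F[m] × X`, functorially in `m` and `X`. -/
def F (n : ℕ) : SimplexCategory × ThetaSpace n ⥤ DeltaThetaSpace n where
  obj P :=
    { obj := fun x => (x.unop.1 ⟶ P.1) × P.2.obj (op x.unop.2)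
      map := fun f => ↾fun y => (f.unop.1 ≫ y.1, P.2.map f.unop.2.op y.2)
      map_id := fun x => by
        refine ConcreteCategory.hom_ext _ _ fun y => ?_
        exact congrArg₂ Prod.mk (Category.id_comp y.1) (ConcreteCategory.congr_hom (P.2.map_id _) y.2)
      map_comp := fun f g => by
        refine ConcreteCategory.hom_ext _ _ fun y => ?_
        exact congrArg₂ Prod.mk (Category.assoc (obj := SimplexCategory) _ _ _)
          (ConcreteCategory.congr_hom (P.2.map_comp f.unop.2.op g.unop.2.op) y.2) }
  map g :=
    { app := fun x => ↾fun y => (y.1 ≫ g.1, g.2.app _ y.2)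
      naturality := fun x x' f => by
        refine ConcreteCategory.hom_ext _ _ fun y => ?_
        exact congrArg₂ Prod.mk (Category.assoc (obj := SimplexCategory) _ _ _)
          (ConcreteCategory.congr_hom (g.2.naturality f.unop.2.op) y.2) }

/-- The functor `(-) + 1` on `Δ`, adding a new last vertex. -/
def plusOne {p q : SimplexCategory} (ν : p ⟶ q) : ⦋p.len + 1⦌ ⟶ ⦋q.len + 1⦌ :=
  SimplexCategory.Hom.mk
    { toFun := Fin.lastCases (Fin.last _) fun i => (ν.toOrderHom i).castSucc
      monotone' := by
        intro i j h
        induction j using Fin.lastCases with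
        | last => simpa using Fin.le_last _
        | cast j =>
          induction i using Fin.lastCases with
          | last => exact absurd (lt_of_le_of_lt h (Fin.castSucc_lt_last j)) (lt_irrefl _)
          | cast i => simpa using ν.toOrderHom.monotone (by simpa using h) }

/-- The coface `d^{p+1} : [p] ⟶ [p + 1]` missing the last vertex. -/
def dLast (p : SimplexCategory) : p ⟶ ⦋p.len + 1⦌ :=
  SimplexCategory.δ (n := p.len) (Fin.last (p.len + 1))

lemma plusOne_castSucc {p q : SimplexCategory} (ν : p ⟶ q) (i : Fin (p.len + 1)) :
    (plusOne ν).toOrderHom i.castSucc = (ν.toOrderHom i).castSucc :=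
  Fin.lastCases_castSucc (motive := fun _ => Fin (q.len + 2)) i

lemma plusOne_last {p q : SimplexCategory} (ν : p ⟶ q) :
    (plusOne ν).toOrderHom (Fin.last _) = Fin.last _ :=
  Fin.lastCases_last (motive := fun _ => Fin (q.len + 2))

lemma dLast_apply (p : SimplexCategory) (i : Fin (p.len + 1)) :
    (dLast p).toOrderHom i = i.castSucc :=
  Fin.succAbove_last_apply i

lemma hom_ext_fin {p q : SimplexCategory} {f g : p ⟶ q}
    (h : ∀ i, f.toOrderHom i = g.toOrderHom i) : f = g :=
  SimplexCategory.Hom.ext _ _ (OrderHom.ext _ _ (funext h))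

lemma dLast_plusOne {p q : SimplexCategory} (ν : p ⟶ q) :
    dLast p ≫ plusOne ν = ν ≫ dLast q := by
  refine hom_ext_fin fun i => ?_
  refine (congrArg (plusOne ν).toOrderHom (dLast_apply p i)).trans ?_
  exact (plusOne_castSucc ν i).trans (dLast_apply q _).symm

lemma plusOne_id (p : SimplexCategory) : plusOne (𝟙 p) = 𝟙 _ := by
  refine hom_ext_fin fun i => ?_
  refine Fin.lastCases ?_ (fun i => ?_) i
  · exact plusOne_last _
  · exact plusOne_castSucc _ i

lemma plusOne_comp {p q r : SimplexCategory} (ν : p ⟶ q) (ξ : q ⟶ r) :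
    plusOne (ν ≫ ξ) = plusOne ν ≫ plusOne ξ := by
  refine hom_ext_fin fun i => ?_
  refine Fin.lastCases ?_ (fun i => ?_) i
  · refine (plusOne_last _).trans ?_
    exact ((congrArg (plusOne ξ).toOrderHom (plusOne_last ν)).trans (plusOne_last ξ)).symm
  · refine (plusOne_castSucc _ i).trans ?_
    exact ((congrArg (plusOne ξ).toOrderHom (plusOne_castSucc ν i)).trans
      (plusOne_castSucc ξ _)).symm

end

noncomputable section

section

open Simplicial

/-! ### The simplicial category generated by a simplicial set

`c^h K` is the colimit, over the simplices `Δ[p] ⟶ K`, of the simplicial thickenings of `[p]`.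
Colimits of simplicial categories are computed in each simplicial degree `k`, and a colimit of
categories is presented by generators and relations, which is what we do. -/

/-- The simplicial set of maps from `i` to `j` in the simplicial thickening of `[p]`. -/
abbrev Thick (p : SimplexCategory) (i j : Fin (p.len + 1)) : SSet.{0} :=
  SimplicialThickening.mk i ⟶[SSet.{0}] SimplicialThickening.mk j

/-- The identity of `i`, in degree `k`. -/
def Thick.one (p : SimplexCategory) (i : Fin (p.len + 1)) (k : SimplexCategoryᵒᵖ) :
    (Thick p i i).obj k :=
  (eId SSet.{0} (SimplicialThickening.mk i)).app k PUnit.unit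

/-- The composite, in degree `k`. -/
def Thick.comp {p : SimplexCategory} {i j l : Fin (p.len + 1)} {k : SimplexCategoryᵒᵖ}
    (T : (Thick p i j).obj k) (S : (Thick p j l).obj k) : (Thick p i l).obj k :=
  (eComp SSet.{0} (SimplicialThickening.mk i) (SimplicialThickening.mk j)
    (SimplicialThickening.mk l)).app k (T, S)

/-- Functoriality of the simplicial thickening. -/
def Thick.map {p q : SimplexCategory} (α : p ⟶ q) (i j : Fin (p.len + 1)) :
    Thick p i j ⟶ Thick q (α.toOrderHom i) (α.toOrderHom j) :=
  (SimplicialThickening.functor α.toOrderHom).map (.mk i) (.mk j)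

/-- The `i`-th vertex of a simplex. -/
def vertex {K : SSet.{0}} {p : SimplexCategory} (σ : K.obj (op p)) (i : Fin (p.len + 1)) :
    K.obj (op ⦋0⦌) :=
  K.map (SimplexCategory.const ⦋0⦌ p i).op σ

/-- A simplicial set with a set `O` of names for its vertices; in all uses below `v` is a bijection. -/
structure Labelled where
  K : SSet.{0}
  O : Type
  v : O → K.obj (op ⦋0⦌)

@[ext]
structure Labelled.Hom (A B : Labelled) where
  f : A.K ⟶ B.K
  u : A.O → B.O
  hu : ∀ a, f.app (op ⦋0⦌) (A.v a) = B.v (u a)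

instance : Category Labelled where
  Hom := Labelled.Hom
  id A := ⟨𝟙 _, id, fun _ => rfl⟩
  comp g h := ⟨g.f ≫ h.f, h.u ∘ g.u, fun a =>
    (congrArg (h.f.app (op ⦋0⦌)) (g.hu a)).trans (h.hu _)⟩

/-- The objects of `c^h K` in degree `k` are the vertices of `K`, through their names. -/
def ChObj (A : Labelled) (_ : SimplexCategoryᵒᵖ) : Type := A.O

/-- The generating morphisms in degree `k`: a simplex `σ : Δ[p] ⟶ K` and a morphism of degree `k`
from `i` to `j` in the simplicial thickening of `[p]`. -/
structure ChGen (A : Labelled) (k : SimplexCategoryᵒᵖ) (a b : A.O) where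
  p : SimplexCategory
  σ : A.K.obj (op p)
  i : Fin (p.len + 1)
  j : Fin (p.len + 1)
  src : vertex σ i = A.v a
  tgt : vertex σ j = A.v b
  T : (Thick p i j).obj k

instance (A : Labelled) (k : SimplexCategoryᵒᵖ) : Quiver (ChObj A k) where
  Hom a b := ChGen A k a b

/-- The object with name `a` of the free category on the generators. -/
abbrev ChObj.mk {A : Labelled} (k : SimplexCategoryᵒᵖ) (a : A.O) : Paths (ChObj A k) := a

/-- The path of length one on a generator. -/
def ChGen.path {A : Labelled} {k : SimplexCategoryᵒᵖ} {a b : A.O} (g : ChGen A k a b) :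
    ChObj.mk k a ⟶ ChObj.mk k b :=
  Quiver.Hom.toPath (V := ChObj A k) g

end

/-- The relations: the simplicial thickening of every `σ` is mapped functorially, and compatibly
with the simplicial operators. -/
inductive ChRel (A : Labelled) (k : SimplexCategoryᵒᵖ) : HomRel (Paths (ChObj A k)) where
  | ident {a : A.O} {p : SimplexCategory} (σ : A.K.obj (op p)) (i : Fin (p.len + 1))
      (h : vertex σ i = A.v a) :
      ChRel A k (ChGen.path ⟨p, σ, i, i, h, h, Thick.one p i k⟩) (𝟙 (ChObj.mk k a))
  | comp {a b c : A.O} {p : SimplexCategory} (σ : A.K.obj (op p)) (i j l : Fin (p.len + 1))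
      (ha : vertex σ i = A.v a) (hb : vertex σ j = A.v b) (hc : vertex σ l = A.v c)
      (T : (Thick p i j).obj k) (S : (Thick p j l).obj k) :
      ChRel A k (ChGen.path ⟨p, σ, i, l, ha, hc, Thick.comp T S⟩)
        (ChGen.path ⟨p, σ, i, j, ha, hb, T⟩ ≫ ChGen.path ⟨p, σ, j, l, hb, hc, S⟩)
  | nat {a b : A.O} {p q : SimplexCategory} (α : p ⟶ q) (σ : A.K.obj (op q))
      (i j : Fin (p.len + 1)) (T : (Thick p i j).obj k)
      (ha : vertex σ (α.toOrderHom i) = A.v a) (hb : vertex σ (α.toOrderHom j) = A.v b)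
      (ha' : vertex (A.K.map α.op σ) i = A.v a) (hb' : vertex (A.K.map α.op σ) j = A.v b) :
      ChRel A k (ChGen.path ⟨q, σ, α.toOrderHom i, α.toOrderHom j, ha, hb, (Thick.map α i j).app k T⟩)
        (ChGen.path ⟨p, A.K.map α.op σ, i, j, ha', hb', T⟩)

section

open Simplicial

/-- The category `c^h K` in degree `k`. -/
abbrev Ch (A : Labelled) (k : SimplexCategoryᵒᵖ) : Type := CategoryTheory.Quotient (ChRel A k)

/-- The object with name `a`. -/
abbrev Ch.mk {A : Labelled} (k : SimplexCategoryᵒᵖ) (a : A.O) : Ch A k :=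
  ⟨ChObj.mk k a⟩

lemma vertex_map {K K' : SSet.{0}} (f : K ⟶ K') {p : SimplexCategory} (σ : K.obj (op p))
    (i : Fin (p.len + 1)) : vertex (f.app (op p) σ) i = f.app (op ⦋0⦌) (vertex σ i) :=
  (ConcreteCategory.congr_hom (f.naturality _) σ).symm

/-- Functoriality on generators. -/
def ChGen.map {A B : Labelled} (g : A ⟶ B) {k l : SimplexCategoryᵒᵖ} (κ : k ⟶ l) {a b : A.O}
    (x : ChGen A k a b) : ChGen B l (g.u a) (g.u b) where
  p := x.p
  σ := g.f.app (op x.p) x.σ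
  i := x.i
  j := x.j
  src := by rw [vertex_map, x.src, g.hu]
  tgt := by rw [vertex_map, x.tgt, g.hu]
  T := (Thick x.p x.i x.j).map κ x.T

/-- Functoriality on paths of generators. -/
def Ch.pathFunctor {A B : Labelled} (g : A ⟶ B) {k l : SimplexCategoryᵒᵖ} (κ : k ⟶ l) :
    Paths (ChObj A k) ⥤ Ch B l :=
  Paths.lift (V := ChObj A k)
    { obj := fun a => Ch.mk l (g.u a)
      map := fun x => (Quotient.functor (ChRel B l)).map (ChGen.path (ChGen.map g κ x)) }

lemma Ch.pathFunctor_path {A B : Labelled} (g : A ⟶ B) {k l : SimplexCategoryᵒᵖ} (κ : k ⟶ l)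
    {a b : A.O} (x : ChGen A k a b) : (Ch.pathFunctor g κ).map x.path =
      (Quotient.functor (ChRel B l)).map (ChGen.path (ChGen.map g κ x)) :=
  Paths.lift_toPath _ _

lemma Thick.map_one {p : SimplexCategory} {i : Fin (p.len + 1)} {k l : SimplexCategoryᵒᵖ}
    (κ : k ⟶ l) : (Thick p i i).map κ (Thick.one p i k) = Thick.one p i l :=
  (ConcreteCategory.congr_hom ((eId SSet.{0} (SimplicialThickening.mk i)).naturality κ)
    PUnit.unit).symm

lemma Thick.map_comp {p : SimplexCategory} {i j h : Fin (p.len + 1)} {k l : SimplexCategoryᵒᵖ}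
    (κ : k ⟶ l) (T : (Thick p i j).obj k) (S : (Thick p j h).obj k) :
    (Thick p i h).map κ (Thick.comp T S) =
      Thick.comp ((Thick p i j).map κ T) ((Thick p j h).map κ S) :=
  (congrArg (fun φ => (ConcreteCategory.hom φ) (T, S)) ((eComp SSet.{0}
    (SimplicialThickening.mk i) (SimplicialThickening.mk j) (SimplicialThickening.mk h)).naturality κ)).symm

lemma ChGen.congr_T {A : Labelled} {k : SimplexCategoryᵒᵖ} {a b : A.O} {p : SimplexCategory}
    {σ : A.K.obj (op p)} {i j : Fin (p.len + 1)} {hi : vertex σ i = A.v a}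
    {hj : vertex σ j = A.v b} {T T' : (Thick p i j).obj k} (h : T = T') :
    (⟨p, σ, i, j, hi, hj, T⟩ : ChGen A k a b) = ⟨p, σ, i, j, hi, hj, T'⟩ := by
  rw [h]

lemma ChGen.congr_σ {A : Labelled} {k : SimplexCategoryᵒᵖ} {a b : A.O} {p : SimplexCategory}
    {σ σ' : A.K.obj (op p)} {i j : Fin (p.len + 1)} {hi : vertex σ i = A.v a}
    {hj : vertex σ j = A.v b} {hi' : vertex σ' i = A.v a}
    {hj' : vertex σ' j = A.v b} {T : (Thick p i j).obj k} (h : σ = σ') :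
    (⟨p, σ, i, j, hi, hj, T⟩ : ChGen A k a b) = ⟨p, σ', i, j, hi', hj', T⟩ := by
  subst h
  rfl

lemma Ch.pathFunctor_rel {A B : Labelled} (g : A ⟶ B) {k l : SimplexCategoryᵒᵖ} (κ : k ⟶ l)
    {a b : Paths (ChObj A k)} (x y : a ⟶ b) (h : ChRel A k x y) :
    (Ch.pathFunctor g κ).map x = (Ch.pathFunctor g κ).map y := by
  cases h with
  | ident σ i h =>
    rw [Ch.pathFunctor_path]
    have := CategoryTheory.Quotient.sound _ (ChRel.ident (k := l) (g.f.app _ σ) i (by rw [vertex_map, h, g.hu]))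
    refine Eq.trans ?_ (this.trans
      (CategoryTheory.Functor.map_id (Ch.pathFunctor g κ) (ChObj.mk k _)).symm)
    exact congrArg (fun x => (Quotient.functor (ChRel B l)).map (ChGen.path x))
      (ChGen.congr_T (Thick.map_one κ))
  | comp σ i j h ha hb hc T S =>
    have := CategoryTheory.Quotient.sound _ (ChRel.comp (k := l) (g.f.app _ σ) i j h
      (by rw [vertex_map, ha, g.hu]) (by rw [vertex_map, hb, g.hu]) (by rw [vertex_map, hc, g.hu])
      ((Thick _ i j).map κ T) ((Thick _ j h).map κ S))
    rw [Functor.map_comp, Ch.pathFunctor_path, Ch.pathFunctor_path, Ch.pathFunctor_path]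
    refine Eq.trans ?_ (this.trans (Functor.map_comp _ _ _))
    exact congrArg (fun x => (Quotient.functor (ChRel B l)).map (ChGen.path x))
      (ChGen.congr_T (Thick.map_comp κ T S))
  | nat α σ i j T ha hb ha' hb' =>
    have e : g.f.app _ (A.K.map α.op σ) = B.K.map α.op (g.f.app _ σ) :=
      ConcreteCategory.congr_hom (g.f.naturality α.op) σ
    have := CategoryTheory.Quotient.sound _ (ChRel.nat (k := l) α (g.f.app _ σ) i j
      ((Thick _ i j).map κ T)
      (by rw [vertex_map, ha, g.hu]) (by rw [vertex_map, hb, g.hu])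
      (by rw [← e, vertex_map, ha', g.hu]) (by rw [← e, vertex_map, hb', g.hu]))
    rw [Ch.pathFunctor_path, Ch.pathFunctor_path]
    refine Eq.trans ?_ (this.trans ?_)
    · exact congrArg (fun x => (Quotient.functor (ChRel B l)).map (ChGen.path x))
        (ChGen.congr_T (ConcreteCategory.congr_hom ((Thick.map α i j).naturality κ) T).symm)
    · exact congrArg (fun x => (Quotient.functor (ChRel B l)).map (ChGen.path x))
        (ChGen.congr_σ e.symm)

/-- Functoriality of `c^h`. -/
def Ch.functor {A B : Labelled} (g : A ⟶ B) {k l : SimplexCategoryᵒᵖ} (κ : k ⟶ l) :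
    Ch A k ⥤ Ch B l :=
  CategoryTheory.Quotient.lift _ (Ch.pathFunctor g κ) fun _ _ x y h => Ch.pathFunctor_rel g κ x y h

/-- The set of morphisms of degree `k` from `a` to `b` in `c^h K`. -/
abbrev Ch.Hom (A : Labelled) (k : SimplexCategoryᵒᵖ) (a b : A.O) : Type := Ch.mk k a ⟶ Ch.mk k b

/-- The morphism given by a generator. -/
abbrev ChGen.toHom {A : Labelled} {k : SimplexCategoryᵒᵖ} {a b : A.O} (x : ChGen A k a b) :
    Ch.Hom A k a b :=
  (Quotient.functor (ChRel A k)).map x.path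

lemma Ch.functor_toHom {A B : Labelled} (g : A ⟶ B) {k l : SimplexCategoryᵒᵖ} (κ : k ⟶ l)
    {a b : A.O} (x : ChGen A k a b) : (Ch.functor g κ).map x.toHom = (ChGen.map g κ x).toHom :=
  Ch.pathFunctor_path g κ x

lemma Ch.induction {A : Labelled} {k : SimplexCategoryᵒᵖ}
    (P : ∀ a b : A.O, Ch.Hom A k a b → Prop) (one : ∀ a, P a a (𝟙 _))
    (comp : ∀ a b c (f : Ch.Hom A k a b) (x : ChGen A k b c), P a b f → P a c (f ≫ x.toHom))
    {a b : A.O} (f : Ch.Hom A k a b) : P a b f := by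
  obtain ⟨f, rfl⟩ := (Quotient.functor (ChRel A k)).map_surjective f
  change Quiver.Path (V := ChObj A k) a b at f
  induction f with
  | nil => exact one _
  | cons p x ih => exact comp _ _ _ _ x ih

/-- Functoriality of the morphism sets, with prescribed endpoints in the target. -/
def Ch.homMap {A B : Labelled} (g : A ⟶ B) {k l : SimplexCategoryᵒᵖ} (κ : k ⟶ l) {a b : A.O}
    {a' b' : B.O} (ha : g.u a = a') (hb : g.u b = b') (f : Ch.Hom A k a b) : Ch.Hom B l a' b' :=
  ha ▸ hb ▸ ((Ch.functor g κ).map f : Ch.Hom B l (g.u a) (g.u b))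

section homMap

variable {A B C : Labelled} (g : A ⟶ B) (h : B ⟶ C) {k l m : SimplexCategoryᵒᵖ} (κ : k ⟶ l)
  (κ' : l ⟶ m)

lemma Ch.homMap_one {a : A.O} {a' : B.O} (ha ha' : g.u a = a') :
    Ch.homMap g κ ha ha' (𝟙 _) = 𝟙 _ := by
  subst ha
  exact CategoryTheory.Functor.map_id _ _

lemma Ch.homMap_mul {a b c : A.O} {a' b' c' : B.O} (ha : g.u a = a') (hb : g.u b = b')
    (hc : g.u c = c') (x : Ch.Hom A k a b) (y : Ch.Hom A k b c) :
    Ch.homMap g κ ha hc (x ≫ y) = Ch.homMap g κ ha hb x ≫ Ch.homMap g κ hb hc y := by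
  subst ha hb hc
  exact Functor.map_comp _ _ _

lemma Ch.homMap_toHom {a b : A.O} (x : ChGen A k a b) :
    Ch.homMap g κ rfl rfl x.toHom = (ChGen.map g κ x).toHom := by
  exact Ch.functor_toHom g κ x

lemma Ch.homMap_refl {a b : A.O} (x : Ch.Hom A k a b) :
    Ch.homMap (𝟙 A) (𝟙 k) (a' := a) (b' := b) rfl rfl x = x := by
  induction x using Ch.induction with
  | one a => exact Ch.homMap_one _ _ _ _
  | comp a b c f x ih =>
    refine (Ch.homMap_mul (𝟙 A) (𝟙 k) rfl rfl rfl f x.toHom).trans ?_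
    refine congrArg₂ (· ≫ ·) ih ((Ch.homMap_toHom (𝟙 A) (𝟙 k) x).trans ?_)
    obtain ⟨p, σ, i, j, hs, ht, T⟩ := x
    exact congrArg ChGen.toHom
      (ChGen.congr_T (ConcreteCategory.congr_hom ((Thick p i j).map_id k) T))

lemma Ch.homMap_comp {a b : A.O} {a' b' : B.O} {a'' b'' : C.O} (ha : g.u a = a')
    (hb : g.u b = b') (ha' : h.u a' = a'') (hb' : h.u b' = b'') (ha'' : (g ≫ h).u a = a'')
    (hb'' : (g ≫ h).u b = b'') (x : Ch.Hom A k a b) :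
    Ch.homMap (g ≫ h) (κ ≫ κ') ha'' hb'' x = Ch.homMap h κ' ha' hb' (Ch.homMap g κ ha hb x) := by
  subst ha hb ha' hb'
  induction x using Ch.induction with
  | one a =>
    rw [Ch.homMap_one g κ]
    exact (Ch.homMap_one _ _ _ _).trans (Ch.homMap_one _ _ _ _).symm
  | comp a b c f x ih =>
    rw [Ch.homMap_mul g κ rfl rfl rfl]
    refine (Ch.homMap_mul (g ≫ h) (κ ≫ κ') rfl rfl rfl f x.toHom).trans ?_
    refine Eq.trans ?_ (Ch.homMap_mul h κ' rfl rfl rfl _ _).symm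
    refine congrArg₂ (· ≫ ·) (ih rfl rfl) ((Ch.homMap_toHom (g ≫ h) (κ ≫ κ') x).trans ?_)
    rw [Ch.homMap_toHom g, Ch.homMap_toHom h]
    obtain ⟨p, σ, i, j, hs, ht, T⟩ := x
    exact congrArg ChGen.toHom
      (ChGen.congr_T (ConcreteCategory.congr_hom ((Thick p i j).map_comp κ κ') T))

end homMap

end

end

noncomputable section

open Simplicial

/-! ### The homotopy coherent categorification

For a precategory object `W`, the category `𝔠 W` enriched in `Θ_n`-spaces has the set `W₀` of
objects, and its hom `Θ_n`-spaces are obtained by applying `c^h` to the simplicial sets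
`W_{-,θ,l}`, and by taking the diagonal of the two space directions. -/

lemma Ch.homMap_refl' {A : Labelled} {k : SimplexCategoryᵒᵖ} {g : A ⟶ A} (hg : g = 𝟙 A)
    {κ : k ⟶ k} (hκ : κ = 𝟙 k) {a b : A.O} (ha : g.u a = a) (hb : g.u b = b)
    (x : Ch.Hom A k a b) : Ch.homMap g κ ha hb x = x := by
  subst hg hκ
  exact Ch.homMap_refl x

lemma Ch.homMap_comp' {A B C : Labelled} (g : A ⟶ B) (h : B ⟶ C) {k l m : SimplexCategoryᵒᵖ}
    (κ : k ⟶ l) (κ' : l ⟶ m) {gh : A ⟶ C} (hgh : gh = g ≫ h) {κκ' : k ⟶ m} (hκ : κκ' = κ ≫ κ')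
    {a b : A.O} {a' b' : B.O} {a'' b'' : C.O} (ha : g.u a = a')
    (hb : g.u b = b') (ha' : h.u a' = a'') (hb' : h.u b' = b'') (ha'' : gh.u a = a'')
    (hb'' : gh.u b = b'') (x : Ch.Hom A k a b) :
    Ch.homMap gh κκ' ha'' hb'' x = Ch.homMap h κ' ha' hb' (Ch.homMap g κ ha hb x) := by
  subst hgh hκ
  exact Ch.homMap_comp g h κ κ' ha hb ha' hb' ha'' hb'' x

variable {n : ℕ}

/-- The set of objects of `𝔠 W`, that is, the set `W₀`. -/
def CObj (W : Pcat n) : Type := W.obj.obj (op (⦋0⦌, Cell.pt n))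

/-- Functoriality of the set of objects. -/
def CObj.map {W W' : Pcat n} (g : W ⟶ W') (a : CObj W) : CObj W' :=
  g.hom.app (op (⦋0⦌, Cell.pt n)) a

lemma map_map {W : DeltaThetaSpace n} {x y z : (SimplexCategory × Cell n)ᵒᵖ} (f : x ⟶ y)
    (g : y ⟶ z) (h : x ⟶ z) (e : h.unop = g.unop ≫ f.unop) (a : W.obj x) :
    W.map g (W.map f a) = W.map h a := by
  obtain rfl : h = f ≫ g := Quiver.Hom.unop_inj e
  exact (ConcreteCategory.congr_hom (W.map_comp f g) a).symm

/-- The simplicial set `W_{-,d}`; as `W₀` is discrete its vertices are named by `CObj W`. -/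
def labObj (W : Pcat n) (d : (Cell n)ᵒᵖ) : Labelled where
  K := W.obj.column d.unop
  O := CObj W
  v := W.obj.map (Quiver.Hom.op
    ((𝟙 _, d.unop.toPt) : ((⦋0⦌, d.unop) : SimplexCategory × Cell n) ⟶ (⦋0⦌, Cell.pt n)))

/-- The simplicial set `W_{-,d}`, functorially in `d`. -/
def lab (W : Pcat n) : (Cell n)ᵒᵖ ⥤ Labelled where
  obj := labObj W
  map {d e} f :=
    { f :=
        { app := fun x => W.obj.map (Quiver.Hom.op
            ((𝟙 _, f.unop) : ((x.unop, e.unop) : SimplexCategory × Cell n) ⟶ (x.unop, d.unop)))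
          naturality := fun x y g => by
            refine ConcreteCategory.hom_ext _ _ fun a => ?_
            refine (map_map _ _ (Quiver.Hom.op ((g.unop, f.unop) :
              ((y.unop, e.unop) : SimplexCategory × Cell n) ⟶ (x.unop, d.unop))) ?_ a).trans
              (map_map _ _ _ ?_ a).symm
            · exact Prod.ext (Category.id_comp _).symm (Category.comp_id _).symm
            · exact Prod.ext (Category.comp_id _).symm (Category.id_comp _).symm }
      u := id
      hu := fun a => map_map _ _ _ (Prod.ext (Category.id_comp _).symm (Cell.toPt_unique _ _)) a }
  map_id d := by
    refine Labelled.Hom.ext ?_ rfl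
    ext x a
    exact ConcreteCategory.congr_hom (W.obj.map_id _) a
  map_comp {d e e'} f g := by
    refine Labelled.Hom.ext ?_ rfl
    ext x a
    exact (map_map (W := W.obj) (Quiver.Hom.op ((𝟙 _, f.unop) :
        ((x.unop, e.unop) : SimplexCategory × Cell n) ⟶ (x.unop, d.unop)))
      (Quiver.Hom.op ((𝟙 _, g.unop) :
        ((x.unop, e'.unop) : SimplexCategory × Cell n) ⟶ (x.unop, e.unop)))
      (Quiver.Hom.op ((𝟙 _, (f ≫ g).unop) :
        ((x.unop, e'.unop) : SimplexCategory × Cell n) ⟶ (x.unop, d.unop)))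
      (Prod.ext (Category.id_comp _).symm rfl) a).symm

/-- Functoriality in `W`. -/
def labMap {W W' : Pcat n} (g : W ⟶ W') (d : (Cell n)ᵒᵖ) : labObj W d ⟶ labObj W' d where
  f := Functor.whiskerLeft _ g.hom
  u := CObj.map g
  hu := ConcreteCategory.congr_hom (g.hom.naturality _)

lemma labMap_naturality {W W' : Pcat n} (g : W ⟶ W') {d e : (Cell n)ᵒᵖ} (f : d ⟶ e) :
    (lab W).map f ≫ labMap g e = labMap g d ≫ (lab W').map f := by
  refine Labelled.Hom.ext ?_ rfl
  ext x a
  exact ConcreteCategory.congr_hom (g.hom.naturality _) a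

/-- The value at `d = (θ, l)` of the hom `Θ_n`-space: the set of maps of degree `l` in
`c^h(W_{-,θ,l})`. -/
abbrev CHomAt (W : Pcat n) (d : (Cell n)ᵒᵖ) (a b : CObj W) : Type :=
  Ch.Hom (labObj W d) (op d.unop.2) a b

/-- The operators of the hom `Θ_n`-spaces. -/
abbrev CHomAt.res {W : Pcat n} {d e : (Cell n)ᵒᵖ} (f : d ⟶ e) {a b : CObj W}
    (x : CHomAt W d a b) : CHomAt W e a b :=
  Ch.homMap ((lab W).map f) f.unop.2.op rfl rfl x

lemma CHomAt.res_id {W : Pcat n} {d : (Cell n)ᵒᵖ} {a b : CObj W} (x : CHomAt W d a b) :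
    x.res (𝟙 d) = x :=
  Ch.homMap_refl' ((lab W).map_id d) rfl _ _ x

lemma CHomAt.res_comp {W : Pcat n} {d e e' : (Cell n)ᵒᵖ} (f : d ⟶ e) (g : e ⟶ e') {a b : CObj W}
    (x : CHomAt W d a b) : x.res (f ≫ g) = (x.res f).res g :=
  Ch.homMap_comp' (a' := a) (b' := b) ((lab W).map f) ((lab W).map g) f.unop.2.op g.unop.2.op
    ((lab W).map_comp f g) rfl rfl rfl rfl rfl rfl rfl x

/-- The hom `Θ_n`-spaces of `𝔠 W`. -/
def CHom (W : Pcat n) (a b : CObj W) : ThetaSpace n where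
  obj d := CHomAt W d a b
  map f := ↾fun x => CHomAt.res f x
  map_id _ := ConcreteCategory.hom_ext _ _ CHomAt.res_id
  map_comp f g := ConcreteCategory.hom_ext _ _ (CHomAt.res_comp f g)

instance (W : Pcat n) : EnrichedCategory (ThetaSpace n) (CObj W) where
  Hom := CHom W
  id a :=
    { app := fun d => ↾fun _ => (𝟙 (Ch.mk (A := labObj W d) _ a) : CHomAt W d a a)
      naturality := fun d e f => ConcreteCategory.hom_ext _ _ fun x =>
        (Ch.homMap_one ((lab W).map f) f.unop.2.op rfl rfl).symm }
  comp a b c :=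
    { app := fun d => ↾fun x => ((x.1 : CHomAt W d a b) ≫ (x.2 : CHomAt W d b c) : CHomAt W d a c)
      naturality := fun d e f => ConcreteCategory.hom_ext _ _ fun x =>
        (Ch.homMap_mul ((lab W).map f) f.unop.2.op rfl rfl rfl _ _).symm }
  id_comp a b := by
    ext d x
    exact Category.id_comp (x : CHomAt W d a b)
  comp_id a b := by
    ext d x
    exact Category.comp_id (x : CHomAt W d a b)
  assoc a b c d := by
    ext e x
    exact Category.assoc (x.1 : CHomAt W e a b) (x.2.1 : CHomAt W e b c) (x.2.2 : CHomAt W e c d)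

/-- Functoriality of the hom `Θ_n`-spaces in `W`, with prescribed endpoints in the target. -/
def CHomMap {W W' : Pcat n} (g : W ⟶ W') {a b : CObj W} {a' b' : CObj W'} (ha : CObj.map g a = a')
    (hb : CObj.map g b = b') : (a ⟶[ThetaSpace n] b) ⟶ (a' ⟶[ThetaSpace n] b') where
  app d := ↾fun x => (Ch.homMap (labMap g d) (𝟙 _) ha hb (x : CHomAt W d a b) : CHomAt W' d a' b')
  naturality d _ f := ConcreteCategory.hom_ext _ _ fun x =>
    (Ch.homMap_comp' _ _ f.unop.2.op (𝟙 _) (labMap_naturality g f).symm (Category.comp_id _).symm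
      rfl rfl ha hb ha hb (x : CHomAt W d a b)).symm.trans
    (Ch.homMap_comp' (labMap g d) ((lab W').map f) (𝟙 _) f.unop.2.op rfl (Category.id_comp _).symm
      ha hb rfl rfl ha hb (x : CHomAt W d a b))

lemma eId_CHomMap {W W' : Pcat n} (g : W ⟶ W') {a : CObj W} {a' : CObj W'}
    (ha : CObj.map g a = a') : eId (ThetaSpace n) a ≫ CHomMap g ha ha = eId (ThetaSpace n) a' := by
  ext d x
  exact Ch.homMap_one (labMap g d) (𝟙 _) ha ha

lemma eComp_CHomMap {W W' : Pcat n} (g : W ⟶ W') {a b c : CObj W} {a' b' c' : CObj W'}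
    (ha : CObj.map g a = a') (hb : CObj.map g b = b') (hc : CObj.map g c = c') :
    eComp (ThetaSpace n) a b c ≫ CHomMap g ha hc =
      (CHomMap g ha hb ⊗ₘ CHomMap g hb hc) ≫ eComp (ThetaSpace n) a' b' c' := by
  ext d x
  exact Ch.homMap_mul (labMap g d) (𝟙 _) ha hb hc (x.1 : CHomAt W d a b) (x.2 : CHomAt W d b c)

lemma CHomMap_id {W : Pcat n} {g : W ⟶ W} (hg : g = 𝟙 W) {a b : CObj W} (ha : CObj.map g a = a)
    (hb : CObj.map g b = b) : CHomMap g ha hb = 𝟙 _ := by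
  subst hg
  ext d x
  exact Ch.homMap_refl' (g := labMap (𝟙 W) d) rfl rfl ha hb (x : CHomAt W d a b)

lemma CHomMap_comp {W W' W'' : Pcat n} (g : W ⟶ W') (h : W' ⟶ W'') {gh : W ⟶ W''}
    (hgh : g ≫ h = gh) {a b : CObj W} {a' b' : CObj W'} {a'' b'' : CObj W''}
    (ha : CObj.map g a = a') (hb : CObj.map g b = b') (ha' : CObj.map h a' = a'')
    (hb' : CObj.map h b' = b'') (ha'' : CObj.map gh a = a'') (hb'' : CObj.map gh b = b'') :
    CHomMap g ha hb ≫ CHomMap h ha' hb' = CHomMap gh ha'' hb'' := by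
  subst hgh
  ext d x
  exact (Ch.homMap_comp' (labMap g d) (labMap h d) (𝟙 _) (𝟙 _) (gh := labMap (g ≫ h) d) rfl
    (Category.id_comp _).symm ha hb ha' hb' ha'' hb'' (x : CHomAt W d a b)).symm

/-- Functoriality of `𝔠`. -/
def CMap {W W' : Pcat n} (g : W ⟶ W') :
    EnrichedFunctor (ThetaSpace n) (CObj W) (CObj W') where
  obj := CObj.map g
  map _ _ := CHomMap g rfl rfl
  map_id _ := eId_CHomMap g rfl
  map_comp _ _ _ := eComp_CHomMap g rfl rfl rfl

end

noncomputable section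

/-! ### Enriched presheaves -/

/-- A `V`-enriched functor `Cᵒᵖ ⥤ V`, given by its values and by the action of `C`. -/
structure EnrichedPresheaf (V : Type 1) [Category.{0} V] [MonoidalCategory V] (C : Type)
    [EnrichedCategory V C] where
  obj : C → V
  act : ∀ a b : C, (a ⟶[V] b) ⊗ obj b ⟶ obj a
  act_id : ∀ a, (λ_ (obj a)).inv ≫ eId V a ▷ obj a ≫ act a a = 𝟙 (obj a)
  act_comp : ∀ a b c, (α_ (a ⟶[V] b) (b ⟶[V] c) (obj c)).inv ≫ eComp V a b c ▷ obj c ≫ act a c =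
    (a ⟶[V] b) ◁ act b c ≫ act a b

namespace EnrichedPresheaf

variable {V : Type 1} [Category.{0} V] [MonoidalCategory V] {C : Type} [EnrichedCategory V C]
  {D : Type} [EnrichedCategory V D]

/-- A `V`-natural transformation. -/
@[ext]
structure Hom (P Q : EnrichedPresheaf V C) where
  app : ∀ a, P.obj a ⟶ Q.obj a
  naturality : ∀ a b, P.act a b ≫ app a = (a ⟶[V] b) ◁ app b ≫ Q.act a b

instance : Category (EnrichedPresheaf V C) where
  Hom := Hom
  id P := { app := fun _ => 𝟙 _, naturality := by simp }
  comp f g :=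
    { app := fun a => f.app a ≫ g.app a
      naturality := fun a b => by
        rw [← Category.assoc, f.naturality, Category.assoc, g.naturality,
          MonoidalCategory.whiskerLeft_comp, Category.assoc] }
  id_comp f := Hom.ext (funext fun _ => Category.id_comp _)
  comp_id f := Hom.ext (funext fun _ => Category.comp_id _)
  assoc f g h := Hom.ext (funext fun _ => Category.assoc _ _ _)

/-- Evaluation at an object. -/
def ev (V : Type 1) [Category.{0} V] [MonoidalCategory V] {C : Type} [EnrichedCategory V C]
    (a : C) : EnrichedPresheaf V C ⥤ V where
  obj P := P.obj a
  map f := f.app a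

/-- The representable presheaf `Hom_C(-, c)`. -/
def representable (V : Type 1) [Category.{0} V] [MonoidalCategory V] {C : Type}
    [EnrichedCategory V C] (c : C) : EnrichedPresheaf V C where
  obj a := a ⟶[V] c
  act a b := eComp V a b c
  act_id a := e_id_comp V a c
  act_comp a b d := e_assoc V a b d c

/-- Restriction of presheaves along an enriched functor. -/
def restrict (Φ : EnrichedFunctor V C D) (P : EnrichedPresheaf V D) : EnrichedPresheaf V C where
  obj a := P.obj (Φ.obj a)
  act a b := Φ.map a b ▷ P.obj (Φ.obj b) ≫ P.act (Φ.obj a) (Φ.obj b)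
  act_id a := by
    rw [← comp_whiskerRight_assoc, Φ.map_id, P.act_id]
  act_comp a b c := by
    rw [← comp_whiskerRight_assoc, Φ.map_comp, comp_whiskerRight_assoc,
      MonoidalCategory.whiskerLeft_comp_assoc, MonoidalCategory.whisker_exchange_assoc,
      ← P.act_comp (Φ.obj a) (Φ.obj b) (Φ.obj c)]
    simp [MonoidalCategory.tensorHom_def']

section Colimits

variable {J : Type} [SmallCategory J] [HasColimitsOfSize.{0, 0} V]
  (Q : J ⥤ EnrichedPresheaf V C)

/-- The colimit of the values at `a`. -/
def colimObj (a : C) : V := colimit (Q ⋙ ev V a)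

/-- The legs of the colimit of the values at `a`. -/
def colimι (a : C) (j : J) : (Q.obj j).obj a ⟶ colimObj Q a := colimit.ι (Q ⋙ ev V a) j

lemma colimι_w (a : C) {j j' : J} (f : j ⟶ j') :
    (Q.map f).app a ≫ colimι Q a j' = colimι Q a j :=
  colimit.w (Q ⋙ ev V a) f

lemma colim_hom_ext {Z : V} {a : C} {f g : colimObj Q a ⟶ Z}
    (h : ∀ j, colimι Q a j ≫ f = colimι Q a j ≫ g) : f = g :=
  colimit.hom_ext h

/-- The map out of the colimit of the values at `a`. -/
def colimDesc (s : Cocone Q) (a : C) : colimObj Q a ⟶ s.pt.obj a :=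
  colimit.desc (Q ⋙ ev V a) ((ev V a).mapCocone s)

lemma ι_colimDesc (s : Cocone Q) (a : C) (j : J) :
    colimι Q a j ≫ colimDesc Q s a = (s.ι.app j).app a :=
  colimit.ι_desc ((ev V a).mapCocone s) j

variable [∀ X : V, PreservesColimitsOfSize.{0, 0} (tensorLeft X)]

/-- Tensoring with `X` preserves the colimit of the values at `a`. -/
def tensorIsColimit (X : V) (a : C) :
    IsColimit ((tensorLeft X).mapCocone (colimit.cocone (Q ⋙ ev V a))) :=
  isColimitOfPreserves _ (colimit.isColimit _)

lemma tensor_hom_ext {X Z : V} {a : C} {f g : X ⊗ colimObj Q a ⟶ Z}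
    (h : ∀ j, X ◁ colimι Q a j ≫ f = X ◁ colimι Q a j ≫ g) : f = g :=
  (tensorIsColimit Q X a).hom_ext h

lemma tensor_tensor_hom_ext {X Y Z : V} {a : C} {f g : X ⊗ (Y ⊗ colimObj Q a) ⟶ Z}
    (h : ∀ j, X ◁ Y ◁ colimι Q a j ≫ f = X ◁ Y ◁ colimι Q a j ≫ g) : f = g :=
  (isColimitOfPreserves (tensorLeft X) (tensorIsColimit Q Y a)).hom_ext h

/-- The action on the pointwise colimit. -/
def colimAct (a b : C) : (a ⟶[V] b) ⊗ colimObj Q b ⟶ colimObj Q a :=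
  (tensorIsColimit Q (a ⟶[V] b) b).desc
    ⟨_, { app := fun j => (Q.obj j).act a b ≫ colimι Q a j
          naturality := fun _ j' f => by
            refine Eq.trans ?_ (Category.comp_id _).symm
            change (a ⟶[V] b) ◁ (Q.map f).app b ≫ (Q.obj j').act a b ≫ colimι Q a j' = _
            rw [← colimι_w Q a f, ← Category.assoc, ← (Q.map f).naturality a b, Category.assoc]
            rfl }⟩

lemma ι_colimAct (a b : C) (j : J) :
    (a ⟶[V] b) ◁ colimι Q b j ≫ colimAct Q a b = (Q.obj j).act a b ≫ colimι Q a j :=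
  (tensorIsColimit Q (a ⟶[V] b) b).fac _ j

/-- The pointwise colimit. -/
def colim : EnrichedPresheaf V C where
  obj a := colimObj Q a
  act := colimAct Q
  act_id a := by
    refine colim_hom_ext Q fun j => ?_
    rw [leftUnitor_inv_naturality_assoc, whisker_exchange_assoc, ι_colimAct,
      Category.comp_id, ← Category.assoc, ← Category.assoc, Category.assoc _ _ ((Q.obj j).act a a),
      (Q.obj j).act_id, Category.id_comp]
  act_comp a b c := by
    refine tensor_tensor_hom_ext Q fun j => ?_
    rw [associator_inv_naturality_right_assoc, whisker_exchange_assoc, ι_colimAct,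
      ← MonoidalCategory.whiskerLeft_comp_assoc, ι_colimAct,
      MonoidalCategory.whiskerLeft_comp_assoc, ι_colimAct]
    have := congrArg (· ≫ colimι Q a j) ((Q.obj j).act_comp a b c)
    simpa only [Category.assoc] using this

/-- The pointwise colimit cocone. -/
def colimCocone : Cocone Q where
  pt := colim Q
  ι :=
    { app := fun j =>
        { app := fun a => colimι Q a j
          naturality := fun a b => (ι_colimAct Q a b j).symm }
      naturality := fun _ _ f => Hom.ext (funext fun a =>
        (colimι_w Q a f).trans (Category.comp_id _).symm) }

/-- The pointwise colimit is a colimit. -/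
def colimIsColimit : IsColimit (colimCocone Q) where
  desc s :=
    { app := colimDesc Q s
      naturality := fun a b => by
        refine tensor_hom_ext Q fun j => ?_
        change _ ◁ colimι Q b j ≫ colimAct Q a b ≫ colimDesc Q s a = _
        rw [← Category.assoc, ι_colimAct, Category.assoc, ι_colimDesc]
        have e : (a ⟶[V] b) ◁ colimι Q b j ≫ (a ⟶[V] b) ◁ colimDesc Q s b =
            (a ⟶[V] b) ◁ (s.ι.app j).app b := by
          rw [← MonoidalCategory.whiskerLeft_comp, ι_colimDesc]
        exact ((s.ι.app j).naturality a b).trans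
          ((congrArg (· ≫ s.pt.act a b) e.symm).trans (Category.assoc _ _ _)) }
  fac s j := Hom.ext (funext fun a => ι_colimDesc Q s a j)
  uniq s m h := Hom.ext (funext fun a => colim_hom_ext Q fun j =>
    (congrArg (fun φ => φ.app a) (h j)).trans (ι_colimDesc Q s a j).symm)

end Colimits

instance [HasColimitsOfSize.{0, 0} V] [∀ X : V, PreservesColimitsOfSize.{0, 0} (tensorLeft X)] :
    HasColimitsOfSize.{0, 0} (EnrichedPresheaf V C) where
  has_colimits_of_shape _ := ⟨fun Q => ⟨⟨⟨colimCocone Q, colimIsColimit Q⟩⟩⟩⟩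

end EnrichedPresheaf

end

noncomputable section

open Simplicial

variable {n : ℕ}

/-! ### The straightening functor -/

/-- The functor `[p] ↦ [p + 1]` in the categorical direction. -/
def succ (n : ℕ) : SimplexCategory × Cell n ⥤ SimplexCategory × Cell n where
  obj S := (⦋S.1.len + 1⦌, S.2)
  map f := (plusOne f.1, f.2)
  map_id S := congrArg₂ Prod.mk (plusOne_id S.1) rfl
  map_comp f g := congrArg₂ Prod.mk (plusOne_comp f.1 g.1) rfl

/-- The natural map `d^{p+1} : [p] ⟶ [p + 1]`. -/
def incl (n : ℕ) : 𝟭 _ ⟶ succ n where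
  app S := (dLast S.1, 𝟙 S.2)
  naturality _ _ f := congrArg₂ Prod.mk (dLast_plusOne f.1).symm
    ((Category.comp_id f.2).trans (Category.id_comp f.2).symm)

/-- The object `L F[p, θ, k]`. -/
def LF (n : ℕ) : SimplexCategory × Cell n ⥤ Pcat n := yoneda ⋙ L n

/-- The map `L F[p, θ, k] ⟶ W` given by an element `σ` of `W_{p,θ,k}`. -/
def adjunct {W : Pcat n} (σ : CostructuredArrow yoneda W.obj) : (LF n).obj σ.left ⟶ W :=
  ((adjL n).homEquiv _ _).symm σ.hom

lemma adjunct_naturality {W : Pcat n} {σ τ : CostructuredArrow yoneda W.obj} (f : σ ⟶ τ) :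
    (LF n).map f.left ≫ adjunct τ = adjunct σ := by
  refine ((adjL n).homEquiv_naturality_left_symm (yoneda.map f.left) τ.hom).symm.trans ?_
  exact congrArg ((adjL n).homEquiv _ _).symm (CostructuredArrow.w f)

/-- `W_σ`, the pushout of `W ⟵ L F[p, θ, k] ⟶ L F[p + 1, θ, k]`. -/
def Cone {W : Pcat n} (σ : CostructuredArrow yoneda W.obj) : Pcat n :=
  pushout (adjunct σ) ((LF n).map ((incl n).app σ.left))

/-- The inclusion `W ⟶ W_σ`. -/
def Cone.ι {W : Pcat n} (σ : CostructuredArrow yoneda W.obj) : W ⟶ Cone σ :=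
  pushout.inl _ _

/-- The map `L F[p + 1, θ, k] ⟶ W_σ`. -/
def Cone.simplex {W : Pcat n} (σ : CostructuredArrow yoneda W.obj) :
    (LF n).obj ((succ n).obj σ.left) ⟶ Cone σ :=
  pushout.inr _ _

/-- Functoriality of `W_σ`. -/
def Cone.map {W : Pcat n} {σ τ : CostructuredArrow yoneda W.obj} (f : σ ⟶ τ) : Cone σ ⟶ Cone τ :=
  pushout.desc (Cone.ι τ) ((LF n).map ((succ n).map f.left) ≫ Cone.simplex τ) (by
    rw [← Category.assoc, ← Functor.map_comp, ← (incl n).naturality, Functor.map_comp,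
      Category.assoc]
    refine Eq.trans ?_ (congrArg ((LF n).map f.left ≫ ·) pushout.condition)
    rw [← adjunct_naturality f, Category.assoc]
    rfl)

lemma Cone.ι_map {W : Pcat n} {σ τ : CostructuredArrow yoneda W.obj} (f : σ ⟶ τ) :
    Cone.ι σ ≫ Cone.map f = Cone.ι τ :=
  pushout.inl_desc _ _ _

lemma Cone.simplex_map {W : Pcat n} {σ τ : CostructuredArrow yoneda W.obj} (f : σ ⟶ τ) :
    Cone.simplex σ ≫ Cone.map f = (LF n).map ((succ n).map f.left) ≫ Cone.simplex τ :=
  pushout.inr_desc _ _ _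

lemma Cone.map_id {W : Pcat n} (σ : CostructuredArrow yoneda W.obj) :
    Cone.map (𝟙 σ) = 𝟙 (Cone σ) := by
  refine pushout.hom_ext ?_ ?_
  · exact (Cone.ι_map _).trans (Category.comp_id _).symm
  · refine (Cone.simplex_map _).trans (Eq.trans ?_ (Category.comp_id _).symm)
    have e : (LF n).map ((succ n).map (CommaMorphism.left (𝟙 σ))) = 𝟙 _ :=
      ((succ n ⋙ LF n).map_id σ.left)
    exact (congrArg (· ≫ Cone.simplex σ) e).trans (Category.id_comp _)

lemma Cone.map_comp {W : Pcat n} {σ τ ρ : CostructuredArrow yoneda W.obj} (f : σ ⟶ τ) (g : τ ⟶ ρ) :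
    Cone.map f ≫ Cone.map g = Cone.map (f ≫ g) := by
  refine pushout.hom_ext ?_ ?_
  · change Cone.ι σ ≫ _ = Cone.ι σ ≫ _
    rw [← Category.assoc, Cone.ι_map, Cone.ι_map, Cone.ι_map]
  · change Cone.simplex σ ≫ _ = Cone.simplex σ ≫ _
    rw [← Category.assoc, Cone.simplex_map, Cone.simplex_map, Category.assoc, Cone.simplex_map,
      ← Category.assoc]
    exact congrArg (· ≫ Cone.simplex ρ) ((succ n ⋙ LF n).map_comp f.left g.left).symm

lemma isPcat_map_eq {W : DeltaThetaSpace n} (hW : isPcat n W) {d e : (Cell n)ᵒᵖ} (f g : d ⟶ e) :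
    ((level 0).obj W).map f = ((level 0).obj W).map g := by
  obtain ⟨S, ⟨φ⟩⟩ := hW
  have h (k : d ⟶ e) : ((level 0).obj W).map k = φ.inv.app d ≫ φ.hom.app e := by
    rw [← cancel_epi (φ.hom.app d), ← φ.hom.naturality k, φ.hom_inv_id_app_assoc]
    exact Category.id_comp _
  rw [h f, h g]

/-- The vertex `i` of `L F[p, θ, k]`. -/
def LFvertex (S : SimplexCategory × Cell n) (i : Fin (S.1.len + 1)) : CObj ((LF n).obj S) :=
  ((adjL n).unit.app (yoneda.obj S)).app (op (⦋0⦌, Cell.pt n))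
    ((SimplexCategory.const ⦋0⦌ S.1 i, S.2.fromPt) : (⦋0⦌, Cell.pt n) ⟶ S)

lemma LFvertex_map {S T : SimplexCategory × Cell n} (f : S ⟶ T) (i : Fin (S.1.len + 1)) :
    CObj.map ((LF n).map f) (LFvertex S i) = LFvertex T (f.1.toOrderHom i) := by
  let η := (adjL n).unit
  let v : (⦋0⦌, Cell.pt n) ⟶ S := (SimplexCategory.const ⦋0⦌ S.1 i, S.2.fromPt)
  have h1 : (η.app (yoneda.obj T)).app (op (⦋0⦌, Cell.pt n)) (v ≫ f) =
      CObj.map ((LF n).map f) (LFvertex S i) :=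
    ConcreteCategory.congr_hom (NatTrans.congr_app (η.naturality (yoneda.map f)) _) v
  refine h1.symm.trans ?_
  let e : (⦋0⦌, T.2) ⟶ T := (SimplexCategory.const ⦋0⦌ T.1 (f.1.toOrderHom i), 𝟙 T.2)
  have h2 (g : Cell.pt n ⟶ T.2) :
      (η.app (yoneda.obj T)).app (op (⦋0⦌, Cell.pt n))
        ((SimplexCategory.const ⦋0⦌ T.1 (f.1.toOrderHom i), g) : (⦋0⦌, Cell.pt n) ⟶ T) =
      ((level 0).obj ((LF n).obj T).obj).map g.op ((η.app (yoneda.obj T)).app (op (⦋0⦌, T.2)) e) := by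
    refine Eq.trans ?_ (ConcreteCategory.congr_hom (((level 0).map (η.app (yoneda.obj T))).naturality
      g.op) e)
    refine congrArg ((η.app (yoneda.obj T)).app (op (⦋0⦌, Cell.pt n))) ?_
    exact congrArg₂ Prod.mk (SimplexCategory.Hom.ext _ _ rfl) (Category.comp_id g).symm
  refine Eq.trans ?_ ((h2 (S.2.fromPt ≫ f.2)).trans ?_)
  · rfl
  · rw [isPcat_map_eq ((LF n).obj T).property (S.2.fromPt ≫ f.2).op T.2.fromPt.op]
    exact (h2 _).symm

/-- The object `⊤` of `𝔠 W_σ`, the image of the vertex `p + 1` of `L F[p + 1, θ, k]`. -/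
def Cone.top {W : Pcat n} (σ : CostructuredArrow yoneda W.obj) : CObj (Cone σ) :=
  CObj.map (Cone.simplex σ) (LFvertex ((succ n).obj σ.left) (Fin.last _))

lemma CObj.map_map {W W' W'' : Pcat n} (g : W ⟶ W') (h : W' ⟶ W'') {gh : W ⟶ W''}
    (e : g ≫ h = gh) (a : CObj W) : CObj.map h (CObj.map g a) = CObj.map gh a := by
  subst e
  rfl

lemma Cone.map_top {W : Pcat n} {σ τ : CostructuredArrow yoneda W.obj} (f : σ ⟶ τ) :
    CObj.map (Cone.map f) (Cone.top σ) = Cone.top τ := by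
  refine (CObj.map_map _ _ (Cone.simplex_map f) _).trans ?_
  refine (CObj.map_map _ _ rfl _).symm.trans ?_
  refine congrArg (CObj.map (Cone.simplex τ)) ((LFvertex_map ((succ n).map f.left) _).trans ?_)
  exact congrArg (LFvertex _) (plusOne_last f.left.1)

lemma whisker_aux {V : Type 1} [Category.{0} V] [MonoidalCategory V] {A A' A'' B B' D D' : V}
    {i : A ⟶ A'} {g : A' ⟶ A''} {j : A ⟶ A''} (e : i ≫ g = j) {c : A' ⊗ B ⟶ D}
    {c' : A'' ⊗ B' ⟶ D'} {gb : B ⟶ B'} {gd : D ⟶ D'} (h : c ≫ gd = (g ⊗ₘ gb) ≫ c') :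
    (i ▷ B ≫ c) ≫ gd = A ◁ gb ≫ j ▷ B' ≫ c' := by
  rw [Category.assoc, h, ← e, MonoidalCategory.tensorHom_def]
  simp only [comp_whiskerRight, Category.assoc]
  rw [whisker_exchange_assoc, whisker_exchange_assoc]

/-- The straightening of a representable: `Hom_{𝔠 W_σ}(-, ⊤)`, restricted along `W ⟶ W_σ`. -/
def St₀ (W : Pcat n) :
    CostructuredArrow yoneda W.obj ⥤ EnrichedPresheaf (ThetaSpace n) (CObj W) where
  obj σ := (EnrichedPresheaf.representable (ThetaSpace n) (Cone.top σ)).restrict (CMap (Cone.ι σ))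
  map {σ τ} f :=
    { app := fun a => CHomMap (Cone.map f) (a := CObj.map (Cone.ι σ) a)
        (a' := CObj.map (Cone.ι τ) a) (CObj.map_map _ _ (Cone.ι_map f) a) (Cone.map_top f)
      naturality := fun a b => by
        have hx (x : CObj W) : CObj.map (Cone.map f) (CObj.map (Cone.ι σ) x) =
          CObj.map (Cone.ι τ) x := CObj.map_map _ _ (Cone.ι_map f) x
        exact whisker_aux (CHomMap_comp (Cone.ι σ) (Cone.map f) (Cone.ι_map f) rfl rfl
          (hx a) (hx b) rfl rfl) (eComp_CHomMap (Cone.map f) (hx a) (hx b) (Cone.map_top f)) }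
  map_id σ := EnrichedPresheaf.Hom.ext (funext fun a => CHomMap_id (Cone.map_id σ) _ _)
  map_comp f g := EnrichedPresheaf.Hom.ext (funext fun a =>
    (CHomMap_comp _ _ (Cone.map_comp f g) _ _ _ _ _ _).symm)

/-- The straightening functor `St_W`: the colimit-preserving extension of `St₀ W` to all objects
over `W`, which are identified with presheaves on the category of elements of `W`. -/
def St (W : Pcat n) : Over W.obj ⥤ EnrichedPresheaf (ThetaSpace n) (CObj W) :=
  (overEquivPresheafCostructuredArrow W.obj).functor ⋙ yoneda.leftKanExtension (St₀ W)

end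

noncomputable section

open Simplicial

/-! ### Necklaces -/

/-- A necklace `Δ[m₀] ∨ ⋯ ∨ Δ[m_t]`; if there is more than one bead, all beads have positive
dimension. -/
structure Necklace where
  t : ℕ
  dims : Fin (t + 1) → ℕ
  pos : 0 < t → ∀ j, 0 < dims j

namespace Necklace

variable (T : Necklace)

/-- The set of beads. -/
abbrev Bead : Type := Fin (T.t + 1)

/-- The last bead. -/
abbrev lastBead : T.Bead := Fin.last T.t

/-- The position `m₀ + ⋯ + m_{j-1}` of the `j`-th joint, that is, of the first vertex of the
`j`-th bead. -/
def joint (j : ℕ) : ℕ := ∑ i : T.Bead, if (i : ℕ) < j then T.dims i else 0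

/-- The position `m₀ + ⋯ + m_t` of the last vertex. -/
def total : ℕ := ∑ i, T.dims i

lemma joint_succ (j : T.Bead) : T.joint (j + 1) = T.joint j + T.dims j := by
  have h (i : T.Bead) : (if (i : ℕ) < j + 1 then T.dims i else 0) =
      (if (i : ℕ) < j then T.dims i else 0) + if i = j then T.dims i else 0 := by
    by_cases h1 : i = j
    · subst h1; simp
    · have : (i : ℕ) ≠ j := fun h => h1 (Fin.ext h)
      by_cases h2 : (i : ℕ) < j
      · simp [h2, h1]; omega
      · have : ¬ (i : ℕ) < j + 1 := by omega
        simp [h2, h1, this]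
  simp only [joint, h, Finset.sum_add_distrib]
  simp

lemma joint_mono {i j : ℕ} (h : i ≤ j) : T.joint i ≤ T.joint j := by
  refine Finset.sum_le_sum fun l _ => ?_
  split_ifs <;> omega

lemma joint_last : T.joint (T.t + 1) = T.total := by
  refine Finset.sum_congr rfl fun i _ => if_pos i.2

lemma joint_zero : T.joint 0 = 0 :=
  Finset.sum_eq_zero fun _ _ => if_neg (Nat.not_lt_zero _)

lemma joint_le_total (j : ℕ) : T.joint j ≤ T.total :=
  Finset.sum_le_sum fun l _ => by split_ifs <;> omega

/-- The `k`-simplex `s` of `Δ[m₀ + ⋯ + m_t]` lies on the bead `j`. -/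
def On {k : ℕ} (s : Fin (k + 1) →o Fin (T.total + 1)) (j : T.Bead) : Prop :=
  ∀ x, T.joint j ≤ s x ∧ (s x : ℕ) ≤ T.joint (j + 1)

/-- The wedge `Δ[m₀] ∨ ⋯ ∨ Δ[m_t]`, realised as the union of the faces of `Δ[m₀ + ⋯ + m_t]`
given by the beads. -/
def toSSet : SSet.{0} where
  obj k := { s : Fin (k.unop.len + 1) →o Fin (T.total + 1) // ∃ j, T.On s j }
  map f := ↾fun s => ⟨s.1.comp f.unop.toOrderHom, s.2.imp fun _ h x => h _⟩

/-- The first vertex. -/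
def α : T.toSSet.obj (op ⦋0⦌) :=
  ⟨⟨fun _ => 0, fun _ _ _ => le_rfl⟩, 0, fun _ => ⟨T.joint_zero.le, Nat.zero_le _⟩⟩

lemma on_lastBead_ω : T.On (k := 0) ⟨fun _ => Fin.last T.total, fun _ _ _ => le_rfl⟩ T.lastBead :=
  fun _ => ⟨T.joint_le_total T.t, T.joint_last.ge⟩

/-- The last vertex. -/
def ω : T.toSSet.obj (op ⦋0⦌) :=
  ⟨⟨fun _ => Fin.last T.total, fun _ _ _ => le_rfl⟩, T.lastBead, T.on_lastBead_ω⟩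

/-- The bead `j` as a map `[m_j] ⟶ [m₀ + ⋯ + m_t]`. -/
def beadHom (j : T.Bead) : Fin (T.dims j + 1) →o Fin (T.total + 1) where
  toFun x := ⟨T.joint j + x, by
    have h1 := T.joint_succ j
    have h2 := T.joint_le_total (j + 1)
    omega⟩
  monotone' _ _ h := Nat.add_le_add_left (Fin.le_def.1 h) _

lemma on_beadHom (j : T.Bead) : T.On (T.beadHom j) j := fun x => by
  have h1 := T.joint_succ j
  exact ⟨Nat.le_add_right _ _, h1 ▸ Nat.add_le_add_left (Nat.lt_succ_iff.1 x.2) _⟩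

/-- The bead `j` as a simplex. -/
def bead (j : T.Bead) : T.toSSet.obj (op ⦋T.dims j⦌) := ⟨T.beadHom j, j, T.on_beadHom j⟩

/-- A simplex on the bead `j` is obtained from the bead by a simplicial operator. -/
lemma exists_map_bead {k : SimplexCategory} (s : T.toSSet.obj (op k)) (j : T.Bead)
    (h : T.On s.1 j) : ∃ f : k ⟶ ⦋T.dims j⦌, T.toSSet.map f.op (T.bead j) = s := by
  have h1 := T.joint_succ j
  refine ⟨SimplexCategory.Hom.mk ⟨fun x => ⟨(s.1 x : ℕ) - T.joint j, ?_⟩, ?_⟩, ?_⟩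
  · have h2 : (s.1 x : ℕ) ≤ T.joint (j + 1) := (h x).2
    change _ < T.dims j + 1
    omega
  · intro x y hxy
    have : (s.1 x : ℕ) ≤ s.1 y := s.1.monotone hxy
    exact Nat.sub_le_sub_right this _
  · refine Subtype.ext (OrderHom.ext _ _ (funext fun x => Fin.ext ?_))
    exact Nat.add_sub_cancel' (h x).1

/-- A simplex on two beads is constant. -/
lemma eq_of_on {k : ℕ} {s : Fin (k + 1) →o Fin (T.total + 1)} {i j : T.Bead} (hi : T.On s i)
    (hj : T.On s j) (hij : i ≠ j) (x y : Fin (k + 1)) : s x = s y := by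
  wlog h : i < j generalizing i j
  · exact this hj hi hij.symm (lt_of_le_of_ne (not_lt.1 h) hij.symm)
  have h1 : T.joint (i + 1) ≤ T.joint j := T.joint_mono h
  have hx := hi x
  have hy := hi y
  have hx' := hj x
  have hy' := hj y
  refine Fin.ext ?_
  omega

/-- Only the last bead contains the last vertex. -/
lemma on_ω {j : T.Bead} (h : T.On T.ω.1 j) : j = T.lastBead := by
  by_contra hj
  have hlt : (j : ℕ) < T.t := lt_of_le_of_ne (Nat.lt_succ_iff.1 j.2) fun e => hj (Fin.ext e)
  have h1 : T.total ≤ T.joint (j + 1) := (h 0).2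
  have h2 := T.joint_succ ⟨j + 1, by omega⟩
  have h3 := T.pos (by omega) ⟨j + 1, by omega⟩
  have h4 := T.joint_le_total (j + 1 + 1)
  have h5 : T.joint (j + 1 + 1) = T.joint (j + 1) + T.dims ⟨j + 1, by omega⟩ := h2
  omega

/-- The simplicial set `T`, labelled by its own vertices. -/
def labelled : Labelled where
  K := T.toSSet
  O := T.toSSet.obj (op ⦋0⦌)
  v := id

end Necklace

/-- A totally non-degenerate necklace in `K` from `a` to `b`. -/
structure TndNec (K : SSet.{0}) (a b : K.obj (op ⦋0⦌)) where
  T : Necklace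
  p : T.toSSet ⟶ K
  p_α : p.app (op ⦋0⦌) T.α = a
  p_ω : p.app (op ⦋0⦌) T.ω = b
  tnd : ∀ j, p.app (op ⦋T.dims j⦌) (T.bead j) ∈ K.nonDegenerate (T.dims j)

namespace TndNec

variable {K : SSet.{0}} {a b : K.obj (op ⦋0⦌)}

/-- A map of necklaces in `K` from `a` to `b`. -/
@[ext]
structure Hom (U T : TndNec K a b) where
  g : U.T.toSSet ⟶ T.T.toSSet
  g_p : g ≫ T.p = U.p
  g_α : g.app (op ⦋0⦌) U.T.α = T.T.α
  g_ω : g.app (op ⦋0⦌) U.T.ω = T.T.ω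

instance : SmallCategory (TndNec K a b) where
  Hom := Hom
  id T := ⟨𝟙 _, Category.id_comp _, rfl, rfl⟩
  comp f g := ⟨f.g ≫ g.g, by rw [Category.assoc, g.g_p, f.g_p],
    (congrArg (g.g.app (op ⦋0⦌)) f.g_α).trans g.g_α,
    (congrArg (g.g.app (op ⦋0⦌)) f.g_ω).trans g.g_ω⟩

lemma g_p_apply {U T : TndNec K a b} (g : U ⟶ T) {k : SimplexCategoryᵒᵖ} (s : U.T.toSSet.obj k) :
    T.p.app k (g.g.app k s) = U.p.app k s :=
  ConcreteCategory.congr_hom (NatTrans.congr_app g.g_p k) s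

/-- The bead functor on morphisms: the bead `j` of `U` is mapped into the bead `B g j` of `T`. -/
def B {U T : TndNec K a b} (g : U ⟶ T) (j : U.T.Bead) : T.T.Bead :=
  (g.g.app _ (U.T.bead j)).2.choose

lemma on_B {U T : TndNec K a b} (g : U ⟶ T) (j : U.T.Bead) :
    T.T.On (g.g.app _ (U.T.bead j)).1 (B g j) :=
  (g.g.app _ (U.T.bead j)).2.choose_spec

lemma on_B_of_on {U T : TndNec K a b} (g : U ⟶ T) (j : U.T.Bead) {k : SimplexCategory}
    (s : U.T.toSSet.obj (op k)) (h : U.T.On s.1 j) : T.T.On (g.g.app (op k) s).1 (B g j) := by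
  obtain ⟨f, rfl⟩ := U.T.exists_map_bead s j h
  have : g.g.app (op k) (U.T.toSSet.map f.op (U.T.bead j)) =
    T.T.toSSet.map f.op (g.g.app _ (U.T.bead j)) := ConcreteCategory.congr_hom (g.g.naturality f.op) _
  rw [this]
  exact fun x => on_B g j _

lemma B_last {U T : TndNec K a b} (g : U ⟶ T) : B g U.T.lastBead = T.T.lastBead := by
  refine T.T.on_ω ?_
  rw [← g.g_ω]
  exact on_B_of_on g U.T.lastBead U.T.ω U.T.on_lastBead_ω

variable [hab : Fact (a ≠ b)]

lemma dims_pos (T : TndNec K a b) (j : T.T.Bead) : 0 < T.T.dims j := by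
  by_cases ht : 0 < T.T.t
  · exact T.T.pos ht j
  · by_contra hj
    have ht0 : T.T.t = 0 := by omega
    have hj0 : (j : ℕ) = 0 := by have := j.2; omega
    have h1 := T.T.joint_succ j
    have h2 := T.T.joint_last
    rw [ht0] at h2
    rw [hj0, T.T.joint_zero] at h1
    have h3 : T.T.total = 0 := by omega
    refine hab.out (T.p_α.symm.trans (Eq.trans ?_ T.p_ω))
    refine congrArg (T.p.app (op ⦋0⦌)) (Subtype.ext (OrderHom.ext _ _ (funext fun _ => Fin.ext ?_)))
    exact h3.symm

lemma bead_unique {U T : TndNec K a b} (g : U ⟶ T) (j : U.T.Bead) {i i' : T.T.Bead}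
    (h : T.T.On (g.g.app _ (U.T.bead j)).1 i) (h' : T.T.On (g.g.app _ (U.T.bead j)).1 i') :
    i = i' := by
  by_contra hne
  let s := g.g.app (op ⦋U.T.dims j⦌) (U.T.bead j)
  let r : ⦋U.T.dims j⦌ ⟶ ⦋0⦌ := SimplexCategory.const _ _ 0
  let c : ⦋0⦌ ⟶ ⦋U.T.dims j⦌ := SimplexCategory.const _ _ 0
  have hs : T.T.toSSet.map r.op (T.T.toSSet.map c.op s) = s :=
    Subtype.ext (OrderHom.ext _ _ (funext fun x => Necklace.eq_of_on T.T h h' hne 0 x))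
  refine U.tnd j ⟨0, U.dims_pos j, r, T.p.app (op ⦋0⦌) (T.T.toSSet.map c.op s), ?_⟩
  rw [← g_p_apply g (U.T.bead j)]
  exact (ConcreteCategory.congr_hom (T.p.naturality r.op) (T.T.toSSet.map c.op s)).symm.trans
    (congrArg (T.p.app (op ⦋U.T.dims j⦌)) hs)

lemma B_id (T : TndNec K a b) (j : T.T.Bead) : B (𝟙 T) j = j :=
  bead_unique (𝟙 T) j (on_B (𝟙 T) j) (T.T.on_beadHom j)

lemma B_comp {S U T : TndNec K a b} (f : S ⟶ U) (g : U ⟶ T) (j : S.T.Bead) :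
    B (f ≫ g) j = B g (B f j) :=
  bead_unique (f ≫ g) j (on_B (f ≫ g) j) (on_B_of_on g _ _ (on_B f j))

end TndNec

end

noncomputable section

open Simplicial

variable {n : ℕ}

/-! ### The right-hand side -/

/-- The vertex `i` of `Δ[m]`. -/
abbrev stdVertex {m : ℕ} (i : Fin (m + 1)) : (Δ[m] : SSet.{0}).obj (op ⦋0⦌) :=
  SSet.stdSimplex.const m i (op ⦋0⦌)

/-- The category of totally non-degenerate necklaces in `Δ[m + 1]` from `i` to `m + 1`. -/
abbrev TndNecTo (m : ℕ) (i : Fin (m + 1)) : Type :=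
  TndNec (Δ[m + 1] : SSet.{0}) (stdVertex i.castSucc) (stdVertex (Fin.last (m + 1)))

instance (m : ℕ) (i : Fin (m + 1)) :
    Fact (stdVertex i.castSucc ≠ stdVertex (Fin.last (m + 1))) where
  out h := (Fin.castSucc_lt_last i).ne
    (congrArg (fun s => (SSet.stdSimplex.objEquiv s).toOrderHom 0) h)

/-- The pairs `(μ, f)` of an injective map `μ : [ℓ] ⟶ [m]` and a monomorphism `f : X ⟶ Y` with `X`
connected. -/
def isMonoPair (m : ℕ) (Y : ThetaSpace n) : ObjectProperty (Over ⦋m⦌ × Over Y) :=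
  fun P => Function.Injective P.1.hom.toOrderHom ∧ Mono P.2.hom ∧
    ThetaSpace.Connected (n := n) P.2.left

/-- The category of these pairs, with maps over `[m]` and over `Y`. -/
abbrev MonoPair (m : ℕ) (Y : ThetaSpace n) := (isMonoPair m Y).FullSubcategory

namespace MonoPair

variable {m : ℕ} {Y : ThetaSpace n}

/-- The map `μ`. -/
abbrev μ (P : MonoPair m Y) : P.obj.1.left ⟶ ⦋m⦌ := P.obj.1.hom

/-- The object `X`. -/
abbrev X (P : MonoPair m Y) : ThetaSpace n := P.obj.2.left

/-- The map `f`. -/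
abbrev f (P : MonoPair m Y) : P.X ⟶ Y := P.obj.2.hom

end MonoPair

/-- The last bead of `T` is contained in the image of `μ + 1 : Δ[ℓ + 1] ⟶ Δ[m + 1]`. -/
def LastBeadIn {m : ℕ} {i : Fin (m + 1)} {ℓ : SimplexCategory} (μ : ℓ ⟶ ⦋m⦌) (T : TndNecTo m i) :
    Prop :=
  T.p.app _ (T.T.bead T.T.lastBead) ∈ Set.range ((SSet.stdSimplex.{0}.map (plusOne μ)).app
    (op ⦋T.T.dims T.T.lastBead⦌))

lemma LastBeadIn.res {m : ℕ} {i : Fin (m + 1)} {ℓ : SimplexCategory} {μ : ℓ ⟶ ⦋m⦌}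
    {U T : TndNecTo m i} (g : U ⟶ T) (h : LastBeadIn μ T) : LastBeadIn μ U := by
  have h0 := TndNec.on_B g U.T.lastBead
  rw [TndNec.B_last g] at h0
  obtain ⟨φ, hφ⟩ := T.T.exists_map_bead _ _ h0
  obtain ⟨s, hs⟩ := h
  refine ⟨(Δ[_]).map φ.op s, ?_⟩
  rw [← TndNec.g_p_apply g, ← hφ]
  refine ((SSet.stdSimplex.{0}.map (plusOne μ)).naturality_apply φ.op s).trans ?_
  rw [hs]
  exact (T.p.naturality_apply φ.op _).symm

lemma LastBeadIn.map {m : ℕ} {i : Fin (m + 1)} {ℓ ℓ' : SimplexCategory} {μ : ℓ ⟶ ⦋m⦌}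
    {μ' : ℓ' ⟶ ⦋m⦌} (ν : ℓ ⟶ ℓ') (e : ν ≫ μ' = μ) {T : TndNecTo m i} (h : LastBeadIn μ T) :
    LastBeadIn μ' T := by
  subst e
  obtain ⟨s, hs⟩ := h
  refine ⟨(SSet.stdSimplex.{0}.map (plusOne ν)).app _ s, ?_⟩
  refine Eq.trans ?_ hs
  rw [plusOne_comp]
  exact (ConcreteCategory.congr_hom (NatTrans.congr_app
    (SSet.stdSimplex.{0}.map_comp (plusOne ν) (plusOne μ')) _) s).symm

/-- The beads of `T` other than the last one. -/
abbrev Necklace.OtherBead (T : Necklace) : Type := { b : T.Bead // b ≠ T.lastBead }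

section G

variable {m : ℕ} {Y : ThetaSpace n} {i : Fin (m + 1)}

/-- The value of `G(T)` at `d`: the set `(∏_{b ≠ ω} Y_d) × X_d` if the last bead of `T` is contained
in the image of `μ + 1`, and the empty set otherwise. -/
@[ext]
structure GObj (P : MonoPair m Y) (T : TndNecTo m i) (d : (Cell n)ᵒᵖ) where
  y : T.T.OtherBead → Y.obj d
  x : P.X.obj d
  mem : LastBeadIn P.μ T

open Classical in
/-- The action of a map of necklaces: the coordinate of a bead `b` of `U` is that of the bead of `T`
containing it, with `f` applied to the coordinate in `X` if this is the last bead. -/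
def GObj.res {P : MonoPair m Y} {U T : TndNecTo m i} (g : U ⟶ T) {d : (Cell n)ᵒᵖ}
    (z : GObj P T d) : GObj P U d where
  y b := if h : TndNec.B g b.1 = T.T.lastBead then P.f.app d z.x else z.y ⟨TndNec.B g b.1, h⟩
  x := z.x
  mem := z.mem.res g

/-- The operators of the `Θ_n`-space `G(T)`. -/
def GObj.act {P : MonoPair m Y} {T : TndNecTo m i} {d e : (Cell n)ᵒᵖ} (φ : d ⟶ e)
    (z : GObj P T d) : GObj P T e where
  y b := Y.map φ (z.y b)
  x := P.X.map φ z.x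
  mem := z.mem

/-- Functoriality in `(μ, f)`. -/
def GObj.map {P P' : MonoPair m Y} (h : P ⟶ P') {T : TndNecTo m i} {d : (Cell n)ᵒᵖ}
    (z : GObj P T d) : GObj P' T d where
  y := z.y
  x := h.hom.2.left.app d z.x
  mem := z.mem.map h.hom.1.left (Over.w h.hom.1)

lemma GObj.res_y_of_eq {P : MonoPair m Y} {U T : TndNecTo m i} (g : U ⟶ T) {d : (Cell n)ᵒᵖ}
    (z : GObj P T d) (b : U.T.OtherBead) (h : TndNec.B g b.1 = T.T.lastBead) :
    (z.res g).y b = P.f.app d z.x :=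
  dif_pos h

lemma GObj.res_y_of_ne {P : MonoPair m Y} {U T : TndNecTo m i} (g : U ⟶ T) {d : (Cell n)ᵒᵖ}
    (z : GObj P T d) (b : U.T.OtherBead) (h : TndNec.B g b.1 ≠ T.T.lastBead) :
    (z.res g).y b = z.y ⟨TndNec.B g b.1, h⟩ :=
  dif_neg h

lemma GObj.res_id {P : MonoPair m Y} {T : TndNecTo m i} {d : (Cell n)ᵒᵖ} (z : GObj P T d) :
    z.res (𝟙 T) = z := by
  refine GObj.ext (funext fun b => ?_) rfl
  have h : TndNec.B (𝟙 T) b.1 = b.1 := TndNec.B_id T b.1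
  rw [GObj.res_y_of_ne (𝟙 T) z b (fun e => b.2 (h.symm.trans e))]
  exact congrArg z.y (Subtype.ext h)

lemma GObj.res_comp {P : MonoPair m Y} {S U T : TndNecTo m i} (f : S ⟶ U) (g : U ⟶ T)
    {d : (Cell n)ᵒᵖ} (z : GObj P T d) : z.res (f ≫ g) = (z.res g).res f := by
  refine GObj.ext (funext fun b => ?_) rfl
  have h : TndNec.B (f ≫ g) b.1 = TndNec.B g (TndNec.B f b.1) := TndNec.B_comp f g b.1
  by_cases h1 : TndNec.B f b.1 = U.T.lastBead
  · rw [GObj.res_y_of_eq f _ b h1, GObj.res_y_of_eq (f ≫ g) z b (by rw [h, h1, TndNec.B_last])]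
    rfl
  · rw [GObj.res_y_of_ne f _ b h1]
    by_cases h2 : TndNec.B g (TndNec.B f b.1) = T.T.lastBead
    · rw [GObj.res_y_of_eq g z ⟨_, h1⟩ h2, GObj.res_y_of_eq (f ≫ g) z b (h.trans h2)]
    · rw [GObj.res_y_of_ne g z ⟨_, h1⟩ h2,
        GObj.res_y_of_ne (f ≫ g) z b (fun e => h2 (h.symm.trans e))]
      exact congrArg z.y (Subtype.ext h)

lemma GObj.act_id {P : MonoPair m Y} {T : TndNecTo m i} {d : (Cell n)ᵒᵖ} (z : GObj P T d) :
    z.act (𝟙 d) = z :=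
  GObj.ext (funext fun b => ConcreteCategory.congr_hom (Y.map_id d) (z.y b))
    (ConcreteCategory.congr_hom (P.X.map_id d) z.x :)

lemma GObj.act_comp {P : MonoPair m Y} {T : TndNecTo m i} {d e e' : (Cell n)ᵒᵖ} (φ : d ⟶ e)
    (ψ : e ⟶ e') (z : GObj P T d) : z.act (φ ≫ ψ) = (z.act φ).act ψ :=
  GObj.ext (funext fun b => ConcreteCategory.congr_hom (Y.map_comp φ ψ) (z.y b))
    (ConcreteCategory.congr_hom (P.X.map_comp φ ψ) z.x :)

lemma GObj.res_act {P : MonoPair m Y} {U T : TndNecTo m i} (g : U ⟶ T) {d e : (Cell n)ᵒᵖ}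
    (φ : d ⟶ e) (z : GObj P T d) : (z.act φ).res g = (z.res g).act φ := by
  refine GObj.ext (funext fun b => ?_) rfl
  by_cases h : TndNec.B g b.1 = T.T.lastBead
  · refine (GObj.res_y_of_eq g _ b h).trans
      (Eq.trans ?_ (congrArg (Y.map φ) (GObj.res_y_of_eq g z b h)).symm)
    exact P.f.naturality_apply φ z.x
  · exact (GObj.res_y_of_ne g _ b h).trans (congrArg (Y.map φ) (GObj.res_y_of_ne g z b h)).symm

lemma GObj.map_act {P P' : MonoPair m Y} (h : P ⟶ P') {T : TndNecTo m i} {d e : (Cell n)ᵒᵖ}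
    (φ : d ⟶ e) (z : GObj P T d) : (z.act φ).map h = (z.map h).act φ :=
  GObj.ext rfl (NatTrans.naturality_apply h.hom.2.left φ z.x :)

lemma GObj.map_res {P P' : MonoPair m Y} (h : P ⟶ P') {U T : TndNecTo m i} (g : U ⟶ T)
    {d : (Cell n)ᵒᵖ} (z : GObj P T d) : (z.res g).map h = (z.map h).res g := by
  refine GObj.ext (funext fun b => ?_) rfl
  by_cases hb : TndNec.B g b.1 = T.T.lastBead
  · refine (GObj.res_y_of_eq g z b hb).trans (Eq.trans ?_ (GObj.res_y_of_eq g _ b hb).symm)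
    exact (ConcreteCategory.congr_hom (NatTrans.congr_app (Over.w h.hom.2) d) z.x).symm
  · exact (GObj.res_y_of_ne g z b hb).trans (GObj.res_y_of_ne g (z.map h) b hb).symm

/-- The functor `G` on totally non-degenerate necklaces, functorially in `(μ, f)`. -/
def G (m : ℕ) (Y : ThetaSpace n) (i : Fin (m + 1)) :
    MonoPair m Y ⥤ (TndNecTo m i)ᵒᵖ ⥤ ThetaSpace n where
  obj P :=
    { obj := fun T =>
        { obj := fun d => GObj P T.unop d
          map := fun φ => ↾GObj.act φ
          map_id := fun _ => ConcreteCategory.hom_ext _ _ GObj.act_id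
          map_comp := fun φ ψ => ConcreteCategory.hom_ext _ _ (GObj.act_comp φ ψ) }
      map := fun g =>
        { app := fun _ => ↾GObj.res g.unop
          naturality := fun _ _ φ => ConcreteCategory.hom_ext _ _ (GObj.res_act g.unop φ) }
      map_id := fun _ => NatTrans.ext (funext fun _ => ConcreteCategory.hom_ext _ _ GObj.res_id)
      map_comp := fun g g' => NatTrans.ext (funext fun _ =>
        ConcreteCategory.hom_ext _ _ (GObj.res_comp g'.unop g.unop)) }
  map h :=
    { app := fun _ =>
        { app := fun _ => ↾GObj.map h
          naturality := fun _ _ φ => ConcreteCategory.hom_ext _ _ (GObj.map_act h φ) }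
      naturality := fun _ _ g => NatTrans.ext (funext fun _ =>
        ConcreteCategory.hom_ext _ _ (GObj.map_res h g.unop)) }
  map_id _ := rfl
  map_comp _ _ := rfl

end G

/-- The hom simplicial set of `c^h K` from `a` to `b`. -/
def Ch.homSSet (A : Labelled) (a b : A.O) : SSet.{0} where
  obj k := Ch.Hom A k a b
  map κ := ↾Ch.homMap (𝟙 A) κ rfl rfl
  map_id _ := ConcreteCategory.hom_ext _ _ fun x => Ch.homMap_refl x
  map_comp κ κ' := ConcreteCategory.hom_ext _ _ fun x =>
    Ch.homMap_comp' (𝟙 A) (𝟙 A) κ κ' (Category.comp_id _).symm rfl rfl rfl rfl rfl rfl rfl x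

/-- The map of labelled simplicial sets given by a map of necklaces. -/
def TndNec.labMap {K : SSet.{0}} {a b : K.obj (op ⦋0⦌)} {U T : TndNec K a b} (g : U ⟶ T) :
    U.T.labelled ⟶ T.T.labelled where
  f := g.g
  u := g.g.app (op ⦋0⦌)
  hu _ := rfl

/-- The weight `T ↦ Hom_{c^h T}(α, ω)`. -/
def H (m : ℕ) (i : Fin (m + 1)) : TndNecTo m i ⥤ SSet.{0} where
  obj T := Ch.homSSet T.T.labelled T.T.α T.T.ω
  map g :=
    { app := fun k => ↾Ch.homMap (TndNec.labMap g) (𝟙 k) g.g_α g.g_ω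
      naturality := fun k l κ => ConcreteCategory.hom_ext _ _ fun x =>
        (Ch.homMap_comp' (𝟙 _) (TndNec.labMap g) κ (𝟙 l) (Category.id_comp _).symm
          (Category.comp_id κ).symm rfl rfl g.g_α g.g_ω g.g_α g.g_ω x).symm.trans
        (Ch.homMap_comp' (TndNec.labMap g) (𝟙 _) (𝟙 k) κ (Category.comp_id _).symm
          (Category.id_comp κ).symm g.g_α g.g_ω rfl rfl g.g_α g.g_ω x) }
  map_id T := NatTrans.ext (funext fun _ => ConcreteCategory.hom_ext _ _ fun x =>
    Ch.homMap_refl' (g := TndNec.labMap (𝟙 T)) rfl rfl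
      (show _ = _ from TndNec.Hom.g_α (𝟙 T)) (show _ = _ from TndNec.Hom.g_ω (𝟙 T)) x)
  map_comp f g := NatTrans.ext (funext fun k => ConcreteCategory.hom_ext _ _ fun x =>
    Ch.homMap_comp' (TndNec.labMap f) (TndNec.labMap g) (𝟙 k) (𝟙 k) (gh := TndNec.labMap (f ≫ g))
      rfl (Category.comp_id _).symm f.g_α f.g_ω g.g_α g.g_ω _ _ x)

/-- The category `(sSet)^{Θ_nᵒᵖ × Δᵒᵖ}`, which is enriched, tensored and cotensored over `sSet`. -/
abbrev SpaceValued (n : ℕ) := (Cell n)ᵒᵖ ⥤ SSet.{0}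

/-- The inclusion of `Θ_n`-spaces as the objects with discrete values. -/
def ι (n : ℕ) : ThetaSpace n ⥤ SpaceValued n :=
  (Functor.whiskeringRight _ _ _).obj (Functor.const SimplexCategoryᵒᵖ)

/-- The diagonal, identifying the space direction with the direction of the values. -/
def diag (n : ℕ) : SpaceValued n ⥤ ThetaSpace n where
  obj Z :=
    { obj := fun d => (Z.obj d).obj (op d.unop.2)
      map := fun {d e} f => (Z.map f).app (op d.unop.2) ≫ (Z.obj e).map f.unop.2.op
      map_id := fun d => by
        have h := NatTrans.congr_app (Z.map_id d) (op d.unop.2)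
        exact (congrArg₂ (· ≫ ·) h ((Z.obj d).map_id _)).trans (Category.comp_id _)
      map_comp := fun {d e e'} f g => by
        have h := NatTrans.congr_app (Z.map_comp f g) (op d.unop.2)
        have h' := (Z.map g).naturality f.unop.2.op
        have h'' := (Z.obj e').map_comp f.unop.2.op g.unop.2.op
        refine (congrArg₂ (· ≫ ·) h h'').trans ?_
        change (_ ≫ _) ≫ _ ≫ _ = (_ ≫ _) ≫ _ ≫ _
        simp only [Category.assoc]
        rw [reassoc_of% h'] }
  map φ :=
    { app := fun d => (φ.app d).app (op d.unop.2)
      naturality := fun d e f => by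
        have h := NatTrans.congr_app (φ.naturality f) (op d.unop.2)
        have h' := (φ.app e).naturality f.unop.2.op
        change (_ ≫ _) ≫ _ = _ ≫ _ ≫ _
        change _ ≫ _ = _ ≫ _ at h
        rw [Category.assoc, h', reassoc_of% h] }

/-- The `sSet`-enriched colimit of `Q : Jᵒᵖ ⥤ SpaceValued n` weighted by `W : J ⥤ sSet`, that is the
coend of the tensors `W j ⊗ Q j`. -/
def weightedColim {J : Type} [SmallCategory J] (W : J ⥤ SSet.{0}) :
    (Jᵒᵖ ⥤ SpaceValued n) ⥤ SpaceValued n :=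
  (Functor.whiskeringRight _ _ _).obj
    ((curriedTensor (SpaceValued n)).flip ⋙
      (Functor.whiskeringLeft _ _ _).obj (W ⋙ Functor.const (Cell n)ᵒᵖ)) ⋙ coendFunctor J _

/-- The right-hand side. -/
def weightedSide (m : ℕ) (Y : ThetaSpace n) (i : Fin (m + 1)) : MonoPair m Y ⥤ ThetaSpace n :=
  G m Y i ⋙ (Functor.whiskeringRight _ _ _).obj (ι n) ⋙ weightedColim (H m i) ⋙ diag n

/-! ### The left-hand side -/

lemma ThetaSpace.Connected.nonempty {Y : ThetaSpace n} (hY : Y.Connected) :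
    Nonempty (Y.obj (op (Cell.pt n))) := by
  obtain ⟨e⟩ := hY
  obtain ⟨d, y, -⟩ := Types.jointly_surjective_of_isColimit (colimit.isColimit Y) (e.symm ⟨⟩)
  exact ⟨Y.map d.unop.fromPt.op y⟩

/-- The object `L F[m, Y]`. -/
abbrev LFY (m : ℕ) (Y : ThetaSpace n) : Pcat n := (L n).obj ((F n).obj (⦋m⦌, Y))

/-- The object `i` of `𝔠 L F[m, Y]`, for `Y` connected: the image of the vertex `i` of `F[m]` and of
any point of `Y`. -/
def vertexLFY (m : ℕ) {Y : ThetaSpace n} (hY : Y.Connected) (i : Fin (m + 1)) :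
    CObj (LFY m Y) :=
  ((adjL n).unit.app ((F n).obj (⦋m⦌, Y))).app (op (⦋0⦌, Cell.pt n))
    (SimplexCategory.const ⦋0⦌ ⦋m⦌ i, hY.nonempty.some)

/-- The object `[μ, f] : F[ℓ, X] ⟶ F[m, Y] ⟶ L F[m, Y]`, functorially in `(μ, f)`. -/
def bracket (m : ℕ) (Y : ThetaSpace n) : MonoPair m Y ⥤ Over (LFY m Y).obj where
  obj P := Over.mk ((F n).map ((P.μ, P.f) : (P.obj.1.left, P.X) ⟶ (⦋m⦌, Y)) ≫
    (adjL n).unit.app ((F n).obj (⦋m⦌, Y)))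
  map h := Over.homMk ((F n).map (h.hom.1.left, h.hom.2.left)) (by
    refine (Category.assoc _ _ _).symm.trans (congrArg (· ≫ _) ?_)
    refine ((F n).map_comp _ _).symm.trans (congrArg (F n).map ?_)
    exact Prod.ext (Over.w h.hom.1) (Over.w h.hom.2))
  map_id _ := Over.OverMorphism.ext ((F n).map_id _)
  map_comp {P Q R} f g := Over.OverMorphism.ext ((F n).map_comp
    ((f.hom.1.left, f.hom.2.left) : (P.obj.1.left, P.X) ⟶ (Q.obj.1.left, Q.X))
    ((g.hom.1.left, g.hom.2.left) : (Q.obj.1.left, Q.X) ⟶ (R.obj.1.left, R.X)))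

/-- The left-hand side. -/
def straighteningSide (m : ℕ) {Y : ThetaSpace n} (hY : Y.Connected) (i : Fin (m + 1)) :
    MonoPair m Y ⥤ ThetaSpace n :=
  bracket m Y ⋙ St (LFY m Y) ⋙ EnrichedPresheaf.ev (ThetaSpace n) (vertexLFY m hY i)

end

end StNec

/-! Both sides embed into one explicit `Θ`-space, compatibly with maps of pairs `(μ, f)`, and have
the same image there. The target `Ambient` is the hom space from `i` to `m + 1` in `𝔠` of the
bouquet of copies of `Δ[m + 1]` indexed by `Y` and glued at their vertices. Given the two
embeddings, `nonempty_iso_of_range_eq` yields the isomorphism, and its naturality is automatic.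

Points of the ambient space are described combinatorially. A morphism of degree `k` in the
thickening of a simplex is a chain `S 0 ⊆ ⋯ ⊆ S k` of sets of vertices, and composition is union;
the elements of `S 0`, the joints, are the places where it factors. In a bouquet, the piece that
starts at a joint also remembers the copy on which it lies. This gives the functor `chain` to
labelled chains. For a simplicial set over the bouquet with a suitable family of simplices
(`Cover`), a morphism is determined by its labelled chain: it can be cut at its joints, a piece
without inner joints is a single generator, and the label and the ends of the piece determine its
simplex (`Cover.chainOf_inj`). The chains that occur are those whose pieces lie on simplices of the
cover with the right labels (`Cover.good_chainOf`, `Cover.exists_chainOf`). This applies to the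
bouquets, to `L F[m, Y]`, and to necklaces with labelled beads.

The straightening of `[μ, f]` is a colimit over the simplices `σ` of `F[ℓ, X]` of the morphisms to
`⊤` in the cones `W_σ`. Such a `σ` has a preferred lift to `F[m, Y]`, which maps `W_σ` to the
bouquet. A morphism to `⊤` is a morphism of `L F[m, Y]` followed by a face of the added simplex
without inner joints, and in the colimit `σ` may be taken to be all of `Δ[ℓ]` with an element `x` of
`X` (`exists_topEl`). Hence the chain has label `f x` at its last joint `t` before `m + 1`, and from
`t` on it lies in the image of `μ + 1`: this is `IsBracketChain`. Conversely, since `f` is a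
monomorphism and `μ` is injective, such a chain determines `x`, `t` and both factors.

A point of the weighted colimit is a morphism of a necklace with labels on the beads, the last label
being `f x`. Its chain singles out a minimal necklace, with joints `S 0` and vertices `S k`. This
maps to the given one, so by the coend relation the point is already represented on it, and there
the chain determines the labels and the morphism (`exists_isMinimal`, `weightedDesc_injective`). The
condition on the last bead becomes `IsBracketChain` once more, so the images agree. -/

namespace StNec

noncomputable section

open Simplicial

/-! ### Morphisms of the simplicial thickening as chains of sets -/

namespace Thick

variable {p q : SimplexCategory} {i j l : Fin (p.len + 1)} {k k' : SimplexCategoryᵒᵖ}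

/-- The `x`-th set of the chain of subsets of `[i, j]` given by a simplex of `Thick p i j`. -/
def S (T : (Thick p i j).obj k) (x : Fin (k.unop.len + 1)) : Set (Fin (p.len + 1)) :=
  (CategoryTheory.Functor.obj (C := Fin (k.unop.len + 1))
    (D := SimplicialThickening.Path i j) T x).I

variable (T : (Thick p i j).obj k) (x y : Fin (k.unop.len + 1))

lemma left_mem : i ∈ S T x := SimplicialThickening.Path.left _

lemma right_mem : j ∈ S T x := SimplicialThickening.Path.right _

variable {x} in
lemma left_le {t : Fin (p.len + 1)} (h : t ∈ S T x) : i ≤ t :=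
  SimplicialThickening.Path.left_le _ _ h

variable {x} in
lemma le_right {t : Fin (p.len + 1)} (h : t ∈ S T x) : t ≤ j :=
  SimplicialThickening.Path.le_right _ _ h

lemma le (T : (Thick p i j).obj k) : i ≤ j := left_le T (right_mem T 0)

variable {x y} in
lemma S_mono (h : x ≤ y) : S T x ⊆ S T y :=
  (CategoryTheory.Functor.map (C := Fin (k.unop.len + 1))
    (D := SimplicialThickening.Path i j) T (homOfLE h)).hom.le

variable {T} in
lemma ext {T' : (Thick p i j).obj k} (h : ∀ x, S T x = S T' x) : T = T' :=
  CategoryTheory.Functor.ext (C := Fin (k.unop.len + 1)) (D := SimplicialThickening.Path i j)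
    (fun x => SimplicialThickening.Path.ext (h x))
    (fun _ _ _ => InducedCategory.hom_ext (Subsingleton.elim _ _))

/-- A chain of sets as a simplex of `Thick p i j`. -/
def ofSets (Q : Fin (k.unop.len + 1) → Set (Fin (p.len + 1))) (hi : ∀ x, i ∈ Q x)
    (hj : ∀ x, j ∈ Q x) (hl : ∀ x, ∀ t ∈ Q x, i ≤ t) (hr : ∀ x, ∀ t ∈ Q x, t ≤ j)
    (hm : Monotone Q) : (Thick p i j).obj k :=
  show Fin (k.unop.len + 1) ⥤ SimplicialThickening.Path i j from
  { obj := fun x => ⟨Q x, hi x, hj x, hl x, hr x⟩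
    map := fun f => ⟨homOfLE (hm (leOfHom f))⟩ }

/-- The only subset of the interval from `i` to `i` that contains `i` is `{i}`. -/
lemma eq_one (T : (Thick p i i).obj k) : T = one p i k :=
  ext fun x => Set.Subset.antisymm (fun _ ht => le_antisymm (le_right T ht) (left_le T ht))
    (fun _ ht => (show _ = _ from ht) ▸ left_mem T x)

/-- The part of a chain below a common element. -/
def cutL (T : (Thick p i j).obj k) (t : Fin (p.len + 1)) (ht : t ∈ S T 0) :
    (Thick p i t).obj k :=
  ofSets (fun x => S T x ∩ Set.Iic t) (fun x => ⟨left_mem T x, left_le T ht⟩)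
    (fun x => ⟨S_mono T (Fin.zero_le x) ht, le_refl t⟩) (fun _ _ h => left_le T h.1)
    (fun _ _ h => h.2) (fun _ _ h => Set.inter_subset_inter_left _ (S_mono T h))

/-- The part of a chain above a common element. -/
def cutR (T : (Thick p i j).obj k) (t : Fin (p.len + 1)) (ht : t ∈ S T 0) :
    (Thick p t j).obj k :=
  ofSets (fun x => S T x ∩ Set.Ici t) (fun x => ⟨S_mono T (Fin.zero_le x) ht, le_refl t⟩)
    (fun x => ⟨right_mem T x, le_right T ht⟩) (fun _ _ h => h.2)
    (fun _ _ h => le_right T h.1) (fun _ _ h => Set.inter_subset_inter_left _ (S_mono T h))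

/-- Composition in the thickening is union, so each set of the chain is the union of its parts below
and above `t`. Membership in the smallest set `S T 0` puts `t` into all of them, which is what makes
the two parts morphisms: the elements of `S T 0` are the joints. -/
lemma cut (T : (Thick p i j).obj k) (t : Fin (p.len + 1)) (ht : t ∈ S T 0) :
    comp (cutL T t ht) (cutR T t ht) = T := by
  refine ext fun x => ?_
  change S T x ∩ Set.Iic t ∪ S T x ∩ Set.Ici t = S T x
  rw [← Set.inter_union_distrib_left, Set.Iic_union_Ici, Set.inter_univ]

/-- A chain in the image of an injective operator is the image of a chain. -/
lemma exists_lift (α : p ⟶ q) (hα : Function.Injective α.toOrderHom)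
    (T : (Thick q (α.toOrderHom i) (α.toOrderHom j)).obj k)
    (h : ∀ x, S T x ⊆ Set.range α.toOrderHom) : ∃ U, (Thick.map α i j).app k U = T := by
  have hm : StrictMono α.toOrderHom := α.toOrderHom.monotone.strictMono_of_injective hα
  refine ⟨ofSets (fun x => α.toOrderHom ⁻¹' S T x) (fun x => left_mem T x)
    (fun x => right_mem T x) (fun _ _ ht => hm.le_iff_le.1 (left_le T ht))
    (fun _ _ ht => hm.le_iff_le.1 (le_right T ht))
    (fun _ _ h => Set.preimage_mono (S_mono T h)), ext fun x => ?_⟩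
  exact Set.image_preimage_eq_of_subset (h x)

end Thick

/-! ### Bouquets of simplices

The bouquet is the union of copies of `Δ[M]` indexed by a set `Y` and glued at the vertices. -/

/-- A simplex of the bouquet: a simplex of `Δ[M]`, with a label in `Y` unless it is constant. -/
structure BouquetObj (M : ℕ) (Y : Type) (q : SimplexCategory) where
  κ : q ⟶ ⦋M⦌
  -- Giving constant simplices no label is what glues the copies at their vertices. As `κ` is
  -- monotone, it is constant exactly when its values at the two ends agree.
  lab : κ.toOrderHom 0 ≠ κ.toOrderHom (Fin.last q.len) → Y

namespace BouquetObj

variable {M : ℕ} {Y Y' : Type} {p q : SimplexCategory}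

lemma ext {z z' : BouquetObj M Y q} (h : z.κ = z'.κ) (hl : ∀ h h', z.lab h = z'.lab h') :
    z = z' := by
  obtain ⟨κ, l⟩ := z
  obtain ⟨κ', l'⟩ := z'
  obtain rfl : κ = κ' := h
  congr
  exact funext fun h => hl h h

lemma ends_ne (κ : q ⟶ ⦋M⦌) {s t : Fin (q.len + 1)} (h : κ.toOrderHom s < κ.toOrderHom t) :
    κ.toOrderHom 0 ≠ κ.toOrderHom (Fin.last q.len) :=
  ((κ.toOrderHom.monotone (Fin.zero_le s)).trans_lt
    (h.trans_le (κ.toOrderHom.monotone (Fin.le_last t)))).ne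

lemma ends_ne_of_comp (α : p ⟶ q) (κ : q ⟶ ⦋M⦌)
    (h : (α ≫ κ).toOrderHom 0 ≠ (α ≫ κ).toOrderHom (Fin.last p.len)) :
    κ.toOrderHom 0 ≠ κ.toOrderHom (Fin.last q.len) :=
  ends_ne κ (s := α.toOrderHom 0) (t := α.toOrderHom (Fin.last p.len))
    (lt_of_le_of_ne ((α ≫ κ).toOrderHom.monotone (Fin.zero_le _)) h)

/-- Restriction along a simplicial operator. -/
def res (α : p ⟶ q) (z : BouquetObj M Y q) : BouquetObj M Y p where
  κ := α ≫ z.κ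
  lab h := z.lab (ends_ne_of_comp α z.κ h)

/-- Change of labels. -/
def map (φ : Y → Y') (z : BouquetObj M Y q) : BouquetObj M Y' q where
  κ := z.κ
  lab h := φ (z.lab h)

/-- The vertex `a`. -/
def pt (M : ℕ) (Y : Type) (a : Fin (M + 1)) : BouquetObj M Y ⦋0⦌ where
  κ := SimplexCategory.const ⦋0⦌ ⦋M⦌ a
  lab h := (h rfl).elim

lemma ext_zero {z z' : BouquetObj M Y ⦋0⦌} (h : z.κ.toOrderHom 0 = z'.κ.toOrderHom 0) : z = z' :=
  ext (hom_ext_fin fun i => by rw [Subsingleton.elim (α := Fin 1) i 0]; exact h)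
    fun h => (h rfl).elim

/-- The simplex `κ` of the copy of `Δ[M]` with index `y`. -/
def ofHom (κ : q ⟶ ⦋M⦌) (y : Y) : BouquetObj M Y q := ⟨κ, fun _ => y⟩

/-- A constant simplex lies in every copy, so any index serves for it; this is where `Y` has to be
non-empty. -/
lemma exists_ofHom [hY : Nonempty Y] (z : BouquetObj M Y q) : ∃ κ y, z = ofHom κ y := by
  by_cases h : z.κ.toOrderHom 0 ≠ z.κ.toOrderHom (Fin.last q.len)
  · exact ⟨z.κ, z.lab h, ext rfl fun _ _ => rfl⟩
  · exact ⟨z.κ, hY.some, ext rfl fun h' => (h h').elim⟩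

end BouquetObj

/-- The bouquet as a simplicial set. -/
def bouquet (M : ℕ) (Y : Type) : SSet.{0} where
  obj q := BouquetObj M Y q.unop
  map f := ↾BouquetObj.res f.unop
  map_id q := ConcreteCategory.hom_ext _ _ fun (z : BouquetObj M Y q.unop) =>
    show z.res (𝟙 _) = z from BouquetObj.ext (Category.id_comp _) fun _ _ => rfl
  map_comp f g := ConcreteCategory.hom_ext _ _ fun (z : BouquetObj M Y _) =>
    show z.res (g.unop ≫ f.unop) = (z.res f.unop).res g.unop from
      BouquetObj.ext (Category.assoc _ _ _) fun _ _ => rfl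

/-- The bouquet with its vertices named by their positions. -/
abbrev bouquetLab (M : ℕ) (Y : Type) : Labelled where
  K := bouquet M Y
  O := Fin (M + 1)
  v := BouquetObj.pt M Y

lemma bouquet_vertex {M : ℕ} {Y : Type} {p : SimplexCategory} {z : (bouquet M Y).obj (op p)}
    {i : Fin (p.len + 1)} {a : Fin (M + 1)} :
    vertex z i = (bouquetLab M Y).v a ↔ z.κ.toOrderHom i = a := by
  constructor
  · intro h
    exact congrArg (fun w : BouquetObj M Y ⦋0⦌ => w.κ.toOrderHom 0) h
  · intro h
    exact BouquetObj.ext_zero (M := M) (Y := Y) h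

/-! ### Labelled chains -/

/-- A morphism of degree `k` in the simplicial thickening of `[M]` which has a label in `Y` at each
of its joints but the last one. -/
@[ext]
structure LabChain (M : ℕ) (Y : Type) (k : SimplexCategoryᵒᵖ) (i j : Fin (M + 1)) where
  S : Fin (k.unop.len + 1) → Set (Fin (M + 1))
  -- The labels form a relation, so that concatenation is a union; the last four fields make it the
  -- graph of a function on the joints below `j`. The label at a joint is the index of the copy that
  -- carries the piece up to the next joint.
  L : Set (Fin (M + 1) × Y)
  left_mem : ∀ x, i ∈ S x
  right_mem : ∀ x, j ∈ S x
  left_le : ∀ {x t}, t ∈ S x → i ≤ t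
  le_right : ∀ {x t}, t ∈ S x → t ≤ j
  mono : Monotone S
  lab_mem : ∀ {t y}, (t, y) ∈ L → t ∈ S 0
  lab_lt : ∀ {t y}, (t, y) ∈ L → t < j
  lab_ex : ∀ {t}, t ∈ S 0 → t < j → ∃ y, (t, y) ∈ L
  lab_unique : ∀ {t y y'}, (t, y) ∈ L → (t, y') ∈ L → y = y'

namespace LabChain

variable {M : ℕ} {Y : Type} {k : SimplexCategoryᵒᵖ} {i j l : Fin (M + 1)}

lemma le (D : LabChain M Y k i j) : i ≤ j := D.left_le (D.right_mem 0)

/-- The identity chain. -/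
def one (i : Fin (M + 1)) : LabChain M Y k i i where
  S _ := {i}
  L := ∅
  left_mem _ := rfl
  right_mem _ := rfl
  left_le h := (show _ = _ from h).ge
  le_right h := (show _ = _ from h).le
  mono _ _ _ := le_rfl
  lab_mem h := h.elim
  lab_lt h := h.elim
  lab_ex h h' := (h'.ne h).elim
  lab_unique h := h.elim

/-- Concatenation of chains. -/
def comp (D : LabChain M Y k i j) (D' : LabChain M Y k j l) : LabChain M Y k i l where
  S x := D.S x ∪ D'.S x
  L := D.L ∪ D'.L
  left_mem x := Or.inl (D.left_mem x)
  right_mem x := Or.inr (D'.right_mem x)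
  left_le h := h.elim D.left_le fun h => D.le.trans (D'.left_le h)
  le_right h := h.elim (fun h => (D.le_right h).trans D'.le) D'.le_right
  mono _ _ h := Set.union_subset_union (D.mono h) (D'.mono h)
  lab_mem h := h.imp D.lab_mem D'.lab_mem
  lab_lt h := h.elim (fun h => (D.lab_lt h).trans_le D'.le) D'.lab_lt
  lab_ex {t} h h' := by
    rcases lt_or_ge t j with hj | hj
    · have ht : t ∈ D.S 0 := h.elim id fun h => ((D'.left_le h).not_gt hj).elim
      exact (D.lab_ex ht hj).imp fun _ => Or.inl
    · have ht : t ∈ D'.S 0 := h.elim (fun h => by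
        rw [le_antisymm (D.le_right h) hj]; exact D'.left_mem 0) id
      exact (D'.lab_ex ht h').imp fun _ => Or.inr
  lab_unique h h' := by
    rcases h with h | h <;> rcases h' with h' | h'
    · exact D.lab_unique h h'
    -- Labelled joints of `D` are below `j` and those of `D'` are not, so the mixed cases do not
    -- occur.
    · exact ((D'.left_le (D'.lab_mem h')).not_gt (D.lab_lt h)).elim
    · exact ((D'.left_le (D'.lab_mem h)).not_gt (D.lab_lt h')).elim
    · exact D'.lab_unique h h'

lemma one_comp (D : LabChain M Y k i j) : (one i).comp D = D :=
  LabChain.ext (funext fun x => Set.union_eq_self_of_subset_left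
    (Set.singleton_subset_iff.2 (D.left_mem x))) (Set.empty_union _)

lemma comp_one (D : LabChain M Y k i j) : D.comp (one j) = D :=
  LabChain.ext (funext fun x => Set.union_eq_self_of_subset_right
    (Set.singleton_subset_iff.2 (D.right_mem x))) (Set.union_empty _)

/-- The part of a chain below a common element of its sets. -/
def cutL (D : LabChain M Y k i j) (t : Fin (M + 1)) (ht : t ∈ D.S 0) : LabChain M Y k i t where
  S x := D.S x ∩ Set.Iic t
  L := { z | z ∈ D.L ∧ z.1 < t }
  left_mem x := ⟨D.left_mem x, D.left_le ht⟩
  right_mem x := ⟨D.mono (Fin.zero_le x) ht, le_refl t⟩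
  left_le h := D.left_le h.1
  le_right h := h.2
  mono _ _ h := Set.inter_subset_inter_left _ (D.mono h)
  lab_mem h := ⟨D.lab_mem h.1, h.2.le⟩
  lab_lt h := h.2
  lab_ex h h' := (D.lab_ex h.1 (h'.trans_le (D.le_right ht))).imp fun _ hy => ⟨hy, h'⟩
  lab_unique h h' := D.lab_unique h.1 h'.1

/-- The part of a chain above a common element of its sets. -/
def cutR (D : LabChain M Y k i j) (t : Fin (M + 1)) (ht : t ∈ D.S 0) : LabChain M Y k t j where
  S x := D.S x ∩ Set.Ici t
  L := { z | z ∈ D.L ∧ t ≤ z.1 }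
  left_mem x := ⟨D.mono (Fin.zero_le x) ht, le_refl t⟩
  right_mem x := ⟨D.right_mem x, D.le_right ht⟩
  left_le h := h.2
  le_right h := D.le_right h.1
  mono _ _ h := Set.inter_subset_inter_left _ (D.mono h)
  lab_mem h := ⟨D.lab_mem h.1, h.2⟩
  lab_lt h := D.lab_lt h.1
  lab_ex h h' := (D.lab_ex h.1 h').imp fun _ hy => ⟨hy, h.2⟩
  lab_unique h h' := D.lab_unique h.1 h'.1

lemma cut (D : LabChain M Y k i j) (t : Fin (M + 1)) (ht : t ∈ D.S 0) :
    (D.cutL t ht).comp (D.cutR t ht) = D := by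
  refine LabChain.ext (funext fun x => ?_) (Set.ext fun z => ?_)
  · change D.S x ∩ Set.Iic t ∪ D.S x ∩ Set.Ici t = D.S x
    rw [← Set.inter_union_distrib_left, Set.Iic_union_Ici, Set.inter_univ]
  · change (z ∈ D.L ∧ z.1 < t) ∨ (z ∈ D.L ∧ t ≤ z.1) ↔ _
    rw [← and_or_left]
    exact and_iff_left (lt_or_ge _ _)

/-- Up to `j` the second factor contributes only the point `j`, already in the first one, and no
label. With `cutR_comp` this makes concatenation cancellable on both sides at once. -/
lemma cutL_comp (D : LabChain M Y k i j) (D' : LabChain M Y k j l) (h : j ∈ (D.comp D').S 0) :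
    (D.comp D').cutL j h = D := by
  refine LabChain.ext (funext fun x => Set.ext fun t => ⟨?_, ?_⟩) (Set.ext fun z => ⟨?_, ?_⟩)
  · rintro ⟨h | h, h'⟩
    · exact h
    · rw [le_antisymm h' (D'.left_le h)]
      exact D.right_mem x
  · exact fun h => ⟨Or.inl h, D.le_right h⟩
  · rintro ⟨h | h, h'⟩
    · exact h
    · exact ((D'.left_le (D'.lab_mem (y := z.2) h)).not_gt h').elim
  · exact fun h => ⟨Or.inl h, D.lab_lt (y := z.2) h⟩

lemma cutR_comp (D : LabChain M Y k i j) (D' : LabChain M Y k j l) (h : j ∈ (D.comp D').S 0) :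
    (D.comp D').cutR j h = D' := by
  refine LabChain.ext (funext fun x => Set.ext fun t => ⟨?_, ?_⟩) (Set.ext fun z => ⟨?_, ?_⟩)
  · rintro ⟨h | h, h'⟩
    · rw [le_antisymm (D.le_right h) h']
      exact D'.left_mem x
    · exact h
  · exact fun h => ⟨Or.inr h, D'.left_le h⟩
  · rintro ⟨h | h, h'⟩
    · exact ((D.lab_lt (y := z.2) h).not_ge h').elim
    · exact h
  · exact fun h => ⟨Or.inr h, D'.left_le (D'.lab_mem (y := z.2) h)⟩

/-- Chains with the same concatenation agree. -/
lemma comp_inj {D E : LabChain M Y k i j} {D' E' : LabChain M Y k j l}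
    (h : D.comp D' = E.comp E') : D = E ∧ D' = E' := by
  have hj : j ∈ (D.comp D').S 0 := Or.inl (D.right_mem 0)
  have hj' : j ∈ (E.comp E').S 0 := Or.inl (E.right_mem 0)
  constructor
  · rw [← cutL_comp D D' hj, ← cutL_comp E E' hj']
    congr 1
  · rw [← cutR_comp D D' hj, ← cutR_comp E E' hj']
    congr 1

/-- The labelled chain given by a simplex of the bouquet. -/
def ofSimplex {p : SimplexCategory} (z : BouquetObj M Y p) {s t : Fin (p.len + 1)}
    (hi : z.κ.toOrderHom s = i) (hj : z.κ.toOrderHom t = j) (T : (Thick p s t).obj k) :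
    LabChain M Y k i j where
  S x := z.κ.toOrderHom '' Thick.S T x
  -- Every joint whose image is below `j` gets the single label of `z`. A joint below `j` forces `κ`
  -- to be non-constant, so this label exists.
  L := { w | (∃ u ∈ Thick.S T 0, z.κ.toOrderHom u = w.1) ∧ w.1 < j ∧ ∃ h, z.lab h = w.2 }
  left_mem x := ⟨s, Thick.left_mem T x, hi⟩
  right_mem x := ⟨t, Thick.right_mem T x, hj⟩
  left_le := by
    rintro x _ ⟨u, hu, rfl⟩
    exact hi ▸ z.κ.toOrderHom.monotone (Thick.left_le T hu)
  le_right := by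
    rintro x _ ⟨u, hu, rfl⟩
    exact hj ▸ z.κ.toOrderHom.monotone (Thick.le_right T hu)
  mono _ _ h := Set.image_mono (Thick.S_mono T h)
  lab_mem h := h.1
  lab_lt h := h.2.1
  lab_ex := by
    rintro _ ⟨u, hu, rfl⟩ h
    exact ⟨_, ⟨u, hu, rfl⟩, h, BouquetObj.ends_ne z.κ (hj ▸ h), rfl⟩
  lab_unique := by
    rintro t y y' ⟨-, -, h, rfl⟩ ⟨-, -, h', rfl⟩
    rfl

end LabChain

/-- A chain without inner joints on an injective simplex. -/
lemma LabChain.exists_ofSimplex {M : ℕ} {Y : Type} {k : SimplexCategoryᵒᵖ} {i j : Fin (M + 1)}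
    (D : LabChain M Y k i j) {p : SimplexCategory} (κ : p ⟶ ⦋M⦌)
    (hκ : Function.Injective κ.toOrderHom) (y : Y) {s t : Fin (p.len + 1)}
    (hs : κ.toOrderHom s = i) (ht : κ.toOrderHom t = j) (hij : i < j) (hy : (i, y) ∈ D.L)
    (hS : ∀ r ∈ D.S 0, r = i ∨ r = j) (hr : ∀ x, ∀ r ∈ D.S x, r ∈ Set.range κ.toOrderHom) :
    ∃ T : (Thick p s t).obj k, LabChain.ofSimplex (BouquetObj.ofHom κ y) hs ht T = D := by
  have hm : StrictMono κ.toOrderHom := κ.toOrderHom.monotone.strictMono_of_injective hκ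
  refine ⟨Thick.ofSets (fun x => κ.toOrderHom ⁻¹' D.S x)
    (fun x => by rw [Set.mem_preimage, hs]; exact D.left_mem x)
    (fun x => by rw [Set.mem_preimage, ht]; exact D.right_mem x)
    (fun x t ht => hm.le_iff_le.1 (hs.trans_le (D.left_le ht)))
    (fun x r hr => hm.le_iff_le.1 ((D.le_right hr).trans_eq ht.symm))
    (fun _ _ h => Set.preimage_mono (D.mono h)), ?_⟩
  refine LabChain.ext (funext fun x => Set.image_preimage_eq_of_subset (hr x)) (Set.ext ?_)
  rintro ⟨r, y'⟩
  constructor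
  · rintro ⟨⟨u, hu, rfl⟩, h5, _, rfl⟩
    -- The only joint below `j` is `i`, so the one label `y` accounts for all of `D.L`.
    have h6 : κ.toOrderHom u = i := (hS _ hu).elim id fun h => (h5.ne h).elim
    change (κ.toOrderHom u, y) ∈ D.L
    rwa [h6]
  · intro hD
    obtain rfl : r = i := (hS _ (D.lab_mem hD)).elim id fun h => ((D.lab_lt hD).ne h).elim
    obtain rfl := D.lab_unique hD hy
    refine ⟨⟨s, ?_, hs⟩, hij, BouquetObj.ends_ne κ (s := s) (t := t) (hs ▸ ht ▸ hij), rfl⟩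
    change _ ∈ D.S 0
    rw [hs]
    exact D.left_mem 0

/-- The category of labelled chains. -/
structure LabChainCat (M : ℕ) (Y : Type) (k : SimplexCategoryᵒᵖ) where
  as : Fin (M + 1)

instance (M : ℕ) (Y : Type) (k : SimplexCategoryᵒᵖ) : Category (LabChainCat M Y k) where
  Hom i j := LabChain M Y k i.as j.as
  id i := LabChain.one i.as
  comp D D' := LabChain.comp D D'
  id_comp := LabChain.one_comp
  comp_id := LabChain.comp_one
  assoc _ _ _ := LabChain.ext (funext fun _ => Set.union_assoc _ _ _) (Set.union_assoc _ _ _)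

/-- The chain of a path of generators of `c^h` of the bouquet. -/
def chainPath (M : ℕ) (Y : Type) (k : SimplexCategoryᵒᵖ) :
    Paths (ChObj (bouquetLab M Y) k) ⥤ LabChainCat M Y k :=
  Paths.lift (V := ChObj (bouquetLab M Y) k)
    { obj := fun a => ⟨a⟩
      map := fun {_ _} x => LabChain.ofSimplex (M := M) (Y := Y) x.σ (bouquet_vertex.1 x.src)
        (bouquet_vertex.1 x.tgt) x.T }

lemma chainPath_path {M : ℕ} {Y : Type} {k : SimplexCategoryᵒᵖ} {a b : (bouquetLab M Y).O}
    (x : ChGen (bouquetLab M Y) k a b) : (chainPath M Y k).map x.path =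
      LabChain.ofSimplex (M := M) (Y := Y) x.σ (bouquet_vertex.1 x.src)
        (bouquet_vertex.1 x.tgt) x.T :=
  Paths.lift_toPath _ _

/-- Direct images along `κ` respect singletons, unions and composites of operators, which settles
the sets. For the labels of a composite, a joint is below the middle vertex `b`, and belongs to the
first factor, or it is not, and belongs to the second. -/
lemma chainPath_rel {M : ℕ} {Y : Type} {k : SimplexCategoryᵒᵖ}
    {a b : Paths (ChObj (bouquetLab M Y) k)} (x y : a ⟶ b) (h : ChRel (bouquetLab M Y) k x y) :
    (chainPath M Y k).map x = (chainPath M Y k).map y := by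
  cases h with
  | @ident a p σ i h =>
    refine (chainPath_path _).trans (Eq.trans ?_
      (CategoryTheory.Functor.map_id (chainPath M Y k) (ChObj.mk k a)).symm)
    have hi := bouquet_vertex.1 h
    refine LabChain.ext (funext fun x => ?_) (Set.eq_empty_of_forall_notMem ?_)
    · exact (Set.image_singleton).trans (congrArg _ hi)
    · rintro ⟨t, y⟩ ⟨⟨u, hu, rfl⟩, h', -⟩
      exact h'.ne ((congrArg _ hu).trans hi)
  | @comp a b c p σ i j l ha hb hc T S =>
    have hi := bouquet_vertex.1 ha
    have hj := bouquet_vertex.1 hb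
    have hl := bouquet_vertex.1 hc
    refine (chainPath_path _).trans (Eq.trans ?_ ((Functor.map_comp _ _ _).trans
      (congrArg₂ (· ≫ ·) (chainPath_path _) (chainPath_path _))).symm)
    refine LabChain.ext (funext fun x => Set.image_union _ _ _) (Set.ext ?_)
    have hjl : LE.le (α := Fin (M + 1)) b c :=
      hj.symm.trans_le ((σ.κ.toOrderHom.monotone (Thick.le S)).trans_eq hl)
    rintro ⟨t, y⟩
    constructor
    · rintro ⟨⟨u, hu, rfl⟩, h1, h2⟩
      rcases lt_or_ge (α := Fin (M + 1)) (σ.κ.toOrderHom u) b with h3 | h3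
      · refine Or.inl ⟨⟨u, ?_, rfl⟩, h3, h2⟩
        refine hu.elim id fun hu => ?_
        exact (h3.not_ge (hj.symm.trans_le (σ.κ.toOrderHom.monotone (Thick.left_le S hu)))).elim
      · refine Or.inr ⟨?_, h1, h2⟩
        -- A joint of the first chain that is not below `b` is sent to `b`, and is represented in
        -- the second chain by its first vertex `j`.
        refine hu.elim (fun hu => ⟨j, Thick.left_mem S 0, ?_⟩) fun hu => ⟨u, hu, rfl⟩
        exact le_antisymm (hj.trans_le h3) (σ.κ.toOrderHom.monotone (Thick.le_right T hu))
    · rintro (⟨⟨u, hu, rfl⟩, h1, h2⟩ | ⟨⟨u, hu, rfl⟩, h1, h2⟩)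
      · exact ⟨⟨u, Or.inl hu, rfl⟩, h1.trans_le hjl, h2⟩
      · exact ⟨⟨u, Or.inr hu, rfl⟩, h1, h2⟩
  | @nat a b p q α σ i j T ha hb ha' hb' =>
    refine (chainPath_path _).trans (Eq.trans ?_ (chainPath_path _).symm)
    have hi := bouquet_vertex.1 ha
    have hj := bouquet_vertex.1 hb
    refine LabChain.ext (funext fun x => (Set.image_image _ _ _)) (Set.ext ?_)
    rintro ⟨t, y⟩
    constructor
    · rintro ⟨⟨_, ⟨u, hu, rfl⟩, rfl⟩, h1, h2, h3⟩
      exact ⟨⟨u, hu, rfl⟩, h1, BouquetObj.ends_ne (α ≫ σ.κ) (s := u) (t := j)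
        (lt_of_lt_of_eq h1 hj.symm), h3⟩
    · rintro ⟨⟨u, hu, rfl⟩, h1, h2, h3⟩
      exact ⟨⟨_, ⟨u, hu, rfl⟩, rfl⟩, h1, _, h3⟩

/-- The functor from `c^h` of the bouquet to the category of labelled chains. -/
def chain (M : ℕ) (Y : Type) (k : SimplexCategoryᵒᵖ) :
    Ch (bouquetLab M Y) k ⥤ LabChainCat M Y k :=
  CategoryTheory.Quotient.lift _ (chainPath M Y k) fun _ _ x y h => chainPath_rel x y h

lemma chain_toHom {M : ℕ} {Y : Type} {k : SimplexCategoryᵒᵖ} {a b : (bouquetLab M Y).O}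
    (x : ChGen (bouquetLab M Y) k a b) : (chain M Y k).map x.toHom =
      LabChain.ofSimplex (M := M) (Y := Y) x.σ (bouquet_vertex.1 x.src)
        (bouquet_vertex.1 x.tgt) x.T :=
  chainPath_path x

/-! ### The labelled chain of a morphism of `c^h` -/

/-- The position of a vertex of a labelled simplicial set over a bouquet. -/
abbrev pos {A : Labelled} {M : ℕ} {Y : Type} (g : A ⟶ bouquetLab M Y) (a : A.O) : Fin (M + 1) :=
  g.u a

section chainOf

variable {A B : Labelled} {M : ℕ} {Y : Type} (h : A ⟶ B) (g : B ⟶ bouquetLab M Y)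
  {k : SimplexCategoryᵒᵖ}

/-- The labelled chain of a morphism of `c^h B`, for `B` mapping to a bouquet. -/
def chainOf {a b : B.O} {i j : Fin (M + 1)} (ha : pos g a = i) (hb : pos g b = j)
    (w : Ch.Hom B k a b) : LabChain M Y k i j :=
  (chain M Y k).map (Ch.homMap (a' := i) (b' := j) g (𝟙 k) ha hb w)

lemma chainOf_one {a : B.O} {i : Fin (M + 1)} (ha ha' : pos g a = i) :
    chainOf g (k := k) ha ha' (𝟙 _) = LabChain.one i :=
  (congrArg (chain M Y k).map (Ch.homMap_one g (𝟙 k) (a' := i) ha ha')).trans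
    (CategoryTheory.Functor.map_id _ _)

lemma chainOf_mul {a b c : B.O} {i j l : Fin (M + 1)} (ha : pos g a = i) (hb : pos g b = j)
    (hc : pos g c = l) (w : Ch.Hom B k a b) (w' : Ch.Hom B k b c) :
    chainOf g ha hc (w ≫ w') = (chainOf g ha hb w).comp (chainOf g hb hc w') :=
  (congrArg (chain M Y k).map (Ch.homMap_mul g (𝟙 k) (a' := i) (b' := j) (c' := l)
    ha hb hc w w')).trans (Functor.map_comp _ _ _)

/-- Chains do not change along maps over the bouquet. This transfers them between `L F[m, Y]`, the
cones, the necklaces and the ambient space. -/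
lemma chainOf_homMap {a b : A.O} {a' b' : B.O} {i j : Fin (M + 1)} (ha : h.u a = a')
    (hb : h.u b = b') (hi : pos g a' = i) (hj : pos g b' = j) (hi' : (h ≫ g).u a = i)
    (hj' : (h ≫ g).u b = j) (w : Ch.Hom A k a b) :
    chainOf g hi hj (Ch.homMap h (𝟙 k) ha hb w) = chainOf (h ≫ g) hi' hj' w :=
  (congrArg (chain M Y k).map (Ch.homMap_comp' (a'' := i) (b'' := j) h g (𝟙 k) (𝟙 k) rfl
    (Category.comp_id _).symm ha hb hi hj hi' hj' w)).symm

lemma src_pos {a : B.O} {i : Fin (M + 1)} (ha : pos g a = i) {p : SimplexCategory}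
    {σ : B.K.obj (op p)} {s : Fin (p.len + 1)} (h : vertex σ s = B.v a) :
    (BouquetObj.κ (M := M) (Y := Y) (g.f.app (op p) σ)).toOrderHom s = i := by
  refine bouquet_vertex.1 ?_
  rw [vertex_map, h, g.hu]
  exact congrArg _ ha

lemma chainOf_toHom {a b : B.O} {i j : Fin (M + 1)} (ha : pos g a = i) (hb : pos g b = j)
    (x : ChGen B k a b) : chainOf g ha hb x.toHom =
      LabChain.ofSimplex (M := M) (Y := Y) (g.f.app _ x.σ) (src_pos g ha x.src)
        (src_pos g hb x.tgt) x.T := by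
  subst ha hb
  refine (congrArg (chain M Y k).map (Ch.homMap_toHom g (𝟙 k) x)).trans
    ((chain_toHom _).trans ?_)
  obtain ⟨p, σ, s, t, hs, ht, T⟩ := x
  exact congrArg (LabChain.ofSimplex (M := M) (Y := Y) (g.f.app _ σ) _ _)
    (show (Thick p s t).map (𝟙 k) T = T from
      ConcreteCategory.congr_hom ((Thick p s t).map_id k) T)

end chainOf

lemma LabChain.eq_one {M : ℕ} {Y : Type} {k : SimplexCategoryᵒᵖ} {i : Fin (M + 1)}
    (D : LabChain M Y k i i) : D = LabChain.one i :=
  LabChain.ext (funext fun x => Set.Subset.antisymm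
      (fun _ ht => le_antisymm (D.le_right ht) (D.left_le ht))
      (Set.singleton_subset_iff.2 (D.left_mem x)))
    (Set.eq_empty_of_forall_notMem fun z hz =>
      (D.lab_lt (y := z.2) hz).not_ge (D.left_le (D.lab_mem (y := z.2) hz)))

/-! ### Labelled simplicial sets covered by simplices of a bouquet -/

/-- A family of simplices covering `A` and mapped to faces of simplices of a bouquet, such that two
of them have at most one vertex in common. -/
structure Cover (A : Labelled) {M : ℕ} {Y : Type} (g : A ⟶ bouquetLab M Y) where
  Λ : Type
  y : Λ → Y
  p : Λ → SimplexCategory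
  e : ∀ l, A.K.obj (op (p l))
  κ : ∀ l, p l ⟶ ⦋M⦌
  κ_inj : ∀ l, Function.Injective (κ l).toOrderHom
  g_e : ∀ l, g.f.app _ (e l) = BouquetObj.ofHom (κ l) (y l)
  cov : ∀ {q : SimplexCategory} (s : A.K.obj (op q)), ∃ l, ∃ α : q ⟶ p l, A.K.map α.op (e l) = s
  -- The equality of labels belongs here because the copies in a bouquet share all their vertices
  -- and are told apart by their labels alone; for the beads of a necklace the positions suffice.
  sep : ∀ {l l' i j i' j'}, y l = y l' → i < j → (κ l).toOrderHom i = (κ l').toOrderHom i' →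
    (κ l).toOrderHom j = (κ l').toOrderHom j' → l = l'
  u_inj : Function.Injective (pos g)
  v_bij : Function.Bijective A.v

namespace Cover

variable {A : Labelled} {M : ℕ} {Y : Type} {g : A ⟶ bouquetLab M Y} (C : Cover A g)
  {k : SimplexCategoryᵒᵖ}

include C

lemma κ_mono (l : C.Λ) : StrictMono (C.κ l).toOrderHom :=
  (C.κ l).toOrderHom.monotone.strictMono_of_injective (C.κ_inj l)

/-- Vertices of `A` are determined by their positions, so incidence with a simplex of the cover can
be tested in `[M]`. -/
lemma vertex_iff {l : C.Λ} {i : Fin ((C.p l).len + 1)} {a : A.O} :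
    vertex (C.e l) i = A.v a ↔ (C.κ l).toOrderHom i = pos g a := by
  have h1 {b : A.O} (h : vertex (C.e l) i = A.v b) : (C.κ l).toOrderHom i = pos g b := by
    have := src_pos g rfl h
    rw [C.g_e] at this
    exact this
  refine ⟨h1, fun h => ?_⟩
  obtain ⟨b, hb⟩ := C.v_bij.2 (vertex (C.e l) i)
  rw [C.u_inj (h.symm.trans (h1 hb.symm)), hb]

/-- The generator given by a face of a simplex of the cover. -/
def gen {a b : A.O} (l : C.Λ) {i j : Fin ((C.p l).len + 1)} (T : (Thick (C.p l) i j).obj k)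
    (ha : (C.κ l).toOrderHom i = pos g a) (hb : (C.κ l).toOrderHom j = pos g b) : Ch.Hom A k a b :=
  ChGen.toHom ⟨C.p l, C.e l, i, j, C.vertex_iff.2 ha, C.vertex_iff.2 hb, T⟩

lemma chainOf_gen {a b : A.O} (l : C.Λ) {i j : Fin ((C.p l).len + 1)}
    (T : (Thick (C.p l) i j).obj k) (ha : (C.κ l).toOrderHom i = pos g a)
    (hb : (C.κ l).toOrderHom j = pos g b) : chainOf g rfl rfl (C.gen l T ha hb) =
      LabChain.ofSimplex (BouquetObj.ofHom (C.κ l) (C.y l)) ha hb T := by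
  refine (chainOf_toHom g rfl rfl _).trans ?_
  congr 1
  exact C.g_e l

/-- Every simplex is a restriction of some `e l`, and the naturality relation moves a generator from
the restriction to `e l` itself. -/
lemma exists_gen {a b : A.O} (x : ChGen A k a b) : ∃ l, ∃ i j : Fin ((C.p l).len + 1),
    ∃ T : (Thick (C.p l) i j).obj k, ∃ ha hb, x.toHom = C.gen l T ha hb := by
  obtain ⟨p, σ, i, j, hi, hj, T⟩ := x
  obtain ⟨l, α, rfl⟩ := C.cov σ
  have hv (s : Fin (p.len + 1)) :
      vertex (A.K.map α.op (C.e l)) s = vertex (C.e l) (α.toOrderHom s) := by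
    refine (ConcreteCategory.congr_hom (A.K.map_comp α.op _) (C.e l)).symm.trans ?_
    refine congrArg (fun f : ⦋0⦌ ⟶ C.p l => A.K.map f.op (C.e l)) ?_
    exact hom_ext_fin fun _ => rfl
  have hi' := (hv i).symm.trans hi
  have hj' := (hv j).symm.trans hj
  exact ⟨l, _, _, (Thick.map α i j).app k T, C.vertex_iff.1 hi', C.vertex_iff.1 hj',
    (CategoryTheory.Quotient.sound _ (ChRel.nat α (C.e l) i j T hi' hj' hi hj)).symm⟩

/-- Positions do not decrease along a morphism. A path with equal end positions therefore stays at
one vertex, and each of its generators is an identity by `Thick.eq_one`. -/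
lemma eq_eqToHom {a b : A.O} (w : Ch.Hom A k a b) (h : pos g a = pos g b) :
    w = eqToHom (congrArg (Ch.mk k) (C.u_inj h)) := by
  revert h
  refine Ch.induction (fun a b w => ∀ h : pos g a = pos g b,
    w = eqToHom (congrArg (Ch.mk k) (C.u_inj h))) (fun _ _ => rfl) ?_ w
  intro a b c f x ih h
  have h1 : pos g a ≤ pos g b := (chainOf g rfl rfl f).le
  have h2 : pos g b ≤ pos g c := (chainOf g rfl rfl x.toHom).le
  have hab : pos g a = pos g b := le_antisymm h1 (h2.trans_eq h.symm)
  obtain rfl := C.u_inj hab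
  obtain rfl := C.u_inj h
  obtain ⟨l, i, j, T, ha, hb, hx⟩ := C.exists_gen x
  obtain rfl := C.κ_inj l (ha.trans hb.symm)
  rw [ih rfl, hx, Thick.eq_one T]
  exact (Category.id_comp _).trans
    (CategoryTheory.Quotient.sound _ (ChRel.ident (C.e l) i (C.vertex_iff.2 ha)))

lemma eq_id {a : A.O} (w : Ch.Hom A k a a) : w = 𝟙 _ := C.eq_eqToHom w rfl

/-- A joint of a path is a joint of one of its generators, and a generator can be cut there inside
its own simplex. -/
lemma factor {a b : A.O} (w : Ch.Hom A k a b) {t : Fin (M + 1)}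
    (ht : t ∈ (chainOf g rfl rfl w).S 0) :
    ∃ c, pos g c = t ∧ ∃ (w₁ : Ch.Hom A k a c) (w₂ : Ch.Hom A k c b), w = w₁ ≫ w₂ := by
  revert t ht
  refine Ch.induction (fun a b w => ∀ {t : Fin (M + 1)}, t ∈ (chainOf g rfl rfl w).S 0 →
    ∃ c, pos g c = t ∧ ∃ (w₁ : Ch.Hom A k a c) (w₂ : Ch.Hom A k c b), w = w₁ ≫ w₂) ?_ ?_ w
  · intro a t ht
    rw [chainOf_one] at ht
    exact ⟨a, (show t = _ from ht).symm, 𝟙 _, 𝟙 _, (Category.comp_id _).symm⟩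
  · intro a b c f x ih t ht
    rw [chainOf_mul g rfl rfl rfl] at ht
    rcases ht with ht | ht
    · obtain ⟨d, hd, w₁, w₂, rfl⟩ := ih ht
      exact ⟨d, hd, w₁, w₂ ≫ x.toHom, Category.assoc _ _ _⟩
    · obtain ⟨l, i, j, T, ha, hb, hx⟩ := C.exists_gen x
      rw [hx, C.chainOf_gen] at ht
      obtain ⟨s, hs, rfl⟩ := ht
      obtain ⟨d, hd⟩ := C.v_bij.2 (vertex (C.e l) s)
      have hd' := C.vertex_iff.1 hd.symm
      refine ⟨d, hd'.symm, f ≫ C.gen l (Thick.cutL T s hs) ha hd',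
        C.gen l (Thick.cutR T s hs) hd' hb, ?_⟩
      rw [hx, Category.assoc]
      congr 1
      refine Eq.trans ?_ (CategoryTheory.Quotient.sound _ (ChRel.comp (C.e l) i s j
        (C.vertex_iff.2 ha) hd.symm (C.vertex_iff.2 hb) (Thick.cutL T s hs) (Thick.cutR T s hs)))
      rw [Thick.cut]
      rfl

/-- The intermediate vertices of a path are joints of its chain. If there are no inner joints, all
generators but one are endomorphisms, hence identities. -/
lemma exists_gen_of_S {a b : A.O} (w : Ch.Hom A k a b)
    (hS : ∀ t ∈ (chainOf g rfl rfl w).S 0, t = pos g a ∨ t = pos g b) (hab : pos g a ≠ pos g b) :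
    ∃ l, ∃ i j : Fin ((C.p l).len + 1), ∃ T : (Thick (C.p l) i j).obj k, ∃ ha hb,
      w = C.gen l T ha hb := by
  revert hS hab
  refine Ch.induction (fun a b w => (∀ t ∈ (chainOf g rfl rfl w).S 0, t = pos g a ∨ t = pos g b) →
    pos g a ≠ pos g b → ∃ l, ∃ i j : Fin ((C.p l).len + 1),
      ∃ T : (Thick (C.p l) i j).obj k, ∃ ha hb,
      w = C.gen l T ha hb) (fun _ _ h => (h rfl).elim) ?_ w
  intro a b c f x ih hS hac
  rw [chainOf_mul g rfl rfl rfl] at hS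
  rcases hS (pos g b) (Or.inl ((chainOf g rfl rfl f).right_mem 0)) with hb | hb
  · obtain rfl := C.u_inj hb
    rw [C.eq_id f, Category.id_comp]
    exact C.exists_gen x
  · obtain rfl := C.u_inj hb
    rw [C.eq_id x.toHom, Category.comp_id]
    exact ih (fun t ht => hS t (Or.inl ht)) hac

/-- A morphism is determined by its labelled chain. -/
lemma chainOf_inj {a b : A.O} {i j : Fin (M + 1)} {ha : pos g a = i} {hb : pos g b = j}
    {w w' : Ch.Hom A k a b} (h : chainOf g ha hb w = chainOf g ha hb w') : w = w' := by
  subst ha hb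
  induction hN : (pos g b : ℕ) - (pos g a : ℕ) using Nat.strong_induction_on generalizing a b with
  | _ N ih =>
  by_cases hab : pos g a = pos g b
  · rw [C.eq_eqToHom w hab, C.eq_eqToHom w' hab]
  have hlt : pos g a < pos g b := lt_of_le_of_ne (chainOf g rfl rfl w).le hab
  by_cases hS : ∀ t ∈ (chainOf g rfl rfl w).S 0, t = pos g a ∨ t = pos g b
  -- Without inner joints both morphisms are single generators. The label of the first joint and the
  -- two end positions identify the simplex by `sep`, and injectivity of `κ` recovers the sets.
  · obtain ⟨l, i, j, T, hi, hj, rfl⟩ := C.exists_gen_of_S w hS hab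
    obtain ⟨l', i', j', T', hi', hj', rfl⟩ := C.exists_gen_of_S w' (h ▸ hS) hab
    rw [C.chainOf_gen, C.chainOf_gen] at h
    have hy : (pos g a, C.y l) ∈
        (LabChain.ofSimplex (BouquetObj.ofHom (C.κ l) (C.y l)) hi hj T).L :=
      ⟨⟨i, Thick.left_mem T 0, hi⟩, hlt,
        BouquetObj.ends_ne (C.κ l) (s := i) (t := j) (hi ▸ hj ▸ hlt), rfl⟩
    rw [h] at hy
    obtain ⟨_, _, _, hy⟩ := hy
    obtain rfl := C.sep (i := i) (j := j) (i' := i') (j' := j') hy.symm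
      ((C.κ_mono l).lt_iff_lt.1 (hi ▸ hj ▸ hlt)) (hi.trans hi'.symm) (hj.trans hj'.symm)
    obtain rfl := C.κ_inj l (hi.trans hi'.symm)
    obtain rfl := C.κ_inj l (hj.trans hj'.symm)
    congr 1
    refine Thick.ext fun x => ?_
    exact (C.κ_inj l).image_injective (congrFun (congrArg LabChain.S h) x)
  · push Not at hS
    obtain ⟨t, ht, hta, htb⟩ := hS
    have h1 : (pos g a : ℕ) < t := lt_of_le_of_ne ((chainOf g rfl rfl w).left_le ht)
      fun e => hta (Fin.ext e.symm)
    have h2 : (t : ℕ) < (pos g b : Fin (M + 1)) := lt_of_le_of_ne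
      ((chainOf g rfl rfl w).le_right ht) fun e => htb (Fin.ext e)
    -- At an inner joint both morphisms factor through the same vertex. Cancellation of chains
    -- reduces the claim to the factors, whose end positions are closer together.
    obtain ⟨c, rfl, w₁, w₂, rfl⟩ := C.factor w ht
    obtain ⟨c', hc, w₁', w₂', rfl⟩ := C.factor w' (h ▸ ht)
    obtain rfl := C.u_inj hc
    rw [chainOf_mul g rfl rfl rfl, chainOf_mul g rfl rfl rfl] at h
    obtain ⟨h3, h4⟩ := LabChain.comp_inj h
    rw [ih _ (by omega) h3 rfl, ih _ (by omega) h4 rfl]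

/-- Between a joint and a later one, the chain lies on a simplex of the cover with the label of the
first joint. -/
def Good {i j : Fin (M + 1)} (D : LabChain M Y k i j) : Prop :=
  ∀ t y, (t, y) ∈ D.L → ∃ l, C.y l = y ∧ ∃ s s', s < s' ∧ (C.κ l).toOrderHom s = t ∧
    (C.κ l).toOrderHom s' ∈ D.S 0 ∧ ∀ x, ∀ r ∈ D.S x, t ≤ r → r ≤ (C.κ l).toOrderHom s' →
      r ∈ Set.range (C.κ l).toOrderHom

/-- For a generator, its own simplex is the witness at each of its joints, with its end as the later
joint. Concatenation keeps all witnesses valid because the two chains meet only at their common end.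
-/
lemma good_chainOf {a b : A.O} {i j : Fin (M + 1)} {ha : pos g a = i} {hb : pos g b = j}
    (w : Ch.Hom A k a b) : C.Good (chainOf g ha hb w) := by
  subst ha hb
  refine Ch.induction (fun a b w => C.Good (chainOf g rfl rfl w)) ?_ ?_ w
  · intro a
    rw [chainOf_one]
    exact fun t y h => h.elim
  · intro a b c f x ih
    rw [chainOf_mul g rfl rfl rfl]
    rintro t y (h | h)
    · obtain ⟨l, hl, s, s', hs, rfl, h2, h3⟩ := ih t y h
      refine ⟨l, hl, s, s', hs, rfl, Or.inl h2, fun x' r hr h4 h5 => ?_⟩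
      refine hr.elim (fun hr => h3 x' r hr h4 h5) fun hr => ?_
      have := (h5.trans ((chainOf g rfl rfl f).le_right h2)).antisymm (LabChain.left_le _ hr)
      rw [this] at h5 ⊢
      exact ⟨s', ((chainOf g rfl rfl f).le_right h2).antisymm h5⟩
    · obtain ⟨l, i, j, T, ha, hb, hx⟩ := C.exists_gen x
      rw [hx, C.chainOf_gen] at h ⊢
      obtain ⟨⟨u, hu, rfl⟩, h1, _, hy⟩ := h
      refine ⟨l, hy, u, j, (C.κ_mono l).lt_iff_lt.1 (hb ▸ h1), rfl,
        Or.inr ⟨j, Thick.right_mem T 0, rfl⟩, fun x' r hr h4 h5 => ?_⟩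
      rcases hr with hr | ⟨v, -, rfl⟩
      · refine ⟨u, h4.antisymm (((chainOf g rfl rfl f).le_right hr).trans ?_)⟩
        exact ha.symm.trans_le ((C.κ l).toOrderHom.monotone (Thick.left_le T hu))
      · exact ⟨v, rfl⟩

omit C in
lemma good_cutL (C : Cover A g) {i j t : Fin (M + 1)} {D : LabChain M Y k i j} (h : C.Good D)
    (ht : t ∈ D.S 0) : C.Good (D.cutL t ht) := by
  rintro t' y ⟨hL, hlt⟩
  obtain ⟨l, hl, s, s', hs, rfl, h2, h3⟩ := h t' y hL
  rcases le_total ((C.κ l).toOrderHom s') t with h4 | h4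
  · exact ⟨l, hl, s, s', hs, rfl, ⟨h2, h4⟩, fun x r hr => h3 x r hr.1⟩
  · have hlt' : (C.κ l).toOrderHom s < t := hlt
    -- If the cut comes before the later joint, then `t` is itself on the simplex and takes the
    -- place of that joint.
    obtain ⟨v, rfl⟩ := h3 0 t ht hlt'.le h4
    exact ⟨l, hl, s, v, (C.κ_mono l).lt_iff_lt.1 hlt', rfl, ⟨ht, Set.mem_Iic.2 le_rfl⟩,
      fun x r hr h5 h6 => h3 x r hr.1 h5 (h6.trans h4)⟩

lemma good_cutR {i j t : Fin (M + 1)} {D : LabChain M Y k i j} (h : C.Good D)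
    (ht : t ∈ D.S 0) : C.Good (D.cutR t ht) := by
  rintro t' y ⟨hL, hlt⟩
  obtain ⟨l, hl, s, s', hs, rfl, h2, h3⟩ := h t' y hL
  exact ⟨l, hl, s, s', hs, rfl, ⟨h2, hlt.trans ((C.κ_mono l).monotone hs.le)⟩,
    fun x r hr => h3 x r hr.1⟩

/-- Converse to `good_chainOf`, by induction on the difference of the end positions. A chain without
inner joints lies on one simplex of the cover by `Good`; any other is cut at an inner joint, which
`hv` realises as a vertex of `A`. -/
lemma exists_chainOf {a b : A.O} {i j : Fin (M + 1)} (ha : pos g a = i) (hb : pos g b = j)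
    (D : LabChain M Y k i j) (h : C.Good D)
    (hv : ∀ t ∈ D.S 0, ∃ c, pos g c = t) : ∃ w : Ch.Hom A k a b, chainOf g ha hb w = D := by
  subst ha hb
  induction hN : (pos g b : ℕ) - (pos g a : ℕ) using Nat.strong_induction_on generalizing a b with
  | _ N ih =>
  by_cases hab : pos g a = pos g b
  · obtain rfl := C.u_inj hab
    exact ⟨𝟙 _, (chainOf_one g rfl rfl).trans D.eq_one.symm⟩
  have hlt : pos g a < pos g b := lt_of_le_of_ne D.le hab
  by_cases hS : ∀ t ∈ D.S 0, t = pos g a ∨ t = pos g b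
  · obtain ⟨y, hy⟩ := D.lab_ex (D.left_mem 0) hlt
    obtain ⟨l, rfl, s, s', hs, h1, h2, h3⟩ := h _ _ hy
    have hs' := C.κ_mono l hs
    -- The later joint is different from the first one, so in the absence of inner joints it is the
    -- end of the chain.
    have h4 : (C.κ l).toOrderHom s' = pos g b :=
      (hS _ h2).elim (fun h => (hs'.ne (h1.trans h.symm)).elim) id
    have hr : ∀ x, ∀ r ∈ D.S x, r ∈ Set.range (C.κ l).toOrderHom := fun x r hr =>
      h3 x r hr (D.left_le hr) ((D.le_right hr).trans_eq h4.symm)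
    obtain ⟨T, hT⟩ := D.exists_ofSimplex (C.κ l) (C.κ_inj l) (C.y l) h1 h4 hlt hy hS hr
    exact ⟨C.gen l T h1 h4, (C.chainOf_gen l T h1 h4).trans hT⟩
  · push Not at hS
    obtain ⟨t, ht, hta, htb⟩ := hS
    obtain ⟨c, rfl⟩ := hv t ht
    have h1 : (pos g a : ℕ) < pos g c := lt_of_le_of_ne (D.left_le ht) fun e => hta (Fin.ext e.symm)
    have h2 : (pos g c : ℕ) < (pos g b : Fin (M + 1)) := lt_of_le_of_ne
      (D.le_right ht) fun e => htb (Fin.ext e)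
    obtain ⟨w₁, hw₁⟩ := ih _ (by omega) (D.cutL _ ht) (good_cutL C h ht)
      (fun t ht => hv t ht.1) rfl
    obtain ⟨w₂, hw₂⟩ := ih _ (by omega) (D.cutR _ ht) (C.good_cutR h ht)
      (fun t ht => hv t ht.1) rfl
    refine ⟨w₁ ≫ w₂, ?_⟩
    rw [chainOf_mul g rfl rfl rfl, hw₁, hw₂, LabChain.cut]

end Cover

variable {n : ℕ}

/-! ### Precategory objects -/

lemma isPcat_of_bijective {W : DeltaThetaSpace n}
    (h : ∀ d : (Cell n)ᵒᵖ, Function.Bijective (((level 0).obj W).map d.unop.toPt.op)) :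
    isPcat n W := by
  refine ⟨((level 0).obj W).obj (op (Cell.pt n)), ⟨NatIso.ofComponents
    (fun d => (Equiv.ofBijective _ (h d)).toIso) fun {d e} f => ?_⟩⟩
  refine ConcreteCategory.hom_ext _ _ fun a => ?_
  refine Eq.trans ?_ (ConcreteCategory.congr_hom (((level 0).obj W).map_comp d.unop.toPt.op f) a)
  exact congrArg (fun g : e.unop ⟶ Cell.pt n => ((level 0).obj W).map g.op a)
    (Cell.toPt_unique _ _)

lemma level_map_bijective {W : DeltaThetaSpace n} (hW : isPcat n W) {d e : (Cell n)ᵒᵖ}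
    (f : d ⟶ e) : Function.Bijective (((level 0).obj W).map f) := by
  obtain ⟨S, ⟨φ⟩⟩ := hW
  have : ((level 0).obj W).map f = φ.inv.app d ≫ φ.hom.app e := by
    rw [← cancel_epi (φ.hom.app d), ← φ.hom.naturality f, φ.hom_inv_id_app_assoc]
    exact Category.id_comp _
  rw [this]
  exact (isIso_iff_bijective _).1 inferInstance

lemma labObj_v_bijective (W : Pcat n) (d : (Cell n)ᵒᵖ) : Function.Bijective (labObj W d).v :=
  level_map_bijective W.property d.unop.toPt.op

/-- Over a discrete level an element comes from the terminal cell, and restricting it along a point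
of its cell gives back the element it came from. A subobject is stable under this restriction, so it
is discrete too. -/
lemma isPcat_toFunctor {W : DeltaThetaSpace n} (hW : isPcat n W) (S : Subfunctor W) :
    isPcat n S.toFunctor := by
  refine isPcat_of_bijective fun d => ⟨fun a b h => Subtype.ext ?_, fun b => ?_⟩
  · exact (level_map_bijective hW d.unop.toPt.op).1 (congrArg Subtype.val h)
  · obtain ⟨a, ha⟩ := (level_map_bijective hW d.unop.toPt.op).2 b.1
    have h1 : ((level 0).obj W).map d.unop.fromPt.op (((level 0).obj W).map d.unop.toPt.op a) =
        a := by
      refine (ConcreteCategory.congr_hom (((level 0).obj W).map_comp _ _) a).symm.trans ?_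
      refine Eq.trans ?_ (ConcreteCategory.congr_hom (((level 0).obj W).map_id _) a)
      exact congrArg (fun g : Cell.pt n ⟶ Cell.pt n => ((level 0).obj W).map g.op a)
        (Cell.toPt_unique _ _)
    refine ⟨⟨a, ?_⟩, Subtype.ext ha⟩
    rw [← h1, ha]
    exact S.map _ b.2

/-- The legs of a pushout of precategory objects are jointly surjective. -/
lemma Pcat.pushout_cases {A B D : Pcat n} (f : A ⟶ B) (g : A ⟶ D)
    {x : (SimplexCategory × Cell n)ᵒᵖ} (z : (pushout f g).obj.obj x) :
    (∃ b, (pushout.inl f g).hom.app x b = z) ∨ ∃ b, (pushout.inr f g).hom.app x b = z := by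
  -- The union of the two ranges is again a precategory object. The universal property gives a
  -- section of its inclusion into the pushout, so it is everything.
  let S : Subfunctor (pushout f g).obj :=
    Subfunctor.range (pushout.inl f g).hom ⊔ Subfunctor.range (pushout.inr f g).hom
  let P : Pcat n := ⟨S.toFunctor, isPcat_toFunctor (pushout f g).property S⟩
  let l : B ⟶ P := ⟨Subfunctor.lift (pushout.inl f g).hom (G := S) le_sup_left⟩
  let r : D ⟶ P := ⟨Subfunctor.lift (pushout.inr f g).hom (G := S) le_sup_right⟩
  let i : P ⟶ pushout f g := ⟨S.ι⟩
  have hl : l ≫ i = pushout.inl f g := rfl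
  have hr : r ≫ i = pushout.inr f g := rfl
  have hw : f ≫ l = g ≫ r := by
    refine ObjectProperty.hom_ext _ ((cancel_mono S.ι).1 ?_)
    exact congrArg (fun h => h.hom) (pushout.condition (f := f) (g := g))
  have h1 : pushout.desc l r hw ≫ i = 𝟙 _ := by
    refine pushout.hom_ext ?_ ?_
    · rw [pushout.inl_desc_assoc, hl, Category.comp_id]
    · rw [pushout.inr_desc_assoc, hr, Category.comp_id]
  have h2 : S.ι.app x ((pushout.desc l r hw).hom.app x z) = z :=
    ConcreteCategory.congr_hom (NatTrans.congr_app (congrArg (fun h => h.hom) h1) x) z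
  rw [← h2]
  exact ((pushout.desc l r hw).hom.app x z).2

lemma unit_app_eq (A : DeltaThetaSpace n) : (adjL n).unit.app A = unitL A :=
  Category.comp_id (unitL A)

/-- The unit is a pushout of the epimorphism from `A₀` to its components. -/
lemma unit_surjective (A : DeltaThetaSpace n) (x : (SimplexCategory × Cell n)ᵒᵖ) :
    Function.Surjective (((adjL n).unit.app A).app x) := by
  have : Epi (unitL A) := inferInstanceAs (Epi (pushout.inl _ _))
  rw [unit_app_eq, ← epi_iff_surjective]
  exact (NatTrans.epi_iff_epi_app (unitL A)).1 inferInstance x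

/-- The map from `L A` given by a map from `A`. -/
def descL {A : DeltaThetaSpace n} {W : Pcat n} (f : A ⟶ W.obj) : (L n).obj A ⟶ W :=
  ((adjL n).homEquiv A W).symm f

lemma unit_descL {A : DeltaThetaSpace n} {W : Pcat n} (f : A ⟶ W.obj) :
    (adjL n).unit.app A ≫ (descL f).hom = f :=
  ((adjL n).homEquiv_unit A W (descL f)).symm.trans (Equiv.apply_symm_apply _ f)

lemma unit_descL_apply {A : DeltaThetaSpace n} {W : Pcat n} (f : A ⟶ W.obj)
    (x : (SimplexCategory × Cell n)ᵒᵖ) (a : A.obj x) :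
    (descL f).hom.app x (((adjL n).unit.app A).app x a) = f.app x a :=
  ConcreteCategory.congr_hom (NatTrans.congr_app (unit_descL f) x) a

lemma L_hom_ext {A : DeltaThetaSpace n} {W : Pcat n} {f g : (L n).obj A ⟶ W}
    (h : (adjL n).unit.app A ≫ f.hom = (adjL n).unit.app A ≫ g.hom) : f = g :=
  ((adjL n).homEquiv A W).injective (((adjL n).homEquiv_unit A W f).trans
    (h.trans ((adjL n).homEquiv_unit A W g).symm))

lemma unit_L_map {A B : DeltaThetaSpace n} (f : A ⟶ B) :
    (adjL n).unit.app A ≫ ((L n).map f).hom = f ≫ (adjL n).unit.app B :=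
  ((adjL n).unit.naturality f).symm

/-! ### The precategory object of bouquets -/

/-- The bouquets of copies of `Δ[M]` indexed by the sets `Y_d`. -/
def bouquetSpace (M : ℕ) (Y : ThetaSpace n) : DeltaThetaSpace n where
  obj x := BouquetObj M (Y.obj (op x.unop.2)) x.unop.1
  map f := ↾fun z => (z.res f.unop.1).map (Y.map f.unop.2.op)
  map_id _ := ConcreteCategory.hom_ext _ _ fun (z : BouquetObj M (Y.obj _) _) =>
    show (z.res (𝟙 _)).map (Y.map (𝟙 _)) = z from
      BouquetObj.ext (Category.id_comp _) fun _ _ =>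
        ConcreteCategory.congr_hom (Y.map_id _) _
  map_comp f g := ConcreteCategory.hom_ext _ _ fun (z : BouquetObj M (Y.obj _) _) =>
    show (z.res (g.unop.1 ≫ f.unop.1)).map (Y.map (f.unop.2.op ≫ g.unop.2.op)) =
        (((z.res f.unop.1).map (Y.map f.unop.2.op)).res g.unop.1).map (Y.map g.unop.2.op) from
      BouquetObj.ext (Category.assoc _ _ _) fun _ _ =>
        ConcreteCategory.congr_hom (Y.map_comp _ _) _

/-- Vertices carry no labels, so in categorical degree zero only the position in `[M]` is left. -/
lemma isPcat_bouquetSpace (M : ℕ) (Y : ThetaSpace n) : isPcat n (bouquetSpace M Y) := by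
  refine isPcat_of_bijective fun d => ⟨fun a b h => ?_, fun b => ?_⟩
  · have h' := congrArg (fun z : BouquetObj M (Y.obj d) ⦋0⦌ => z.κ.toOrderHom 0) h
    exact BouquetObj.ext_zero (M := M) (Y := Y.obj (op (Cell.pt n))) h'
  · let b' : BouquetObj M (Y.obj d) ⦋0⦌ := b
    exact ⟨BouquetObj.pt M _ (b'.κ.toOrderHom 0), BouquetObj.ext_zero (M := M) (Y := Y.obj d) rfl⟩

/-- The bouquets as a precategory object. -/
def bouquetPcat (M : ℕ) (Y : ThetaSpace n) : Pcat n := ⟨_, isPcat_bouquetSpace M Y⟩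

/-- The vertex `a` of the bouquets. -/
def bouquetPt (M : ℕ) (Y : ThetaSpace n) (a : Fin (M + 1)) : CObj (bouquetPcat M Y) :=
  BouquetObj.pt M (Y.obj (op (Cell.pt n))) a

lemma bouquetPcat_ext {M : ℕ} {Y : ThetaSpace n} {a b : CObj (bouquetPcat M Y)}
    (h : (BouquetObj.κ (M := M) (Y := Y.obj (op (Cell.pt n))) a).toOrderHom 0 =
      (BouquetObj.κ (M := M) (Y := Y.obj (op (Cell.pt n))) b).toOrderHom 0) : a = b :=
  BouquetObj.ext_zero (M := M) (Y := Y.obj (op (Cell.pt n))) h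

/-- A column of `bouquetPcat` is the bouquet on the corresponding set. -/
def bouquetCol (M : ℕ) (Y : ThetaSpace n) (d : (Cell n)ᵒᵖ) :
    labObj (bouquetPcat M Y) d ⟶ bouquetLab M (Y.obj d) where
  f :=
    { app := fun _ => ↾fun z => z
      naturality := fun q _ f => ConcreteCategory.hom_ext _ _
        fun (z : BouquetObj M (Y.obj d) q.unop) =>
          show (z.res f.unop).map (Y.map (𝟙 d)) = z.res f.unop from
            BouquetObj.ext rfl fun _ _ => ConcreteCategory.congr_hom (Y.map_id _) _ }
  u a := (BouquetObj.κ (M := M) (Y := Y.obj (op (Cell.pt n))) a).toOrderHom 0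
  hu _ := BouquetObj.ext_zero (M := M) (Y := Y.obj d) rfl

lemma ThetaSpace.Connected.nonempty_obj {Y : ThetaSpace n} (hY : Y.Connected) (d : (Cell n)ᵒᵖ) :
    Nonempty (Y.obj d) :=
  hY.nonempty.map (Y.map d.unop.toPt.op)

/-- The cover of the bouquet by its simplices. -/
def bouquetCover (M : ℕ) {Y : ThetaSpace n} (hY : Y.Connected) (d : (Cell n)ᵒᵖ) :
    Cover (labObj (bouquetPcat M Y) d) (bouquetCol M Y d) where
  Λ := Y.obj d
  y := id
  p _ := ⦋M⦌
  e y := BouquetObj.ofHom (𝟙 ⦋M⦌) y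
  κ _ := 𝟙 _
  κ_inj _ _ _ h := h
  g_e y := show BouquetObj.ofHom (𝟙 ⦋M⦌) y = BouquetObj.ofHom (𝟙 ⦋M⦌) y from rfl
  cov {q} s := by
    have := hY.nonempty_obj d
    obtain ⟨κ, y, rfl⟩ := BouquetObj.exists_ofHom (M := M) (Y := Y.obj d) s
    exact ⟨y, κ, BouquetObj.ext (M := M) (Y := Y.obj d) (Category.comp_id κ) fun _ _ =>
      ConcreteCategory.congr_hom (Y.map_id _) y⟩
  sep h _ _ _ := h
  u_inj a b h := bouquetPcat_ext (a := a) (b := b) h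
  v_bij := labObj_v_bijective _ d

/-! ### The precategory object `L F[m, Y]` -/

section LFY

variable {m M : ℕ} {Y : ThetaSpace n}

/-- The element of `F[p, X]` given by a simplex of `Δ[p]` and an element of `X`. -/
def F.el {p : SimplexCategory} {X : ThetaSpace n} {x : (SimplexCategory × Cell n)ᵒᵖ}
    (ν : x.unop.1 ⟶ p) (y : X.obj (op x.unop.2)) : ((F n).obj (p, X)).obj x := (ν, y)

/-- The unit `F[m, Y] ⟶ L F[m, Y]`. -/
def LFY.unit (m : ℕ) (Y : ThetaSpace n) : (F n).obj (⦋m⦌, Y) ⟶ (LFY m Y).obj :=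
  (adjL n).unit.app ((F n).obj (⦋m⦌, Y))

/-- The element of `L F[m, Y]` given by a simplex of `Δ[m]` and an element of `Y`. -/
def LFY.el {x : (SimplexCategory × Cell n)ᵒᵖ} (ν : x.unop.1 ⟶ ⦋m⦌) (y : Y.obj (op x.unop.2)) :
    (LFY m Y).obj.obj x :=
  (LFY.unit m Y).app x (F.el ν y)

lemma LFY.exists_el {x : (SimplexCategory × Cell n)ᵒᵖ} (s : (LFY m Y).obj.obj x) :
    ∃ (ν : x.unop.1 ⟶ ⦋m⦌) (y : Y.obj (op x.unop.2)), s = LFY.el ν y := by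
  obtain ⟨⟨ν, y⟩, h⟩ := unit_surjective _ x s
  exact ⟨ν, y, h.symm⟩

lemma LFY.map_el {x x' : (SimplexCategory × Cell n)ᵒᵖ} (f : x ⟶ x') (ν : x.unop.1 ⟶ ⦋m⦌)
    (y : Y.obj (op x.unop.2)) :
    (LFY m Y).obj.map f (LFY.el ν y) = LFY.el (f.unop.1 ≫ ν) (Y.map f.unop.2.op y) :=
  (ConcreteCategory.congr_hom ((LFY.unit m Y).naturality f)
    (F.el ν y)).symm

/-- The vertex `ν` defines a map from `Y` to the discrete level zero of `L F[m, Y]`. It factors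
through the set of components of `Y`, which is a point. -/
lemma LFY.el_eq (hY : Y.Connected) (ν : ⦋0⦌ ⟶ ⦋m⦌) (y y' : Y.obj (op (Cell.pt n))) :
    LFY.el (x := op (⦋0⦌, Cell.pt n)) ν y = LFY.el (x := op (⦋0⦌, Cell.pt n)) ν y' := by
  let φ : Y ⟶ (level 0).obj (LFY m Y).obj :=
    { app := fun d => ↾fun y => LFY.el (x := op (⦋0⦌, d.unop)) ν y
      naturality := fun d e f => ConcreteCategory.hom_ext _ _ fun y => by
        refine Eq.trans ?_ (LFY.map_el (Quiver.Hom.op ((𝟙 _, f.unop) :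
          ((⦋0⦌, e.unop) : SimplexCategory × Cell n) ⟶ (⦋0⦌, d.unop))) ν y).symm
        exact congrArg (fun ν => LFY.el (x := op (⦋0⦌, e.unop)) ν (Y.map f y))
          (Category.id_comp ν).symm }
  obtain ⟨g, hg⟩ := exists_factor _ _ (LFY m Y).property φ
  have h (y : Y.obj (op (Cell.pt n))) : LFY.el (x := op (⦋0⦌, Cell.pt n)) ν y =
      g.app (op (Cell.pt n)) ((toPi₀ Y).app (op (Cell.pt n)) y) :=
    (ConcreteCategory.congr_hom (NatTrans.congr_app hg (op (Cell.pt n))) y).symm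
  obtain ⟨e⟩ := hY
  rw [h, h]
  exact congrArg _ (e.injective rfl)

/-- The map from `F[m, Y]` to the bouquets of copies of `Δ[M]` given by a map `[m] ⟶ [M]`. -/
def toBouquet (Y : ThetaSpace n) (κ : ⦋m⦌ ⟶ ⦋M⦌) :
    (F n).obj (⦋m⦌, Y) ⟶ (bouquetPcat M Y).obj where
  app _ := ↾fun z => BouquetObj.ofHom (M := M) (z.1 ≫ κ) z.2
  naturality _ _ _ := ConcreteCategory.hom_ext _ _ fun _ =>
    BouquetObj.ext (M := M) (Y := Y.obj _) (Category.assoc _ _ _) fun _ _ => rfl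

/-- The map from `L F[m, Y]` to the bouquets of copies of `Δ[M]` given by a map `[m] ⟶ [M]`. -/
def LFY.toBouquet (Y : ThetaSpace n) (κ : ⦋m⦌ ⟶ ⦋M⦌) : LFY m Y ⟶ bouquetPcat M Y :=
  descL (StNec.toBouquet Y κ)

lemma LFY.toBouquet_el (κ : ⦋m⦌ ⟶ ⦋M⦌) {x : (SimplexCategory × Cell n)ᵒᵖ} (ν : x.unop.1 ⟶ ⦋m⦌)
    (y : Y.obj (op x.unop.2)) : (LFY.toBouquet Y κ).hom.app x (LFY.el ν y) =
      BouquetObj.ofHom (M := M) (ν ≫ κ) y :=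
  unit_descL_apply (StNec.toBouquet Y κ) x (ν, y)

lemma LFY.CObj_map_toBouquet (κ : ⦋m⦌ ⟶ ⦋M⦌) (ν : ⦋0⦌ ⟶ ⦋m⦌) (y : Y.obj (op (Cell.pt n))) :
    CObj.map (LFY.toBouquet Y κ) (LFY.el (x := op (⦋0⦌, Cell.pt n)) ν y) =
      bouquetPt M Y (κ.toOrderHom (ν.toOrderHom 0)) :=
  (LFY.toBouquet_el κ (x := op (⦋0⦌, Cell.pt n)) ν y).trans (bouquetPcat_ext rfl)

/-- The cover of `L F[m, Y]` by the simplices of `F[m, Y]`. -/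
def LFY.cover (hY : Y.Connected) (κ : ⦋m⦌ ⟶ ⦋M⦌) (hκ : Function.Injective κ.toOrderHom)
    (d : (Cell n)ᵒᵖ) :
    Cover (labObj (LFY m Y) d) (labMap (LFY.toBouquet Y κ) d ≫ bouquetCol M Y d) where
  Λ := Y.obj d
  y := id
  p _ := ⦋m⦌
  e y := LFY.el (x := op (⦋m⦌, d.unop)) (𝟙 ⦋m⦌) y
  κ _ := κ
  κ_inj _ := hκ
  g_e y := (LFY.toBouquet_el κ (x := op (⦋m⦌, d.unop)) (𝟙 ⦋m⦌) y).trans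
    (congrArg (BouquetObj.ofHom (M := M) · y) (Category.id_comp κ))
  cov {q} s := by
    obtain ⟨ν, y, rfl⟩ := LFY.exists_el (x := op (q, d.unop)) s
    refine ⟨y, ν, (LFY.map_el _ _ _).trans ?_⟩
    exact congrArg₂ (LFY.el (x := op (q, d.unop))) (Category.comp_id ν)
      (ConcreteCategory.congr_hom (Y.map_id _) y)
  sep h _ _ _ := h
  u_inj a b h := by
    obtain ⟨ν, y, rfl⟩ := LFY.exists_el (x := op (⦋0⦌, Cell.pt n)) a
    obtain ⟨ν', y', rfl⟩ := LFY.exists_el (x := op (⦋0⦌, Cell.pt n)) b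
    have h0 : CObj.map (LFY.toBouquet Y κ) (LFY.el (x := op (⦋0⦌, Cell.pt n)) ν y) =
      CObj.map (LFY.toBouquet Y κ) (LFY.el (x := op (⦋0⦌, Cell.pt n)) ν' y') := bouquetPcat_ext h
    have h' : bouquetPt M Y _ = bouquetPt M Y _ := (LFY.CObj_map_toBouquet κ ν y).symm.trans
      (h0.trans (LFY.CObj_map_toBouquet κ ν' y'))
    have h2 : ν.toOrderHom 0 = ν'.toOrderHom 0 := hκ (congrArg
      (fun a => (BouquetObj.κ (M := M) (Y := Y.obj (op (Cell.pt n))) a).toOrderHom 0) h')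
    obtain rfl : ν = ν' := hom_ext_fin fun i => by
      rw [Subsingleton.elim (α := Fin 1) i 0]; exact h2
    -- Injectivity of `κ` has identified the vertices of `[m]`; connectedness of `Y` removes the
    -- dependence on the point of `Y`.
    exact LFY.el_eq hY ν y y'
  v_bij := labObj_v_bijective _ d

end LFY

/-! ### Generators of `c^h` -/

lemma Ch.homMap_toHom_id {A B : Labelled} (g : A ⟶ B) {k : SimplexCategoryᵒᵖ} {a b : A.O}
    {a' b' : B.O} (ha : g.u a = a') (hb : g.u b = b') {p : SimplexCategory} {σ : A.K.obj (op p)}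
    {i j : Fin (p.len + 1)} (hi : vertex σ i = A.v a) (hj : vertex σ j = A.v b)
    (hi' : vertex (g.f.app _ σ) i = B.v a') (hj' : vertex (g.f.app _ σ) j = B.v b')
    (T : (Thick p i j).obj k) :
    Ch.homMap g (𝟙 k) ha hb (ChGen.toHom ⟨p, σ, i, j, hi, hj, T⟩) =
      ChGen.toHom ⟨p, g.f.app _ σ, i, j, hi', hj', T⟩ := by
  subst ha hb
  refine (Ch.homMap_toHom g (𝟙 k) _).trans (congrArg ChGen.toHom (ChGen.congr_T ?_))
  exact ConcreteCategory.congr_hom ((Thick p i j).map_id k) T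

lemma vertex_map_op {K : SSet.{0}} {p q : SimplexCategory} (α : p ⟶ q) (σ : K.obj (op q))
    (s : Fin (p.len + 1)) : vertex (K.map α.op σ) s = vertex σ (α.toOrderHom s) := by
  refine (ConcreteCategory.congr_hom (K.map_comp α.op _) σ).symm.trans ?_
  refine congrArg (fun f : ⦋0⦌ ⟶ q => K.map f.op σ) ?_
  exact hom_ext_fin fun _ => rfl

lemma Ch.toHom_map_op {A : Labelled} {k : SimplexCategoryᵒᵖ} {a b : A.O} {p q : SimplexCategory}
    (α : p ⟶ q) (σ : A.K.obj (op q)) {i j : Fin (p.len + 1)}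
    (hi : vertex (A.K.map α.op σ) i = A.v a) (hj : vertex (A.K.map α.op σ) j = A.v b)
    (T : (Thick p i j).obj k) : ChGen.toHom ⟨p, A.K.map α.op σ, i, j, hi, hj, T⟩ =
      ChGen.toHom ⟨q, σ, α.toOrderHom i, α.toOrderHom j, (vertex_map_op α σ i).symm.trans hi,
        (vertex_map_op α σ j).symm.trans hj, (Thick.map α i j).app k T⟩ :=
  (CategoryTheory.Quotient.sound _ (ChRel.nat α σ i j T _ _ hi hj)).symm

/-! ### Simplices of the cone -/

section Cone

variable {m : ℕ} {Y : ThetaSpace n}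

/-- The inclusion of `L F[m, Y]` into the bouquets of copies of `Δ[m + 1]`. -/
abbrev LFY.incl (m : ℕ) (Y : ThetaSpace n) : LFY m Y ⟶ bouquetPcat (m + 1) Y :=
  LFY.toBouquet Y (dLast ⦋m⦌)

/-- A lift of a simplex of `L F[m, Y]` to `F[m, Y]`. -/
structure Lift (σ : CostructuredArrow yoneda (LFY m Y).obj) where
  ν : σ.left.1 ⟶ ⦋m⦌
  -- When `ν` is constant, `σ` does not remember `y`. The simplex `ν + 1` added in the cone is never
  -- constant and needs a label, which is why the lift is extra data.
  y : Y.obj (op σ.left.2)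
  h : yonedaEquiv σ.hom = LFY.el (x := op σ.left) ν y

variable {σ τ : CostructuredArrow yoneda (LFY m Y).obj}

/-- The map `F[p + 1, θ, k] ⟶ bouquetPcat (m + 1) Y` given by a lift. -/
def Lift.top (a : Lift σ) : yoneda.obj ((succ n).obj σ.left) ⟶ (bouquetPcat (m + 1) Y).obj :=
  yonedaEquiv.symm (BouquetObj.ofHom (M := m + 1) (q := ⦋σ.left.1.len + 1⦌) (plusOne a.ν) a.y)

/-- Both composites send the universal simplex to the simplex `d^{m+1} ∘ ν = (ν + 1) ∘ d^{p+1}` of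
the copy with index `y`. -/
lemma Lift.condition (a : Lift σ) :
    adjunct σ ≫ LFY.incl m Y = (LF n).map ((incl n).app σ.left) ≫ descL a.top := by
  refine L_hom_ext ?_
  have h1 : (adjL n).unit.app _ ≫ (adjunct σ ≫ LFY.incl m Y).hom =
      σ.hom ≫ (LFY.incl m Y).hom :=
    congrArg (· ≫ (LFY.incl m Y).hom) (unit_descL σ.hom)
  have h2 : (adjL n).unit.app _ ≫ ((LF n).map ((incl n).app σ.left) ≫ descL a.top).hom =
      yoneda.map ((incl n).app σ.left) ≫ a.top :=
    (congrArg (· ≫ (descL a.top).hom) (unit_L_map (yoneda.map ((incl n).app σ.left)))).trans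
      ((Category.assoc _ _ _).trans (congrArg (_ ≫ ·) (unit_descL a.top)))
  refine h1.trans (Eq.trans ?_ h2.symm)
  refine yonedaEquiv.injective ((congrArg ((LFY.incl m Y).hom.app _) a.h).trans ?_)
  refine (LFY.toBouquet_el _ _ _).trans ?_
  refine Eq.trans ?_ (yonedaEquiv_naturality a.top ((incl n).app σ.left))
  refine Eq.trans ?_ (congrArg _ (Equiv.apply_symm_apply _ _).symm)
  refine BouquetObj.ext (M := m + 1) (Y := Y.obj _) (dLast_plusOne a.ν).symm fun _ _ => ?_
  exact (ConcreteCategory.congr_hom (Y.map_id _) _).symm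

/-- The map from `W_σ` to the bouquets of copies of `Δ[m + 1]` given by a lift of `σ`. -/
def Cone.desc (a : Lift σ) : Cone σ ⟶ bouquetPcat (m + 1) Y :=
  pushout.desc (LFY.incl m Y) (descL a.top) a.condition

lemma Cone.ι_desc (a : Lift σ) : Cone.ι σ ≫ Cone.desc a = LFY.incl m Y :=
  pushout.inl_desc _ _ _

lemma Cone.simplex_desc (a : Lift σ) : Cone.simplex σ ≫ Cone.desc a = descL a.top :=
  pushout.inr_desc _ _ _

/-- Compatible lifts make the maps `W_σ ⟶ bouquetPcat (m + 1) Y` into a cocone; this is what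
produces the comparison map out of the straightening. -/
lemma Cone.map_desc (f : σ ⟶ τ) (a : Lift σ) (b : Lift τ) (hν : a.ν = f.left.1 ≫ b.ν)
    (hy : a.y = Y.map f.left.2.op b.y) : Cone.map f ≫ Cone.desc b = Cone.desc a := by
  refine pushout.hom_ext ?_ ?_
  · change Cone.ι σ ≫ _ = Cone.ι σ ≫ _
    rw [← Category.assoc, Cone.ι_map, Cone.ι_desc, Cone.ι_desc]
  · change Cone.simplex σ ≫ _ = Cone.simplex σ ≫ _
    rw [← Category.assoc, Cone.simplex_map, Category.assoc, Cone.simplex_desc, Cone.simplex_desc]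
    refine L_hom_ext ?_
    refine (congrArg (· ≫ (descL b.top).hom) (unit_L_map (yoneda.map ((succ n).map f.left)))).trans
      ((Category.assoc _ _ _).trans ((congrArg (_ ≫ ·) (unit_descL b.top)).trans
        (Eq.trans ?_ (unit_descL a.top).symm)))
    refine yonedaEquiv.injective ((yonedaEquiv_naturality b.top _).symm.trans ?_)
    refine (congrArg _ (Equiv.apply_symm_apply _ _)).trans
      (Eq.trans ?_ (Equiv.apply_symm_apply _ _).symm)
    refine BouquetObj.ext (M := m + 1) (Y := Y.obj _) ?_ fun _ _ => hy.symm
    exact (plusOne_comp _ _).symm.trans (congrArg plusOne hν.symm)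

/-- The simplex of `W_σ` given by a simplex of `F[p + 1, θ, k]`. -/
def Cone.el (σ : CostructuredArrow yoneda (LFY m Y).obj) {x : (SimplexCategory × Cell n)ᵒᵖ}
    (f : x.unop ⟶ (succ n).obj σ.left) : (Cone σ).obj.obj x :=
  (Cone.simplex σ).hom.app x (((adjL n).unit.app (yoneda.obj ((succ n).obj σ.left))).app x f)

lemma Cone.cases {x : (SimplexCategory × Cell n)ᵒᵖ} (s : (Cone σ).obj.obj x) :
    (∃ b, (Cone.ι σ).hom.app x b = s) ∨ ∃ f, s = Cone.el σ f := by
  rcases Pcat.pushout_cases _ _ s with ⟨b, hb⟩ | ⟨b, hb⟩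
  · exact Or.inl ⟨b, hb⟩
  · obtain ⟨f, rfl⟩ := unit_surjective _ x b
    exact Or.inr ⟨f, hb.symm⟩

lemma Cone.map_el {x x' : (SimplexCategory × Cell n)ᵒᵖ} (g : x ⟶ x')
    (f : x.unop ⟶ (succ n).obj σ.left) :
    (Cone σ).obj.map g (Cone.el σ f) = Cone.el σ (g.unop ≫ f) :=
  (ConcreteCategory.congr_hom (((adjL n).unit.app (yoneda.obj ((succ n).obj σ.left)) ≫
    (Cone.simplex σ).hom).naturality g) f).symm

lemma Cone.map_app_el (g : σ ⟶ τ) {x : (SimplexCategory × Cell n)ᵒᵖ}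
    (f : x.unop ⟶ (succ n).obj σ.left) :
    (Cone.map g).hom.app x (Cone.el σ f) = Cone.el τ (f ≫ (succ n).map g.left) := by
  have h1 := congrArg (fun h => h.hom) (Cone.simplex_map g)
  have h2 := ConcreteCategory.congr_hom (NatTrans.congr_app h1 x)
    (((adjL n).unit.app (yoneda.obj ((succ n).obj σ.left))).app x f)
  refine h2.trans (congrArg ((Cone.simplex τ).hom.app x) ?_)
  exact ConcreteCategory.congr_hom (NatTrans.congr_app
    (unit_L_map (yoneda.map ((succ n).map g.left))) x) f

lemma Cone.desc_el (a : Lift σ) {x : (SimplexCategory × Cell n)ᵒᵖ}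
    (f : x.unop ⟶ (succ n).obj σ.left) : (Cone.desc a).hom.app x (Cone.el σ f) =
      BouquetObj.ofHom (M := m + 1) (f.1 ≫ plusOne a.ν) (Y.map f.2.op a.y) := by
  have h1 := congrArg (fun h => h.hom) (Cone.simplex_desc a)
  have h2 := ConcreteCategory.congr_hom (NatTrans.congr_app h1 x)
    (((adjL n).unit.app (yoneda.obj ((succ n).obj σ.left))).app x f)
  exact h2.trans (unit_descL_apply a.top x f)

/-- The base of the added simplex is glued to `σ`, and the lift writes `σ` through a simplex of
`F[m, Y]`. -/
lemma Cone.el_incl (a : Lift σ) {x : (SimplexCategory × Cell n)ᵒᵖ} (f : x.unop ⟶ σ.left) :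
    Cone.el σ (f ≫ (incl n).app σ.left) =
      (Cone.ι σ).hom.app x (LFY.el (f.1 ≫ a.ν) (Y.map f.2.op a.y)) := by
  have h1 := congrArg (fun h => h.hom)
    (pushout.condition (f := adjunct σ) (g := (LF n).map ((incl n).app σ.left)))
  have h2 := ConcreteCategory.congr_hom (NatTrans.congr_app h1 x)
    (((adjL n).unit.app (yoneda.obj σ.left)).app x f)
  have h3 : (adjunct σ).hom.app x (((adjL n).unit.app (yoneda.obj σ.left)).app x f) =
      LFY.el (f.1 ≫ a.ν) (Y.map f.2.op a.y) := by
    refine (unit_descL_apply σ.hom x f).trans ?_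
    refine (map_yonedaEquiv σ.hom f).symm.trans ?_
    rw [a.h]
    exact LFY.map_el f.op a.ν a.y
  have h4 : ((LF n).map ((incl n).app σ.left)).hom.app x
      (((adjL n).unit.app (yoneda.obj σ.left)).app x f) =
      ((adjL n).unit.app (yoneda.obj ((succ n).obj σ.left))).app x
        (f ≫ (incl n).app σ.left) :=
    ConcreteCategory.congr_hom (NatTrans.congr_app
      (unit_L_map (yoneda.map ((incl n).app σ.left))) x) f
  refine (congrArg ((Cone.simplex σ).hom.app x) h4).symm.trans (h2.symm.trans ?_)
  exact congrArg ((Cone.ι σ).hom.app x) h3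

end Cone

/-! ### Morphisms of `c^h` of the cone -/

section Cone

variable {m : ℕ} {Y : ThetaSpace n} {σ : CostructuredArrow yoneda (LFY m Y).obj}
  {d : (Cell n)ᵒᵖ} {k : SimplexCategoryᵒᵖ}

/-- The position of a vertex of `W_σ`. -/
abbrev Cone.pos (a : Lift σ) (d : (Cell n)ᵒᵖ) (b : CObj (Cone σ)) : Fin (m + 1 + 1) :=
  StNec.pos (labMap (Cone.desc a) d ≫ bouquetCol (m + 1) Y d) b

/-- The simplex of `W_σ` given by a simplex `α` of `Δ[p + 1]` and a cell `z` of `(θ, k)`. -/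
def Cone.sx (σ : CostructuredArrow yoneda (LFY m Y).obj) {q : SimplexCategory} {e : Cell n}
    (α : q ⟶ ⦋σ.left.1.len + 1⦌) (z : e ⟶ σ.left.2) : (Cone σ).obj.obj (op (q, e)) :=
  Cone.el σ (x := op (q, e)) ((α, z) : (q, e) ⟶ (⦋σ.left.1.len + 1⦌, σ.left.2))

lemma Cone.map_sx {q q' : SimplexCategory} {e e' : Cell n} (β : q' ⟶ q) (w : e' ⟶ e)
    (α : q ⟶ ⦋σ.left.1.len + 1⦌) (z : e ⟶ σ.left.2) :
    (Cone σ).obj.map (Quiver.Hom.op ((β, w) : (q', e') ⟶ (q, e))) (Cone.sx σ α z) =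
      Cone.sx σ (β ≫ α) (w ≫ z) :=
  Cone.map_el (σ := σ) (x := op (q, e)) (x' := op (q', e'))
    (Quiver.Hom.op ((β, w) : (q', e') ⟶ (q, e)))
    ((α, z) : (q, e) ⟶ (⦋σ.left.1.len + 1⦌, σ.left.2))

/-- The simplex of a column of `W_σ` given by an operator `z : d ⟶ (θ, k)`. -/
def Cone.cell (σ : CostructuredArrow yoneda (LFY m Y).obj) (d : (Cell n)ᵒᵖ)
    (z : d.unop ⟶ σ.left.2) : (labObj (Cone σ) d).K.obj (op ⦋σ.left.1.len + 1⦌) :=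
  Cone.sx σ (𝟙 _) z

lemma Cone.map_cell {q : SimplexCategory} (α : q ⟶ ⦋σ.left.1.len + 1⦌) (z : d.unop ⟶ σ.left.2) :
    (labObj (Cone σ) d).K.map α.op (Cone.cell σ d z) = Cone.sx σ α z := by
  refine (Cone.map_sx α (𝟙 d.unop) (𝟙 _) z).trans ?_
  rw [Category.comp_id, Category.id_comp]

lemma Cone.map_dLast_cell (a : Lift σ) (z : d.unop ⟶ σ.left.2) :
    (labObj (Cone σ) d).K.map (dLast σ.left.1).op (Cone.cell σ d z) =
      (labMap (Cone.ι σ) d).f.app (op σ.left.1)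
        (LFY.el (x := op (σ.left.1, d.unop)) a.ν (Y.map z.op a.y)) := by
  refine (Cone.map_cell _ _).trans ?_
  refine Eq.trans ?_ ((Cone.el_incl a (x := op (σ.left.1, d.unop))
    ((𝟙 _, z) : (σ.left.1, d.unop) ⟶ σ.left)).trans ?_)
  · exact congrArg (Cone.el σ (x := op (σ.left.1, d.unop)))
      (Prod.ext (Category.id_comp (dLast σ.left.1)).symm (Category.comp_id z).symm)
  · exact congrArg (fun ν => (Cone.ι σ).hom.app (op (σ.left.1, d.unop))
      (LFY.el (x := op (σ.left.1, d.unop)) ν (Y.map z.op a.y))) (Category.id_comp a.ν)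

lemma Cone.desc_sx (a : Lift σ) {q : SimplexCategory} {e : Cell n}
    (α : q ⟶ ⦋σ.left.1.len + 1⦌) (z : e ⟶ σ.left.2) :
    (Cone.desc a).hom.app (op (q, e)) (Cone.sx σ α z) =
      BouquetObj.ofHom (M := m + 1) (α ≫ plusOne a.ν) (Y.map z.op a.y) :=
  Cone.desc_el a (x := op (q, e)) ((α, z) : (q, e) ⟶ (⦋σ.left.1.len + 1⦌, σ.left.2))

lemma Cone.desc_cell (a : Lift σ) (z : d.unop ⟶ σ.left.2) :
    (labMap (Cone.desc a) d ≫ bouquetCol (m + 1) Y d).f.app (op ⦋σ.left.1.len + 1⦌)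
      (Cone.cell σ d z) = BouquetObj.ofHom (M := m + 1) (plusOne a.ν) (Y.map z.op a.y) :=
  (Cone.desc_sx a (𝟙 _) z).trans
    (congrArg (BouquetObj.ofHom · (Y.map z.op a.y)) (Category.id_comp (plusOne a.ν)))

lemma Cone.pos_cell (a : Lift σ) (z : d.unop ⟶ σ.left.2) {i : Fin (σ.left.1.len + 1 + 1)}
    {b : CObj (Cone σ)} (h : vertex (Cone.cell σ d z) i = (labObj (Cone σ) d).v b) :
    (plusOne a.ν).toOrderHom i = Cone.pos a d b := by
  refine Eq.trans ?_ (src_pos (labMap (Cone.desc a) d ≫ bouquetCol (m + 1) Y d) rfl h)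
  exact congrArg (fun w : BouquetObj (m + 1) (Y.obj d) ⦋σ.left.1.len + 1⦌ => w.κ.toOrderHom i)
    (Cone.desc_cell a z).symm

lemma plusOne_eq_last {p q : SimplexCategory} (ν : p ⟶ q) {i : Fin (p.len + 1 + 1)}
    (h : (plusOne ν).toOrderHom i = Fin.last _) : i = Fin.last _ := by
  induction i using Fin.lastCases with
  | last => rfl
  | cast i =>
    rw [plusOne_castSucc] at h
    exact ((Fin.castSucc_lt_last _).ne h).elim

lemma Cone.pos_ι (a : Lift σ) (b : CObj (LFY m Y)) :
    Cone.pos a d (CObj.map (Cone.ι σ) b) =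
      StNec.pos (labMap (LFY.incl m Y) d ≫ bouquetCol (m + 1) Y d) b :=
  congrArg (bouquetCol (m + 1) Y d).u (CObj.map_map _ _ (Cone.ι_desc a) b)

lemma LFY.pos_incl_ne_last (b : CObj (LFY m Y)) :
    StNec.pos (labMap (LFY.incl m Y) d ≫ bouquetCol (m + 1) Y d) b ≠ Fin.last (m + 1) := by
  obtain ⟨ν, y, rfl⟩ := LFY.exists_el (x := op (⦋0⦌, Cell.pt n)) b
  have h := congrArg (bouquetCol (m + 1) Y d).u (LFY.CObj_map_toBouquet (dLast ⦋m⦌) ν y)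
  refine fun h' => (Fin.castSucc_lt_last (ν.toOrderHom 0)).ne ?_
  exact (dLast_apply ⦋m⦌ _).symm.trans (h.symm.trans h')

lemma Cone.pos_ι_ne_last (a : Lift σ) (b : CObj (LFY m Y)) :
    Cone.pos a d (CObj.map (Cone.ι σ) b) ≠ Fin.last (m + 1) :=
  fun h => LFY.pos_incl_ne_last b ((Cone.pos_ι a b).symm.trans h)

/-- Positions already separate the vertices of `L F[m, Y]`, and they are preserved by the map to the
cone. -/
lemma Cone.ι_injective (hY : Y.Connected) (a : Lift σ) :
    Function.Injective (CObj.map (Cone.ι σ)) := fun b b' h =>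
  (LFY.cover hY (dLast ⦋m⦌) (fun i j hij => Fin.castSucc_injective _
    ((dLast_apply ⦋m⦌ i).symm.trans (hij.trans (dLast_apply ⦋m⦌ j)))) (op (Cell.pt n))).u_inj
      ((Cone.pos_ι a b).symm.trans ((congrArg (Cone.pos a (op (Cell.pt n))) h).trans
        (Cone.pos_ι a b')))

lemma Cone.vertex_cell (z : d.unop ⟶ σ.left.2) (i : Fin (σ.left.1.len + 1 + 1)) :
    vertex (Cone.cell σ d z) i = Cone.sx σ (SimplexCategory.const ⦋0⦌ _ i) z :=
  Cone.map_cell _ _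

lemma Cone.map_sx_vertex {e e' : Cell n} (w : e' ⟶ e) (i : Fin (σ.left.1.len + 1 + 1))
    (z : e ⟶ σ.left.2) : ((level 0).obj (Cone σ).obj).map w.op
      (Cone.sx σ (SimplexCategory.const ⦋0⦌ _ i) z) =
      Cone.sx σ (SimplexCategory.const ⦋0⦌ _ i) (w ≫ z) :=
  (Cone.map_sx (𝟙 _) w _ z).trans (congrArg (Cone.sx σ · (w ≫ z)) (Category.id_comp _))

/-- Level zero of `W_σ` is discrete, so parallel operators in the cell direction act on vertices in
the same way. -/
lemma Cone.sx_vertex {e : Cell n} (i : Fin (σ.left.1.len + 1 + 1)) (z z' : e ⟶ σ.left.2) :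
    Cone.sx σ (SimplexCategory.const ⦋0⦌ _ i) z = Cone.sx σ (SimplexCategory.const ⦋0⦌ _ i) z' := by
  have h (w : e ⟶ σ.left.2) := (Cone.map_sx_vertex (σ := σ) w i (𝟙 _)).trans
    (congrArg (Cone.sx σ _) (Category.comp_id w))
  refine (h z).symm.trans (Eq.trans ?_ (h z'))
  exact ConcreteCategory.congr_hom (isPcat_map_eq (Cone σ).property z.op z'.op) _

lemma Cone.vertex_cell_last (z : d.unop ⟶ σ.left.2) :
    vertex (Cone.cell σ d z) (Fin.last _) = (labObj (Cone σ) d).v (Cone.top σ) := by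
  refine (Cone.vertex_cell z _).trans ((Cone.sx_vertex _ z
    (d.unop.toPt ≫ σ.left.2.fromPt)).trans ?_)
  exact (Cone.map_sx_vertex (σ := σ) d.unop.toPt (Fin.last _) σ.left.2.fromPt).symm

/-- The face of the added simplex opposite to its last vertex comes from `W`, and so do the vertices
of that face. -/
lemma Cone.exists_ι_of_vertex_cell (a : Lift σ) (z : d.unop ⟶ σ.left.2)
    (j : Fin (σ.left.1.len + 1)) : ∃ b : CObj (LFY m Y),
      vertex (Cone.cell σ d z) j.castSucc = (labObj (Cone σ) d).v (CObj.map (Cone.ι σ) b) := by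
  obtain ⟨b, hb⟩ := (labObj_v_bijective (LFY m Y) d).2
    (vertex (K := (labObj (LFY m Y) d).K)
      (LFY.el (x := op (σ.left.1, d.unop)) a.ν (Y.map z.op a.y)) j)
  refine ⟨b, ?_⟩
  refine Eq.trans ?_ ((labMap (Cone.ι σ) d).hu b)
  refine Eq.trans ?_ (congrArg ((labMap (Cone.ι σ) d).f.app (op ⦋0⦌)) hb.symm)
  refine Eq.trans ?_ (vertex_map (labMap (Cone.ι σ) d).f _ j)
  rw [← Cone.map_dLast_cell a z]
  refine Eq.trans ?_ (vertex_map_op _ _ _).symm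
  rw [dLast_apply]

lemma CObj.v_pt (W : Pcat n) (b : CObj W) : (labObj W (op (Cell.pt n))).v b = b := by
  refine Eq.trans ?_ (ConcreteCategory.congr_hom (W.obj.map_id _) b)
  refine congrArg (fun f => W.obj.map (Quiver.Hom.op f) b) ?_
  exact Prod.ext rfl (Cell.toPt_unique _ _)

lemma Cone.obj_cases (b : CObj (Cone σ)) : (∃ b', CObj.map (Cone.ι σ) b' = b) ∨
    ∃ (i : Fin (σ.left.1.len + 1 + 1)) (z : Cell.pt n ⟶ σ.left.2),
      vertex (Cone.cell σ (op (Cell.pt n)) z) i = (labObj (Cone σ) (op (Cell.pt n))).v b := by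
  rcases Cone.cases (σ := σ) (x := op (⦋0⦌, Cell.pt n)) b with h | ⟨⟨α, z⟩, hf⟩
  · exact Or.inl h
  · refine Or.inr ⟨α.toOrderHom 0, z, ?_⟩
    refine (Cone.vertex_cell (d := op (Cell.pt n)) z _).trans
      (Eq.trans ?_ (hf.symm.trans (CObj.v_pt _ b).symm))
    refine congrArg (Cone.sx σ · z) (hom_ext_fin fun i => ?_)
    rw [Subsingleton.elim (α := Fin 1) i 0]
    rfl

/-- Vertices of `W` have positions below `m + 1`, and `ν + 1` takes the value `m + 1` only at the
last vertex. -/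
lemma Cone.eq_top_of_pos (a : Lift σ) {b : CObj (Cone σ)}
    (h : Cone.pos a d b = Fin.last (m + 1)) : b = Cone.top σ := by
  rcases Cone.obj_cases b with ⟨b, rfl⟩ | ⟨i, z, hi⟩
  · exact (Cone.pos_ι_ne_last a b h).elim
  · refine (labObj_v_bijective (Cone σ) (op (Cell.pt n))).1 ?_
    obtain rfl := plusOne_eq_last a.ν ((Cone.pos_cell a z hi).trans h)
    exact hi.symm.trans (Cone.vertex_cell_last (d := op (Cell.pt n)) z)

end Cone

/-! ### Normal form of the morphisms to `⊤` in the cone -/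

section Cone

variable {m : ℕ} {Y : ThetaSpace n} {σ : CostructuredArrow yoneda (LFY m Y).obj}
  {d : (Cell n)ᵒᵖ} {k : SimplexCategoryᵒᵖ}

lemma Cone.pos_top (a : Lift σ) (z : d.unop ⟶ σ.left.2) :
    Cone.pos a d (Cone.top σ) = Fin.last (m + 1) :=
  (Cone.pos_cell a z (Cone.vertex_cell_last z)).symm.trans (plusOne_last a.ν)

/-- The generator of `c^h` of a column of `W_σ` given by a face of a top simplex. -/
def Cone.gen {b b' : CObj (Cone σ)} (z : d.unop ⟶ σ.left.2) {i j : Fin (σ.left.1.len + 1 + 1)}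
    (hi : vertex (Cone.cell σ d z) i = (labObj (Cone σ) d).v b)
    (hj : vertex (Cone.cell σ d z) j = (labObj (Cone σ) d).v b')
    (T : (Thick ⦋σ.left.1.len + 1⦌ i j).obj k) : Ch.Hom (labObj (Cone σ) d) k b b' :=
  ChGen.toHom ⟨⦋σ.left.1.len + 1⦌, Cone.cell σ d z, i, j, hi, hj, T⟩

/-- The functoriality of the morphisms of `c^h` along `W ⟶ W_σ`. -/
abbrev Cone.ιHom {c c' : CObj (LFY m Y)} {b b' : CObj (Cone σ)} (hc : CObj.map (Cone.ι σ) c = b)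
    (hc' : CObj.map (Cone.ι σ) c' = b') (w : Ch.Hom (labObj (LFY m Y) d) k c c') :
    Ch.Hom (labObj (Cone σ) d) k b b' :=
  Ch.homMap (labMap (Cone.ι σ) d) (𝟙 k) hc hc' w

lemma Cone.exists_ιHom_of_toHom {b b' : CObj (Cone σ)} {p : SimplexCategory}
    (s : (labObj (LFY m Y) d).K.obj (op p)) {i j : Fin (p.len + 1)}
    (hi : vertex ((labMap (Cone.ι σ) d).f.app _ s) i = (labObj (Cone σ) d).v b)
    (hj : vertex ((labMap (Cone.ι σ) d).f.app _ s) j = (labObj (Cone σ) d).v b')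
    (T : (Thick p i j).obj k) : ∃ c c', ∃ (hc : CObj.map (Cone.ι σ) c = b)
      (hc' : CObj.map (Cone.ι σ) c' = b') (w : Ch.Hom (labObj (LFY m Y) d) k c c'),
      ChGen.toHom ⟨p, _, i, j, hi, hj, T⟩ = Cone.ιHom hc hc' w := by
  have hv {b : CObj (Cone σ)} {i : Fin (p.len + 1)}
      (hi : vertex ((labMap (Cone.ι σ) d).f.app _ s) i = (labObj (Cone σ) d).v b) :
      ∃ c, vertex s i = (labObj (LFY m Y) d).v c ∧ CObj.map (Cone.ι σ) c = b := by
    obtain ⟨c, hc⟩ := (labObj_v_bijective (LFY m Y) d).2 (vertex s i)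
    refine ⟨c, hc.symm, (labObj_v_bijective (Cone σ) d).1 ?_⟩
    refine ((labMap (Cone.ι σ) d).hu c).symm.trans ?_
    rw [hc, ← vertex_map]
    exact hi
  obtain ⟨c, h1, hc⟩ := hv hi
  obtain ⟨c', h1', hc'⟩ := hv hj
  exact ⟨c, c', hc, hc', _, (Ch.homMap_toHom_id (labMap (Cone.ι σ) d) hc hc' h1 h1' hi hj T).symm⟩

lemma Cone.toHom_cases {b b' : CObj (Cone σ)} (x : ChGen (labObj (Cone σ) d) k b b') :
    (∃ c c', ∃ (hc : CObj.map (Cone.ι σ) c = b) (hc' : CObj.map (Cone.ι σ) c' = b')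
      (w : Ch.Hom (labObj (LFY m Y) d) k c c'), x.toHom = Cone.ιHom hc hc' w) ∨
    ∃ z i j hi hj, ∃ T : (Thick ⦋σ.left.1.len + 1⦌ i j).obj k,
      x.toHom = Cone.gen z hi hj T := by
  obtain ⟨p, s, i, j, hi, hj, T⟩ := x
  rcases Cone.cases (σ := σ) (x := op (p, d.unop)) s with ⟨s, rfl⟩ | ⟨⟨α, z⟩, hf⟩
  · exact Or.inl (Cone.exists_ιHom_of_toHom (d := d) s hi hj T)
  · obtain rfl : s = (labObj (Cone σ) d).K.map
      (Quiver.Hom.op (α : p ⟶ ⦋σ.left.1.len + 1⦌)) (Cone.cell σ d z) :=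
      hf.trans (Cone.map_cell (d := d) (α : p ⟶ ⦋σ.left.1.len + 1⦌) z).symm
    exact Or.inr ⟨z, _, _, _, _, _, Ch.toHom_map_op (A := labObj (Cone σ) d)
      (α : p ⟶ ⦋σ.left.1.len + 1⦌) (Cone.cell σ d z) hi hj T⟩

/-- A chain that ends before the last vertex avoids it altogether, so it lifts along `d^{p+1}` to
the base of the cone, which lies in `W`. -/
lemma Cone.exists_ιHom_of_gen (a : Lift σ) {b b' : CObj (Cone σ)} (z : d.unop ⟶ σ.left.2)
    {i j : Fin (σ.left.1.len + 1 + 1)}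
    (hi : vertex (Cone.cell σ d z) i = (labObj (Cone σ) d).v b)
    (hj : vertex (Cone.cell σ d z) j = (labObj (Cone σ) d).v b')
    (T : (Thick ⦋σ.left.1.len + 1⦌ i j).obj k) (h : j ≠ Fin.last _) :
    ∃ c c', ∃ (hc : CObj.map (Cone.ι σ) c = b) (hc' : CObj.map (Cone.ι σ) c' = b')
      (w : Ch.Hom (labObj (LFY m Y) d) k c c'), Cone.gen z hi hj T = Cone.ιHom hc hc' w := by
  have hr (r : Fin (σ.left.1.len + 1 + 1)) (hr : r ≤ j) :
      ∃ r', (dLast σ.left.1).toOrderHom r' = r :=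
    ⟨r.castPred (fun e => h (Fin.last_le_iff.1 (e ▸ hr))),
      (dLast_apply _ _).trans (Fin.castSucc_castPred _ _)⟩
  have hS : ∀ x, Thick.S T x ⊆ Set.range (dLast σ.left.1).toOrderHom :=
    fun x r hr' => hr r (Thick.le_right T hr')
  obtain ⟨j, rfl⟩ := hr j le_rfl
  obtain ⟨i, rfl⟩ := hr i (Thick.le T)
  obtain ⟨U, rfl⟩ := Thick.exists_lift (dLast σ.left.1) (fun r r' hrr =>
    Fin.castSucc_injective _ ((dLast_apply _ r).symm.trans (hrr.trans (dLast_apply _ r')))) T hS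
  have h1 := (vertex_map_op (dLast σ.left.1) (Cone.cell σ d z) i).trans hi
  have h2 := (vertex_map_op (dLast σ.left.1) (Cone.cell σ d z) j).trans hj
  have h3 := Ch.toHom_map_op (dLast σ.left.1) (Cone.cell σ d z) h1 h2 U
  have e := Cone.map_dLast_cell a z
  obtain ⟨c, c', hc, hc', w, hw⟩ := Cone.exists_ιHom_of_toHom _ (e ▸ h1) (e ▸ h2) U
  refine ⟨c, c', hc, hc', w, h3.symm.trans (Eq.trans ?_ hw)⟩
  exact congrArg ChGen.toHom (ChGen.congr_σ e)

/-- Read the path from its end. A generator that ends at a vertex of `W` does not end at the last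
vertex of an added simplex, whose position is `m + 1`; so it comes from `W`, and its source is again
a vertex of `W`. -/
lemma Cone.exists_ιHom (hY : Y.Connected) (a : Lift σ) {b b' : CObj (Cone σ)}
    (w : Ch.Hom (labObj (Cone σ) d) k b b') {c' : CObj (LFY m Y)}
    (hc' : CObj.map (Cone.ι σ) c' = b') : ∃ c, ∃ (hc : CObj.map (Cone.ι σ) c = b)
      (w₀ : Ch.Hom (labObj (LFY m Y) d) k c c'), w = Cone.ιHom hc hc' w₀ := by
  revert c'
  refine Ch.induction (A := labObj (Cone σ) d) (fun b b' w => ∀ {c' : CObj (LFY m Y)}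
    (hc' : CObj.map (Cone.ι σ) c' = b'), ∃ c, ∃ (hc : CObj.map (Cone.ι σ) c = b)
      (w₀ : Ch.Hom (labObj (LFY m Y) d) k c c'), w = Cone.ιHom hc hc' w₀) ?_ ?_ w
  · intro b c hc
    exact ⟨c, hc, 𝟙 _, (Ch.homMap_one (labMap (Cone.ι σ) d) (𝟙 k) hc hc).symm⟩
  · intro b b' b'' f x ih c'' hc''
    obtain ⟨c', c₁, hc', hc₁, w', hw'⟩ : ∃ c c', ∃ (hc : CObj.map (Cone.ι σ) c = b')
        (hc' : CObj.map (Cone.ι σ) c' = b'')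
        (w : Ch.Hom (labObj (LFY m Y) d) k c c'), x.toHom = Cone.ιHom hc hc' w := by
      rcases Cone.toHom_cases x with h | ⟨z, i, j, hi, hj, T, hx⟩
      · exact h
      · rw [hx]
        refine Cone.exists_ιHom_of_gen a z hi hj T fun hl => ?_
        subst hl
        refine Cone.pos_ι_ne_last (d := d) a c'' ?_
        rw [hc'']
        exact (Cone.pos_cell a z hj).symm.trans (plusOne_last a.ν)
    obtain rfl := Cone.ι_injective hY a (hc₁.trans hc''.symm)
    obtain ⟨c, hc, w, rfl⟩ := ih hc'
    exact ⟨c, hc, w ≫ w', (congrArg (_ ≫ ·) hw').trans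
      (Ch.homMap_mul (labMap (Cone.ι σ) d) (𝟙 k) hc hc' hc₁ w w').symm⟩

/-- Cutting at the largest joint before the end leaves a final piece without inner joints; this
choice is what makes the later decomposition unique. -/
lemma Thick.exists_last_joint {p : ℕ} {i : Fin (p + 1)}
    (T : (Thick ⦋p + 1⦌ i.castSucc (Fin.last (p + 1))).obj k) :
    ∃ j : Fin (p + 1), j.castSucc ∈ Thick.S T 0 ∧
      ∀ r ∈ Thick.S T 0, j.castSucc ≤ r → r = j.castSucc ∨ r = Fin.last (p + 1) := by
  classical
  obtain ⟨j, hj⟩ := (Set.toFinite (Fin.castSucc ⁻¹' Thick.S T 0)).exists_maximal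
    ⟨i, Thick.left_mem T 0⟩
  refine ⟨j, hj.1, fun r hr hjr => ?_⟩
  obtain ⟨r, rfl⟩ | rfl := Fin.eq_castSucc_or_eq_last r
  · exact Or.inl (congrArg Fin.castSucc (le_antisymm
      (hj.2 hr (Fin.castSucc_le_castSucc_iff.1 hjr)) (Fin.castSucc_le_castSucc_iff.1 hjr)))
  · exact Or.inr rfl

lemma Cone.eq_id {b : CObj (Cone σ)} (a : Lift σ) (hb : b = Cone.top σ)
    (x : ChGen (labObj (Cone σ) d) k b b) : x.toHom = 𝟙 _ := by
  have hp : Cone.pos a d b = Fin.last (m + 1) := by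
    subst hb
    exact Cone.pos_top (d := op σ.left.2) a (𝟙 _)
  rcases Cone.toHom_cases x with ⟨c, c', hc, hc', -⟩ | ⟨z, i, j, hi, hj, T, hx⟩
  · subst hc
    exact (Cone.pos_ι_ne_last a c hp).elim
  · obtain rfl := plusOne_eq_last a.ν ((Cone.pos_cell a z hi).trans hp)
    obtain rfl := plusOne_eq_last a.ν ((Cone.pos_cell a z hj).trans hp)
    rw [hx, Thick.eq_one T]
    exact CategoryTheory.Quotient.sound _ (ChRel.ident (Cone.cell σ d z) _ hi)

/-- A morphism from a vertex of `W` to `⊤` is a morphism of `W` followed by a face of a top simplex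
without inner joints. -/
lemma Cone.exists_ιHom_comp_gen (hY : Y.Connected) (a : Lift σ) {b b' : CObj (Cone σ)}
    (w : Ch.Hom (labObj (Cone σ) d) k b b') (hb : b ≠ Cone.top σ) (hb' : b' = Cone.top σ) :
    ∃ c c', ∃ (hc : CObj.map (Cone.ι σ) c = b) (w₀ : Ch.Hom (labObj (LFY m Y) d) k c c')
      (z : d.unop ⟶ σ.left.2) (j : Fin (σ.left.1.len + 1))
      (hj : vertex (Cone.cell σ d z) j.castSucc = (labObj (Cone σ) d).v (CObj.map (Cone.ι σ) c'))
      (hl : vertex (Cone.cell σ d z) (Fin.last _) = (labObj (Cone σ) d).v b')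
      (T : (Thick ⦋σ.left.1.len + 1⦌ j.castSucc (Fin.last (σ.left.1.len + 1))).obj k),
      w = Cone.ιHom hc rfl w₀ ≫ Cone.gen z hj hl T ∧
      ∀ r ∈ Thick.S T 0, r = j.castSucc ∨ r = Fin.last _ := by
  revert hb hb'
  refine Ch.induction (A := labObj (Cone σ) d) (fun b b' w => b ≠ Cone.top σ → b' = Cone.top σ →
    ∃ c c', ∃ (hc : CObj.map (Cone.ι σ) c = b) (w₀ : Ch.Hom (labObj (LFY m Y) d) k c c')
      (z : d.unop ⟶ σ.left.2) (j : Fin (σ.left.1.len + 1))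
      (hj : vertex (Cone.cell σ d z) j.castSucc = (labObj (Cone σ) d).v (CObj.map (Cone.ι σ) c'))
      (hl : vertex (Cone.cell σ d z) (Fin.last _) = (labObj (Cone σ) d).v b')
      (T : (Thick ⦋σ.left.1.len + 1⦌ j.castSucc (Fin.last (σ.left.1.len + 1))).obj k),
      w = Cone.ιHom hc rfl w₀ ≫ Cone.gen z hj hl T ∧
      ∀ r ∈ Thick.S T 0, r = j.castSucc ∨ r = Fin.last _) ?_ ?_ w
  · intro b h h'
    exact (h h').elim
  · intro b b' b'' f x ih hb hb''
    have hp : Cone.pos a d b'' = Fin.last (m + 1) := by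
      subst hb''
      exact Cone.pos_top (d := op σ.left.2) a (𝟙 _)
    by_cases hb' : b' = Cone.top σ
    -- A path that has already reached `⊤` can only continue by identities.
    · obtain rfl := hb'.trans hb''.symm
      rw [Cone.eq_id a hb' x, Category.comp_id]
      exact ih hb hb'
    rcases Cone.toHom_cases x with ⟨c, c', hc, hc', -⟩ | ⟨z, i, l, hi, hl, T, hx⟩
    · subst hc'
      exact (Cone.pos_ι_ne_last a c' hp).elim
    · obtain rfl := plusOne_eq_last a.ν ((Cone.pos_cell a z hl).trans hp)
      obtain ⟨i, rfl⟩ | rfl := Fin.eq_castSucc_or_eq_last i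
      -- Cut the last generator at its last joint. The part before the cut, together with `f`, ends
      -- at a vertex of `W` and hence comes from `W`.
      · obtain ⟨j, hj, hmax⟩ := Thick.exists_last_joint T
        obtain ⟨c', hc'⟩ := Cone.exists_ι_of_vertex_cell a z j
        obtain ⟨c, hc, w₀, hw₀⟩ := Cone.exists_ιHom hY a
          (f ≫ Cone.gen z hi hc' (Thick.cutL T _ hj)) rfl
        refine ⟨c, c', hc, w₀, z, j, hc', hl, Thick.cutR T _ hj, ?_, fun r hr => hmax r hr.1 hr.2⟩
        rw [← hw₀, Category.assoc, hx]
        congr 1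
        refine Eq.trans ?_ (CategoryTheory.Quotient.sound _ (ChRel.comp (Cone.cell σ d z) _ _ _
          hi hc' hl (Thick.cutL T _ hj) (Thick.cutR T _ hj)))
        rw [Thick.cut]
        rfl
      · exact (hb' (Cone.eq_top_of_pos (d := d) a
          ((Cone.pos_cell a z hi).symm.trans (plusOne_last a.ν)))).elim

end Cone

/-! ### Straightening as a pointwise colimit -/

namespace St

variable {W : Pcat n} {X X' : Over W.obj}

/-- The straightening of a representable over an object of `Over W`. -/
def leg {σ : CostructuredArrow yoneda W.obj}
    (u : (CostructuredArrow.toOver yoneda W.obj).obj σ ⟶ X) :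
    (St₀ W).obj σ ⟶ (St W).obj X :=
  (yoneda.leftKanExtensionUnit (St₀ W)).app σ ≫ (yoneda.leftKanExtension (St₀ W)).map
    ((CostructuredArrow.toOverCompOverEquivPresheafCostructuredArrow W.obj).inv.app σ ≫
      (overEquivPresheafCostructuredArrow W.obj).functor.map u)

lemma leg_comp {σ τ : CostructuredArrow yoneda W.obj} (f : σ ⟶ τ)
    (u : (CostructuredArrow.toOver yoneda W.obj).obj τ ⟶ X) :
    (St₀ W).map f ≫ leg u = leg ((CostructuredArrow.toOver yoneda W.obj).map f ≫ u) := by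
  have h1 := (yoneda.leftKanExtensionUnit (St₀ W)).naturality f
  have h2 := (CostructuredArrow.toOverCompOverEquivPresheafCostructuredArrow W.obj).inv.naturality f
  have h3 := congrArg (· ≫ (yoneda.leftKanExtension (St₀ W)).map
    ((CostructuredArrow.toOverCompOverEquivPresheafCostructuredArrow W.obj).inv.app τ ≫
      (overEquivPresheafCostructuredArrow W.obj).functor.map u)) h1
  refine (Category.assoc _ _ _).symm.trans (h3.trans
    ((Category.assoc _ _ _).trans (congrArg (_ ≫ ·) ?_)))
  refine ((yoneda.leftKanExtension (St₀ W)).map_comp _ _).symm.trans (congrArg _ ?_)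
  have h4 := congrArg (· ≫ (overEquivPresheafCostructuredArrow W.obj).functor.map u) h2
  refine (Category.assoc _ _ _).symm.trans (h4.trans
    ((Category.assoc _ _ _).trans (congrArg (_ ≫ ·)
      ((overEquivPresheafCostructuredArrow W.obj).functor.map_comp _ _).symm)))

lemma leg_map {σ : CostructuredArrow yoneda W.obj}
    (u : (CostructuredArrow.toOver yoneda W.obj).obj σ ⟶ X) (g : X ⟶ X') :
    leg u ≫ (St W).map g = leg (u ≫ g) := by
  refine (Category.assoc _ _ _).trans (congrArg (_ ≫ ·) ?_)
  refine ((yoneda.leftKanExtension (St₀ W)).map_comp _ _).symm.trans (congrArg _ ?_)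
  exact (Category.assoc _ _ _).trans (congrArg (_ ≫ ·)
      ((overEquivPresheafCostructuredArrow W.obj).functor.map_comp _ _).symm)

/-- The map to `X` given by a section of the presheaf of `X`. -/
def arrow {σ : CostructuredArrow yoneda W.obj}
    (g : yoneda.obj σ ⟶ (overEquivPresheafCostructuredArrow W.obj).functor.obj X) :
    (CostructuredArrow.toOver yoneda W.obj).obj σ ⟶ X :=
  (overEquivPresheafCostructuredArrow W.obj).functor.preimage
    ((CostructuredArrow.toOverCompOverEquivPresheafCostructuredArrow W.obj).hom.app σ ≫ g)

lemma leg_arrow {σ : CostructuredArrow yoneda W.obj}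
    (g : yoneda.obj σ ⟶ (overEquivPresheafCostructuredArrow W.obj).functor.obj X) :
    leg (arrow g) = (yoneda.leftKanExtensionUnit (St₀ W)).app σ ≫
      (yoneda.leftKanExtension (St₀ W)).map g := by
  unfold leg arrow
  rw [Functor.map_preimage, Iso.inv_hom_id_app_assoc]
  rfl

lemma arrow_comp {σ τ : CostructuredArrow yoneda W.obj} (f : σ ⟶ τ)
    (g : yoneda.obj τ ⟶ (overEquivPresheafCostructuredArrow W.obj).functor.obj X) :
    (CostructuredArrow.toOver yoneda W.obj).map f ≫ arrow g = arrow (yoneda.map f ≫ g) := by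
  refine (overEquivPresheafCostructuredArrow W.obj).functor.map_injective ?_
  have h2 := (CostructuredArrow.toOverCompOverEquivPresheafCostructuredArrow W.obj).hom.naturality f
  dsimp only [Functor.comp_map] at h2
  unfold arrow
  rw [Functor.map_comp, Functor.map_preimage, Functor.map_preimage, reassoc_of% h2]

lemma arrow_surjective {σ : CostructuredArrow yoneda W.obj}
    (u : (CostructuredArrow.toOver yoneda W.obj).obj σ ⟶ X) : ∃ g, arrow g = u := by
  refine ⟨(CostructuredArrow.toOverCompOverEquivPresheafCostructuredArrow W.obj).inv.app σ ≫
      (overEquivPresheafCostructuredArrow W.obj).functor.map u, ?_⟩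
  unfold arrow
  rw [Iso.hom_inv_id_app_assoc, Functor.preimage_map]

/-- The values of the straightening are colimits. -/
def isColimit (X : Over W.obj) (c : CObj W) :
    IsColimit ((EnrichedPresheaf.ev (ThetaSpace n) c).mapCocone
      ((Functor.LeftExtension.mk _ (yoneda.leftKanExtensionUnit (St₀ W))).coconeAt
        ((overEquivPresheafCostructuredArrow W.obj).functor.obj X))) :=
  let Q := CostructuredArrow.proj yoneda
    ((overEquivPresheafCostructuredArrow W.obj).functor.obj X) ⋙
    St₀ W
  -- Colimits of enriched presheaves are formed objectwise, so evaluation preserves them.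
  have : PreservesColimit Q (EnrichedPresheaf.ev (ThetaSpace n) c) :=
    preservesColimit_of_preserves_colimit_cocone (EnrichedPresheaf.colimIsColimit Q)
      (colimit.isColimit (Q ⋙ EnrichedPresheaf.ev (ThetaSpace n) c))
  isColimitOfPreserves (EnrichedPresheaf.ev (ThetaSpace n) c)
    (Functor.isPointwiseLeftKanExtensionOfIsLeftKanExtension _
      (yoneda.leftKanExtensionUnit (St₀ W)) _)

lemma jointly_surjective {c : CObj W} {d : (Cell n)ᵒᵖ} (z : (((St W).obj X).obj c).obj d) :
    ∃ (σ : CostructuredArrow yoneda W.obj)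
      (u : (CostructuredArrow.toOver yoneda W.obj).obj σ ⟶ X)
      (x : (((St₀ W).obj σ).obj c).obj d), ((leg u).app c).app d x = z := by
  obtain ⟨g, x, hx⟩ := Types.jointly_surjective_of_isColimit
    (isColimitOfPreserves ((evaluation _ _).obj d) (isColimit X c)) z
  exact ⟨g.left, arrow g.hom, x, by rw [leg_arrow]; exact hx⟩

/-- The index category of the pointwise Kan extension at `X` consists of the simplices of `X`, so a
family compatible with restriction of simplices is a cocone on it. -/
lemma exists_desc (X : Over W.obj) (c : CObj W) (Z : ThetaSpace n)
    (φ : ∀ (σ : CostructuredArrow yoneda W.obj)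
      (_ : (CostructuredArrow.toOver yoneda W.obj).obj σ ⟶ X), ((St₀ W).obj σ).obj c ⟶ Z)
    (hφ : ∀ {σ τ : CostructuredArrow yoneda W.obj} (f : σ ⟶ τ)
      (u : (CostructuredArrow.toOver yoneda W.obj).obj τ ⟶ X),
      ((St₀ W).map f).app c ≫ φ τ u = φ σ ((CostructuredArrow.toOver yoneda W.obj).map f ≫ u)) :
    ∃ Φ : ((St W).obj X).obj c ⟶ Z, ∀ {σ : CostructuredArrow yoneda W.obj}
      (u : (CostructuredArrow.toOver yoneda W.obj).obj σ ⟶ X), (leg u).app c ≫ Φ = φ σ u := by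
  refine ⟨(isColimit X c).desc ⟨Z,
    { app := fun g => φ g.left (arrow g.hom)
      naturality := fun g g' f => ?_ }⟩, fun {σ} u => ?_⟩
  · refine Eq.trans ?_ (Category.comp_id _).symm
    refine (hφ f.left (arrow g'.hom)).trans (congrArg (φ g.left) ?_)
    rw [arrow_comp, CostructuredArrow.w]
  · obtain ⟨g, rfl⟩ := arrow_surjective u
    rw [leg_arrow]
    exact (isColimit X c).fac _ (CostructuredArrow.mk g)

end St

/-! ### The straightening of `[μ, f]` -/

section Bracket

variable {m : ℕ} {Y : ThetaSpace n} {P P' : MonoPair m Y}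
  {σ τ : CostructuredArrow yoneda (LFY m Y).obj}

/-- The element of `F[ℓ, X]` given by a simplex of `[μ, f]`. -/
def bracketEl (u : (CostructuredArrow.toOver yoneda (LFY m Y).obj).obj σ ⟶ (bracket m Y).obj P) :
    (σ.left.1 ⟶ P.obj.1.left) × P.X.obj (op σ.left.2) :=
  yonedaEquiv (F := (F n).obj (P.obj.1.left, P.X)) u.left

lemma bracketEl_comp (f : σ ⟶ τ)
    (u : (CostructuredArrow.toOver yoneda (LFY m Y).obj).obj τ ⟶ (bracket m Y).obj P) :
    bracketEl ((CostructuredArrow.toOver yoneda (LFY m Y).obj).map f ≫ u) =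
      (f.left.1 ≫ (bracketEl u).1, P.X.map f.left.2.op (bracketEl u).2) :=
  (yonedaEquiv_naturality (F := (F n).obj (P.obj.1.left, P.X)) u.left f.left).symm

/-- The lift to `F[m, Y]` of a simplex of `[μ, f]`. -/
def bracketLift (u : (CostructuredArrow.toOver yoneda (LFY m Y).obj).obj σ ⟶ (bracket m Y).obj P) :
    Lift σ where
  ν := (bracketEl u).1 ≫ P.μ
  y := P.f.app _ (bracketEl u).2
  h := congrArg yonedaEquiv (Over.w u).symm

lemma Lift.congr {a b : Lift σ} (h₁ : a.ν = b.ν) (h₂ : a.y = b.y) : a = b := by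
  cases a; cases b; cases h₁; cases h₂; rfl

/-- The lift records only the image in `F[m, Y]`, which maps over `[m]` and over `Y` leave alone.
Naturality of the comparison map in `(μ, f)` rests on this. -/
lemma bracketLift_map
    (u : (CostructuredArrow.toOver yoneda (LFY m Y).obj).obj σ ⟶ (bracket m Y).obj P)
    (g : P ⟶ P') : bracketLift (u ≫ (bracket m Y).map g) = bracketLift u := by
  refine Lift.congr ?_ ?_
  · exact (Category.assoc _ _ _).trans (congrArg (_ ≫ ·) (Over.w g.hom.1))
  · exact ConcreteCategory.congr_hom (NatTrans.congr_app (Over.w g.hom.2) _) (bracketEl u).2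

variable (hY : Y.Connected)

lemma map_incl_vertexLFY (i : Fin (m + 1)) : CObj.map (LFY.incl m Y) (vertexLFY m hY i) =
    bouquetPt (m + 1) Y i.castSucc :=
  (LFY.CObj_map_toBouquet (dLast ⦋m⦌) _ _).trans
    (congrArg (bouquetPt (m + 1) Y) (dLast_apply ⦋m⦌ i))

lemma Cone.map_desc_ι (a : Lift σ) (i : Fin (m + 1)) :
    CObj.map (Cone.desc a) (CObj.map (Cone.ι σ) (vertexLFY m hY i)) =
      bouquetPt (m + 1) Y i.castSucc :=
  (CObj.map_map _ _ (Cone.ι_desc a) _).trans (map_incl_vertexLFY hY i)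

lemma Cone.map_desc_top (a : Lift σ) :
    CObj.map (Cone.desc a) (Cone.top σ) = bouquetPt (m + 1) Y (Fin.last (m + 1)) :=
  bouquetPcat_ext (Cone.pos_top (d := op σ.left.2) a (𝟙 _))

/-- The `Θ`-space in which both sides are compared. -/
abbrev Ambient (m : ℕ) (Y : ThetaSpace n) (i : Fin (m + 1)) : ThetaSpace n :=
  CHom (bouquetPcat (m + 1) Y) (bouquetPt (m + 1) Y i.castSucc)
    (bouquetPt (m + 1) Y (Fin.last (m + 1)))

/-- The map from the straightening of a representable given by a lift. -/
def Cone.toAmbient (i : Fin (m + 1)) (a : Lift σ) :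
    ((St₀ (LFY m Y)).obj σ).obj (vertexLFY m hY i) ⟶ Ambient m Y i :=
  CHomMap (Cone.desc a) (Cone.map_desc_ι hY a i) (Cone.map_desc_top a)

/-- The preferred lifts are compatible with restriction of simplices of `[μ, f]`, so the maps from
the cones descend to the colimit. -/
lemma exists_straighteningDesc (i : Fin (m + 1)) (P : MonoPair m Y) :
    ∃ Φ : (straighteningSide m hY i).obj P ⟶ Ambient m Y i,
      ∀ {σ : CostructuredArrow yoneda (LFY m Y).obj}
        (u : (CostructuredArrow.toOver yoneda (LFY m Y).obj).obj σ ⟶ (bracket m Y).obj P),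
        (St.leg u).app (vertexLFY m hY i) ≫ Φ = Cone.toAmbient hY i (bracketLift u) := by
  refine St.exists_desc _ _ _ (fun σ u => Cone.toAmbient hY i (bracketLift u)) fun {σ τ} f u => ?_
  have h := bracketEl_comp f u
  refine CHomMap_comp (Cone.map f) (Cone.desc (bracketLift u)) (Cone.map_desc f _ _ ?_ ?_)
    _ _ _ _ _ _
  · exact (congrArg (fun z : (_ ⟶ P.obj.1.left) × _ => z.1 ≫ P.μ) h).trans (Category.assoc _ _ _)
  · refine (congrArg (fun z : (_ ⟶ P.obj.1.left) × P.X.obj _ => P.f.app _ z.2) h).trans ?_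
    exact ConcreteCategory.congr_hom (P.f.naturality f.left.2.op) _

/-- The comparison map from the straightening of `[μ, f]`. -/
def straighteningDesc (i : Fin (m + 1)) (P : MonoPair m Y) :
    (straighteningSide m hY i).obj P ⟶ Ambient m Y i :=
  (exists_straighteningDesc hY i P).choose

lemma leg_straighteningDesc (i : Fin (m + 1)) 
    (u : (CostructuredArrow.toOver yoneda (LFY m Y).obj).obj σ ⟶ (bracket m Y).obj P)
    {d : (Cell n)ᵒᵖ} (w : CHomAt (Cone σ) d (CObj.map (Cone.ι σ) (vertexLFY m hY i)) (Cone.top σ)) :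
    (straighteningDesc hY i P).app d (((St.leg u).app (vertexLFY m hY i)).app d w) =
      Ch.homMap (labMap (Cone.desc (bracketLift u)) d) (𝟙 _) (Cone.map_desc_ι hY _ i)
        (Cone.map_desc_top _) w :=
  ConcreteCategory.congr_hom (NatTrans.congr_app
    ((exists_straighteningDesc hY i P).choose_spec u) d) w

lemma straighteningDesc_naturality (i : Fin (m + 1)) (g : P ⟶ P') :
    (straighteningSide m hY i).map g ≫ straighteningDesc hY i P' = straighteningDesc hY i P := by
  ext d z
  obtain ⟨σ, u, w, rfl⟩ := St.jointly_surjective z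
  refine Eq.trans ?_ (leg_straighteningDesc hY i u w).symm
  have h := ConcreteCategory.congr_hom (NatTrans.congr_app (congrArg
    (fun h => h.app (vertexLFY m hY i)) (St.leg_map u ((bracket m Y).map g))) d) w
  refine (congrArg ((straighteningDesc hY i P').app d) h).trans ?_
  refine (leg_straighteningDesc hY i (u ≫ (bracket m Y).map g) w).trans ?_
  have e := bracketLift_map u g
  generalize bracketLift (u ≫ (bracket m Y).map g) = a at e
  subst e
  rfl

/-- The top-dimensional simplices of `[μ, f]`. -/
def topSimplex (P : MonoPair m Y) (d : (Cell n)ᵒᵖ) (x : P.X.obj d) :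
    CostructuredArrow yoneda (LFY m Y).obj :=
  CostructuredArrow.mk (Y := (P.obj.1.left, d.unop))
    (yonedaEquiv.symm (F.el (x := op (P.obj.1.left, d.unop)) (𝟙 P.obj.1.left) x) ≫
      ((bracket m Y).obj P).hom)

/-- The top-dimensional simplices of `[μ, f]`, as maps to `[μ, f]`. -/
def topArrow (P : MonoPair m Y) (d : (Cell n)ᵒᵖ) (x : P.X.obj d) :
    (CostructuredArrow.toOver yoneda (LFY m Y).obj).obj (topSimplex P d x) ⟶ (bracket m Y).obj P :=
  Over.homMk (yonedaEquiv.symm (F.el (x := op (P.obj.1.left, d.unop)) (𝟙 P.obj.1.left) x)) rfl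

lemma bracketEl_topArrow (P : MonoPair m Y) (d : (Cell n)ᵒᵖ) (x : P.X.obj d) :
    bracketEl (topArrow P d x) = (𝟙 P.obj.1.left, x) :=
  Equiv.apply_symm_apply (yonedaEquiv (F := (F n).obj (P.obj.1.left, P.X))) _

end Bracket

/-! ### Maps of cones and reduction to the top-dimensional simplices of `[μ, f]` -/

section Cone

variable {m : ℕ} {Y : ThetaSpace n} {σ τ : CostructuredArrow yoneda (LFY m Y).obj}
  {d : (Cell n)ᵒᵖ} {k : SimplexCategoryᵒᵖ}

lemma Cone.map_app_sx (g : σ ⟶ τ) {q : SimplexCategory} {e : Cell n}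
    (α : q ⟶ ⦋σ.left.1.len + 1⦌) (z : e ⟶ σ.left.2) :
    (Cone.map g).hom.app (op (q, e)) (Cone.sx σ α z) =
      Cone.sx τ (α ≫ plusOne g.left.1) (z ≫ g.left.2) :=
  Cone.map_app_el g (x := op (q, e)) ((α, z) : (q, e) ⟶ (⦋σ.left.1.len + 1⦌, σ.left.2))

lemma Cone.map_app_cell (g : σ ⟶ τ) (z : d.unop ⟶ σ.left.2) :
    (labMap (Cone.map g) d).f.app (op ⦋σ.left.1.len + 1⦌) (Cone.cell σ d z) =
      (labObj (Cone τ) d).K.map (plusOne g.left.1).op (Cone.cell τ d (z ≫ g.left.2)) := by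
  refine (Cone.map_app_sx g (𝟙 _) z).trans (Eq.trans ?_ (Cone.map_cell _ _).symm)
  exact congrArg (Cone.sx τ · _) (Category.id_comp _)

lemma Cone.homMap_ιHom (g : σ ⟶ τ) {c c' : CObj (LFY m Y)} {b b' : CObj (Cone σ)}
    {e e' : CObj (Cone τ)} (hc : CObj.map (Cone.ι σ) c = b) (hc' : CObj.map (Cone.ι σ) c' = b')
    (he : CObj.map (Cone.map g) b = e) (he' : CObj.map (Cone.map g) b' = e')
    (h : CObj.map (Cone.ι τ) c = e) (h' : CObj.map (Cone.ι τ) c' = e')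
    (w : Ch.Hom (labObj (LFY m Y) d) k c c') :
    Ch.homMap (labMap (Cone.map g) d) (𝟙 k) he he' (Cone.ιHom hc hc' w) = Cone.ιHom h h' w :=
  (Ch.homMap_comp' (labMap (Cone.ι σ) d) (labMap (Cone.map g) d) (𝟙 k) (𝟙 k)
    (gh := labMap (Cone.ι τ) d) (congrArg (labMap · d) (Cone.ι_map g).symm)
    (Category.comp_id _).symm hc hc' he he' h h' w).symm

lemma Cone.homMap_gen (g : σ ⟶ τ) {b b' : CObj (Cone σ)} {e e' : CObj (Cone τ)}
    (he : CObj.map (Cone.map g) b = e) (he' : CObj.map (Cone.map g) b' = e')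
    (z : d.unop ⟶ σ.left.2) {i j : Fin (σ.left.1.len + 1 + 1)}
    (hi : vertex (Cone.cell σ d z) i = (labObj (Cone σ) d).v b)
    (hj : vertex (Cone.cell σ d z) j = (labObj (Cone σ) d).v b')
    (T : (Thick ⦋σ.left.1.len + 1⦌ i j).obj k) : ∃ hi' hj',
    Ch.homMap (labMap (Cone.map g) d) (𝟙 k) he he' (Cone.gen z hi hj T) =
      Cone.gen (z ≫ g.left.2) hi' hj' ((Thick.map (plusOne g.left.1) i j).app k T) := by
  have h {i : Fin (σ.left.1.len + 1 + 1)} {b : CObj (Cone σ)} {e : CObj (Cone τ)}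
      (he : CObj.map (Cone.map g) b = e)
      (hi : vertex (Cone.cell σ d z) i = (labObj (Cone σ) d).v b) :
      vertex ((labMap (Cone.map g) d).f.app (op ⦋σ.left.1.len + 1⦌) (Cone.cell σ d z)) i =
        (labObj (Cone τ) d).v e :=
    (vertex_map _ _ _).trans ((congrArg _ hi).trans (((labMap (Cone.map g) d).hu b).trans
      (congrArg _ he)))
  have e₁ := Cone.map_app_cell g z
  have h₁ := e₁ ▸ h he hi
  have h₂ := e₁ ▸ h he' hj
  refine ⟨(vertex_map_op _ _ _).symm.trans h₁, (vertex_map_op _ _ _).symm.trans h₂, ?_⟩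
  refine (Ch.homMap_toHom_id (labMap (Cone.map g) d) he he' hi hj (h he hi) (h he' hj) T).trans ?_
  exact (congrArg ChGen.toHom (ChGen.congr_σ e₁)).trans
    (Ch.toHom_map_op (A := labObj (Cone τ) d) (plusOne g.left.1) _ h₁ h₂ T)

lemma Thick.map_id_eq {p : SimplexCategory} {i j : Fin (p.len + 1)} {α : p ⟶ p} (hα : α = 𝟙 p)
    (T : (Thick p i j).obj k) : HEq ((Thick.map α i j).app k T) T := by
  subst hα
  refine heq_of_eq (Thick.ext fun x => ?_)
  exact Set.image_id _

lemma Cone.gen_congr {b b' : CObj (Cone σ)} {z z' : d.unop ⟶ σ.left.2} (hz : z = z')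
    {i i' j j' : Fin (σ.left.1.len + 1 + 1)} (h : i = i') (h' : j = j')
    (hi : vertex (Cone.cell σ d z) i = (labObj (Cone σ) d).v b)
    (hj : vertex (Cone.cell σ d z) j = (labObj (Cone σ) d).v b')
    (hi' : vertex (Cone.cell σ d z') i' = (labObj (Cone σ) d).v b)
    (hj' : vertex (Cone.cell σ d z') j' = (labObj (Cone σ) d).v b')
    {T : (Thick ⦋σ.left.1.len + 1⦌ i j).obj k} {T' : (Thick ⦋σ.left.1.len + 1⦌ i' j').obj k}
    (hT : HEq T T') : Cone.gen z hi hj T = Cone.gen z' hi' hj' T' := by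
  subst hz h h'
  rw [eq_of_heq hT]

variable {P : MonoPair m Y} (hY : Y.Connected)

/-- The morphisms in the straightening of `[μ, f]` given by a morphism of `L F[m, Y]`, an element of
`X` and a face of `Δ[ℓ + 1]`. -/
def topEl {i : Fin (m + 1)} (x : P.X.obj d) {c : CObj (LFY m Y)}
    (w : Ch.Hom (labObj (LFY m Y) d) (op d.unop.2) (vertexLFY m hY i) c)
    {r s : Fin (P.obj.1.left.len + 1 + 1)}
    (hr : vertex (Cone.cell (topSimplex P d x) d (𝟙 d.unop)) r =
      (labObj (Cone (topSimplex P d x)) d).v (CObj.map (Cone.ι (topSimplex P d x)) c))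
    (hs : vertex (Cone.cell (topSimplex P d x) d (𝟙 d.unop)) s =
      (labObj (Cone (topSimplex P d x)) d).v (Cone.top (topSimplex P d x)))
    (T : (Thick ⦋P.obj.1.left.len + 1⦌ r s).obj (op d.unop.2)) :
    ((straighteningSide m hY i).obj P).obj d :=
  ((St.leg (topArrow P d x)).app (vertexLFY m hY i)).app d
    (Cone.ιHom (σ := topSimplex P d x) rfl rfl w ≫ Cone.gen (𝟙 d.unop) hr hs T :
      CHomAt (Cone (topSimplex P d x)) d _ _)

/-- Represent the point over some simplex `σ` in normal form. The restriction `σ'` of `σ` along the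
cell operator of the last generator maps both to `σ` and to a top-dimensional simplex. The morphism
comes from the cone on `σ'`, and the colimit identifies its two images. -/
lemma exists_topEl {i : Fin (m + 1)} (v : ((straighteningSide m hY i).obj P).obj d) :
    ∃ (x : P.X.obj d) (c : CObj (LFY m Y))
      (w : Ch.Hom (labObj (LFY m Y) d) (op d.unop.2) (vertexLFY m hY i) c)
      (r s : Fin (P.obj.1.left.len + 1 + 1)) (hr : _) (hs : _)
      (T : (Thick ⦋P.obj.1.left.len + 1⦌ r s).obj (op d.unop.2)),
      v = topEl hY x w hr hs T ∧ ∀ t ∈ Thick.S T 0, t = r ∨ t = s := by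
  obtain ⟨σ, u, w, rfl⟩ := St.jointly_surjective v
  have hne : CObj.map (Cone.ι σ) (vertexLFY m hY i) ≠ Cone.top σ := fun h =>
    Cone.pos_ι_ne_last (d := d) (bracketLift u) (vertexLFY m hY i)
      ((congrArg (Cone.pos (bracketLift u) d) h).trans
        (Cone.pos_top (d := op σ.left.2) (bracketLift u) (𝟙 _)))
  obtain ⟨c, c', hc, w₀, z, j, hj, hl, T, rfl, hT⟩ :=
    Cone.exists_ιHom_comp_gen hY (bracketLift u) w hne rfl
  obtain rfl := Cone.ι_injective hY (bracketLift u) hc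
  let x : P.X.obj d := P.X.map z.op (bracketEl u).2
  let σ' : CostructuredArrow yoneda (LFY m Y).obj := CostructuredArrow.mk (Y := (σ.left.1, d.unop))
    (yoneda.map ((𝟙 _, z) : (σ.left.1, d.unop) ⟶ σ.left) ≫ σ.hom)
  let f₁ : σ' ⟶ σ := CostructuredArrow.homMk ((𝟙 _, z) : (σ.left.1, d.unop) ⟶ σ.left) rfl
  -- Both composites are the simplex of `F[ℓ, X]` with components `(bracketEl u).1` and `x`.
  have hu : yoneda.map (((bracketEl u).1, 𝟙 d.unop) : (σ.left.1, d.unop) ⟶ (P.obj.1.left, d.unop)) ≫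
      (topArrow P d x).left = yoneda.map ((𝟙 _, z) : (σ.left.1, d.unop) ⟶ σ.left) ≫ u.left := by
    refine (yonedaEquiv (F := (F n).obj (P.obj.1.left, P.X))).injective ?_
    refine (yonedaEquiv_naturality (F := (F n).obj (P.obj.1.left, P.X)) _ _).symm.trans
      (Eq.trans ?_ (yonedaEquiv_naturality (F := (F n).obj (P.obj.1.left, P.X)) _ _))
    refine (congrArg _ (bracketEl_topArrow P d x)).trans (Prod.ext ?_ ?_)
    · exact (Category.comp_id (bracketEl u).1).trans (Category.id_comp _).symm
    · exact ConcreteCategory.congr_hom (P.X.map_id _) x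
  let f₂ : σ' ⟶ topSimplex P d x := CostructuredArrow.homMk
    (((bracketEl u).1, 𝟙 d.unop) : (σ.left.1, d.unop) ⟶ (P.obj.1.left, d.unop)) (by
      refine Eq.trans ?_ ((congrArg (· ≫ ((bracket m Y).obj P).hom) hu).trans ?_)
      · exact (Category.assoc _ _ _).symm
      · exact (Category.assoc _ _ _).trans (congrArg (_ ≫ ·) (Over.w u)))
  have hf : (CostructuredArrow.toOver yoneda (LFY m Y).obj).map f₁ ≫ u =
      (CostructuredArrow.toOver yoneda (LFY m Y).obj).map f₂ ≫ topArrow P d x :=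
    Over.OverMorphism.ext hu.symm
  let a : Lift σ' := bracketLift ((CostructuredArrow.toOver yoneda (LFY m Y).obj).map f₁ ≫ u)
  obtain ⟨c'', hc''⟩ := Cone.exists_ι_of_vertex_cell (d := d) a (𝟙 d.unop) j
  have he {τ : CostructuredArrow yoneda (LFY m Y).obj} (f : σ' ⟶ τ) (c : CObj (LFY m Y)) :
      CObj.map (Cone.map f) (CObj.map (Cone.ι σ') c) = CObj.map (Cone.ι τ) c :=
    CObj.map_map _ _ (Cone.ι_map f) c
  obtain ⟨h₁, h₂, h₃⟩ := Cone.homMap_gen f₁ (he f₁ c'') (Cone.map_top f₁) (𝟙 d.unop) hc''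
    (Cone.vertex_cell_last _) T
  have hz : 𝟙 d.unop ≫ f₁.left.2 = z := Category.id_comp z
  have hα : plusOne f₁.left.1 = 𝟙 _ := plusOne_id _
  have hv : vertex (Cone.cell σ d (𝟙 d.unop ≫ f₁.left.2))
      ((plusOne f₁.left.1).toOrderHom j.castSucc) = vertex (Cone.cell σ d z) j.castSucc :=
    congrArg₂ (fun z α => vertex (Cone.cell σ d z) (SimplexCategory.Hom.toOrderHom α j.castSucc))
      hz hα
  obtain rfl : c'' = c' := Cone.ι_injective hY (bracketLift u)
    ((labObj_v_bijective (Cone σ) d).1 (h₁.symm.trans (hv.trans hj)))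
  have e₁ : Cone.gen z hj hl T = Ch.homMap (labMap (Cone.map f₁) d) (𝟙 _) (he f₁ c'')
      (Cone.map_top f₁) (Cone.gen (𝟙 d.unop) hc'' (Cone.vertex_cell_last _) T) :=
    ((Cone.gen_congr hz (congrArg (fun α => SimplexCategory.Hom.toOrderHom α j.castSucc) hα)
      (congrArg (fun α => SimplexCategory.Hom.toOrderHom α (Fin.last _)) hα) h₁ h₂ hj hl
      (Thick.map_id_eq hα T)).symm.trans h₃.symm)
  obtain ⟨g₁, g₂, g₃⟩ : ∃ hi' hj', _ = Cone.gen (𝟙 d.unop) hi' hj'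
      ((Thick.map (plusOne f₂.left.1) j.castSucc (Fin.last _)).app _ T) := by
    have := Cone.homMap_gen f₂ (he f₂ c'') (Cone.map_top f₂) (𝟙 d.unop) hc''
      (Cone.vertex_cell_last _) T
    rw [Category.id_comp] at this
    exact this
  refine ⟨x, c'', w₀, _, _, g₁, g₂,
    (Thick.map (plusOne f₂.left.1) j.castSucc (Fin.last _)).app _ T, ?_, ?_⟩
  · let w' : CHomAt (Cone σ') d (CObj.map (Cone.ι σ') (vertexLFY m hY i)) (Cone.top σ') :=
      Cone.ιHom rfl rfl w₀ ≫ Cone.gen (𝟙 d.unop) hc'' (Cone.vertex_cell_last _) T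
    have hw (τ : CostructuredArrow yoneda (LFY m Y).obj) (f : σ' ⟶ τ) :
        (((St₀ (LFY m Y)).map f).app (vertexLFY m hY i)).app d w' =
          (Cone.ιHom rfl rfl w₀ ≫ Ch.homMap (labMap (Cone.map f) d) (𝟙 _) (he f c'')
            (Cone.map_top f) (Cone.gen (𝟙 d.unop) hc'' (Cone.vertex_cell_last _) T) :
              CHomAt (Cone τ) d _ _) :=
      (Ch.homMap_mul (labMap (Cone.map f) d) (𝟙 _) (he f _) (he f _) (Cone.map_top f) _ _).trans
        (congrArg (· ≫ _) (Cone.homMap_ιHom f rfl rfl _ _ rfl rfl w₀))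
    have hl {τ : CostructuredArrow yoneda (LFY m Y).obj} (f : σ' ⟶ τ)
        (u : (CostructuredArrow.toOver yoneda (LFY m Y).obj).obj τ ⟶ (bracket m Y).obj P) :
        ((St.leg u).app (vertexLFY m hY i)).app d
            ((((St₀ (LFY m Y)).map f).app (vertexLFY m hY i)).app d w') =
          ((St.leg ((CostructuredArrow.toOver yoneda (LFY m Y).obj).map f ≫ u)).app
            (vertexLFY m hY i)).app d w' :=
      ConcreteCategory.congr_hom (NatTrans.congr_app (congrArg
        (fun h => h.app (vertexLFY m hY i)) (St.leg_comp f u)) d) w'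
    -- The images of `w'` along `f₁` and `f₂` become equal in the colimit, since by `hf` both arrows
    -- restrict to the same arrow on `σ'`.
    have h4 := (hl f₁ u).trans ((congrArg (fun u => ((St.leg u).app (vertexLFY m hY i)).app d w')
      hf).trans (hl f₂ (topArrow P d x)).symm)
    rw [hw, hw, ← e₁] at h4
    refine h4.trans (congrArg (fun w => ((St.leg (topArrow P d x)).app (vertexLFY m hY i)).app d
      (Cone.ιHom (σ := topSimplex P d x) rfl rfl w₀ ≫ w :
        CHomAt (Cone (topSimplex P d x)) d _ _)) g₃)
  · rintro _ ⟨t, ht, rfl⟩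
    exact (hT t ht).imp (congrArg _) (congrArg _)

end Cone

lemma LabChain.ofSimplex_congr {M : ℕ} {Y : Type} {k : SimplexCategoryᵒᵖ} {i j : Fin (M + 1)}
    {p : SimplexCategory} {z z' : BouquetObj M Y p} (h : z = z') {s t : Fin (p.len + 1)}
    (hi : z.κ.toOrderHom s = i) (hj : z.κ.toOrderHom t = j) (hi' : z'.κ.toOrderHom s = i)
    (hj' : z'.κ.toOrderHom t = j) (T : (Thick p s t).obj k) :
    LabChain.ofSimplex z hi hj T = LabChain.ofSimplex z' hi' hj' T := by
  subst h
  rfl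

/-! ### The labelled chains coming from the straightening of `[μ, f]` -/

section

variable {m : ℕ} {Y : ThetaSpace n} (hY : Y.Connected) {i : Fin (m + 1)} {P : MonoPair m Y}
  {σ : CostructuredArrow yoneda (LFY m Y).obj} {d : (Cell n)ᵒᵖ} {k : SimplexCategoryᵒᵖ}

/-- The labelled chain of a point of the ambient space. -/
def ambChain (z : (Ambient m Y i).obj d) :
    LabChain (m + 1) (Y.obj d) (op d.unop.2) i.castSucc (Fin.last (m + 1)) :=
  chainOf (a := bouquetPt (m + 1) Y i.castSucc) (b := bouquetPt (m + 1) Y (Fin.last (m + 1)))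
    (bouquetCol (m + 1) Y d) rfl rfl z

include hY in
lemma ambChain_injective : Function.Injective (ambChain (Y := Y) (i := i) (d := d)) :=
  fun _ _ h => (bouquetCover (m + 1) hY d).chainOf_inj h

lemma pos_incl_vertexLFY (j : Fin (m + 1)) :
    StNec.pos (labMap (LFY.incl m Y) d ≫ bouquetCol (m + 1) Y d) (vertexLFY m hY j) =
      j.castSucc :=
  congrArg (bouquetCol (m + 1) Y d).u (map_incl_vertexLFY hY j)

lemma labMap_ι_desc (a : Lift σ) :
    labMap (Cone.ι σ) d ≫ labMap (Cone.desc a) d ≫ bouquetCol (m + 1) Y d =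
      labMap (LFY.incl m Y) d ≫ bouquetCol (m + 1) Y d :=
  congrArg (fun g => labMap g d ≫ bouquetCol (m + 1) Y d) (Cone.ι_desc a)

lemma Cone.chainOf_ιHom (a : Lift σ) {c c' : CObj (LFY m Y)} {b b' : CObj (Cone σ)}
    (hc : CObj.map (Cone.ι σ) c = b) (hc' : CObj.map (Cone.ι σ) c' = b')
    (w : Ch.Hom (labObj (LFY m Y) d) k c c') {j j' : Fin (m + 1 + 1)}
    (hj : Cone.pos a d b = j) (hj' : Cone.pos a d b' = j') :
    chainOf (labMap (Cone.desc a) d ≫ bouquetCol (m + 1) Y d) hj hj' (Cone.ιHom hc hc' w) =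
      chainOf (labMap (LFY.incl m Y) d ≫ bouquetCol (m + 1) Y d)
        ((Cone.pos_ι a c).symm.trans ((congrArg (Cone.pos a d) hc).trans hj))
        ((Cone.pos_ι a c').symm.trans ((congrArg (Cone.pos a d) hc').trans hj')) w := by
  have e := labMap_ι_desc (d := d) a
  refine (chainOf_homMap (labMap (Cone.ι σ) d) (labMap (Cone.desc a) d ≫ bouquetCol (m + 1) Y d)
    hc hc' hj hj' ((congrArg (Cone.pos a d) hc).trans hj)
    ((congrArg (Cone.pos a d) hc').trans hj') w).trans ?_
  congr 1

lemma Cone.chainOf_gen (a : Lift σ) {b b' : CObj (Cone σ)} (z : d.unop ⟶ σ.left.2)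
    {r s : Fin (σ.left.1.len + 1 + 1)}
    (hr : vertex (Cone.cell σ d z) r = (labObj (Cone σ) d).v b)
    (hs : vertex (Cone.cell σ d z) s = (labObj (Cone σ) d).v b')
    (T : (Thick ⦋σ.left.1.len + 1⦌ r s).obj k) {j j' : Fin (m + 1 + 1)}
    (hj : Cone.pos a d b = j) (hj' : Cone.pos a d b' = j') :
    chainOf (labMap (Cone.desc a) d ≫ bouquetCol (m + 1) Y d) hj hj' (Cone.gen z hr hs T) =
      LabChain.ofSimplex (BouquetObj.ofHom (plusOne a.ν) (Y.map z.op a.y))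
        ((Cone.pos_cell a z hr).trans hj) ((Cone.pos_cell a z hs).trans hj') T :=
  (chainOf_toHom _ _ _ _).trans (LabChain.ofSimplex_congr (Cone.desc_cell a z) _ _ _ _ T)

/-- The labelled chains of the points of the straightening of `[μ, f]`. -/
structure IsBracketChain (P : MonoPair m Y) {k : SimplexCategoryᵒᵖ}
    (D : LabChain (m + 1) (Y.obj d) k i.castSucc (Fin.last (m + 1))) (x : P.X.obj d)
    (t : Fin (m + 1 + 1)) : Prop where
  mem : t ∈ D.S 0
  lt : t < Fin.last (m + 1)
  last : ∀ r ∈ D.S 0, t ≤ r → r = t ∨ r = Fin.last (m + 1)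
  lab : (t, P.f.app d x) ∈ D.L
  range : ∀ x, ∀ r ∈ D.S x, t ≤ r → r ∈ Set.range (plusOne P.μ).toOrderHom

/-- The position `t` is the largest joint below `m + 1`. The label there is unique, and it
determines `x` because `f` is a monomorphism. -/
lemma IsBracketChain.unique {D : LabChain (m + 1) (Y.obj d) k i.castSucc (Fin.last (m + 1))}
    {x x' : P.X.obj d} {t t' : Fin (m + 1 + 1)} (h : IsBracketChain P D x t)
    (h' : IsBracketChain P D x' t') : t = t' ∧ x = x' := by
  have ht : t = t' := by
    rcases le_total t t' with hle | hle
    · exact ((h.last _ h'.mem hle).resolve_right h'.lt.ne).symm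
    · exact (h'.last _ h.mem hle).resolve_right h.lt.ne
  subst ht
  have hf : Mono P.f := P.property.2.1
  exact ⟨rfl, (mono_iff_injective _).1 ((NatTrans.mono_iff_mono_app P.f).1 hf d)
    (D.lab_unique h.lab h'.lab)⟩

lemma bracketLift_topArrow_ν (x : P.X.obj d) : (bracketLift (topArrow P d x)).ν = P.μ :=
  (congrArg (fun z : (_ ⟶ P.obj.1.left) × P.X.obj d => z.1 ≫ P.μ) (bracketEl_topArrow P d x)).trans
    (Category.id_comp _)

lemma bracketLift_topArrow_y (x : P.X.obj d) :
    (bracketLift (topArrow P d x)).y = P.f.app d x :=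
  congrArg (fun z : (P.obj.1.left ⟶ P.obj.1.left) × P.X.obj d => P.f.app d z.2)
    (bracketEl_topArrow P d x)

lemma topEl_pos {x : P.X.obj d} {c : CObj (LFY m Y)} {r : Fin (P.obj.1.left.len + 1 + 1)}
    (hr : vertex (Cone.cell (topSimplex P d x) d (𝟙 d.unop)) r =
      (labObj (Cone (topSimplex P d x)) d).v (CObj.map (Cone.ι (topSimplex P d x)) c)) :
    StNec.pos (labMap (LFY.incl m Y) d ≫ bouquetCol (m + 1) Y d) c =
      (plusOne P.μ).toOrderHom r := by
  refine ((Cone.pos_ι (bracketLift (topArrow P d x)) c).symm.trans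
    (Cone.pos_cell (bracketLift (topArrow P d x)) (𝟙 d.unop) hr).symm).trans ?_
  exact congrArg (fun ν => (plusOne ν).toOrderHom r) (bracketLift_topArrow_ν x)

lemma topEl_last {x : P.X.obj d} {s : Fin (P.obj.1.left.len + 1 + 1)}
    (hs : vertex (Cone.cell (topSimplex P d x) d (𝟙 d.unop)) s =
      (labObj (Cone (topSimplex P d x)) d).v (Cone.top (topSimplex P d x))) :
    s = Fin.last _ :=
  plusOne_eq_last (bracketLift (topArrow P d x)).ν ((Cone.pos_cell (bracketLift (topArrow P d x))
    (𝟙 d.unop) hs).trans (Cone.pos_top (bracketLift (topArrow P d x)) (𝟙 d.unop)))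

lemma ambChain_topEl (x : P.X.obj d) {c : CObj (LFY m Y)}
    (w : Ch.Hom (labObj (LFY m Y) d) (op d.unop.2) (vertexLFY m hY i) c)
    {r : Fin (P.obj.1.left.len + 1 + 1)}
    (hr : vertex (Cone.cell (topSimplex P d x) d (𝟙 d.unop)) r =
      (labObj (Cone (topSimplex P d x)) d).v (CObj.map (Cone.ι (topSimplex P d x)) c))
    (hs : vertex (Cone.cell (topSimplex P d x) d (𝟙 d.unop)) (Fin.last _) =
      (labObj (Cone (topSimplex P d x)) d).v (Cone.top (topSimplex P d x)))
    (T : (Thick ⦋P.obj.1.left.len + 1⦌ r (Fin.last _)).obj (op d.unop.2)) :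
    ambChain ((straighteningDesc hY i P).app d (topEl hY x w hr hs T)) =
      (chainOf (labMap (LFY.incl m Y) d ≫ bouquetCol (m + 1) Y d) (pos_incl_vertexLFY hY i)
        (topEl_pos hr) w).comp (LabChain.ofSimplex
          (BouquetObj.ofHom (M := m + 1) (q := ⦋P.obj.1.left.len + 1⦌) (plusOne P.μ) (P.f.app d x))
          rfl (plusOne_last P.μ) T) := by
  let a := bracketLift (topArrow P d x)
  have h₁ := leg_straighteningDesc hY i (topArrow P d x) (Cone.ιHom rfl rfl w ≫
    Cone.gen (𝟙 d.unop) hr hs T : CHomAt (Cone (topSimplex P d x)) d _ _)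
  refine (congrArg ambChain h₁).trans ?_
  have hi : Cone.pos a d (CObj.map (Cone.ι (topSimplex P d x)) (vertexLFY m hY i)) = i.castSucc :=
    (Cone.pos_ι a _).trans (pos_incl_vertexLFY hY i)
  have hc : Cone.pos a d (CObj.map (Cone.ι (topSimplex P d x)) c) =
    (plusOne P.μ).toOrderHom r := (Cone.pos_ι a _).trans (topEl_pos hr)
  have hl : Cone.pos a d (Cone.top (topSimplex P d x)) = Fin.last (m + 1) :=
    Cone.pos_top a (𝟙 d.unop)
  refine (chainOf_homMap (labMap (Cone.desc a) d) (bouquetCol (m + 1) Y d) _ _ rfl rfl hi hl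
    _).trans ((chainOf_mul _ hi hc hl _ _).trans (congrArg₂ LabChain.comp
      (Cone.chainOf_ιHom a rfl rfl w hi hc) ((Cone.chainOf_gen a (𝟙 d.unop) hr hs T hc hl).trans
        (LabChain.ofSimplex_congr ?_ _ _ _ _ T))))
  refine congrArg₂ BouquetObj.ofHom (congrArg plusOne (bracketLift_topArrow_ν x)) ?_
  exact (ConcreteCategory.congr_hom (Y.map_id _) _).trans (bracketLift_topArrow_y x)

lemma isBracketChain_topEl (x : P.X.obj d) {c : CObj (LFY m Y)}
    (w : Ch.Hom (labObj (LFY m Y) d) (op d.unop.2) (vertexLFY m hY i) c)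
    {r : Fin (P.obj.1.left.len + 1 + 1)}
    (hr : vertex (Cone.cell (topSimplex P d x) d (𝟙 d.unop)) r =
      (labObj (Cone (topSimplex P d x)) d).v (CObj.map (Cone.ι (topSimplex P d x)) c))
    (hs : vertex (Cone.cell (topSimplex P d x) d (𝟙 d.unop)) (Fin.last _) =
      (labObj (Cone (topSimplex P d x)) d).v (Cone.top (topSimplex P d x)))
    (T : (Thick ⦋P.obj.1.left.len + 1⦌ r (Fin.last _)).obj (op d.unop.2))
    (hT : ∀ t ∈ Thick.S T 0, t = r ∨ t = Fin.last _) :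
    IsBracketChain P (ambChain ((straighteningDesc hY i P).app d (topEl hY x w hr hs T))) x
      ((plusOne P.μ).toOrderHom r) := by
  rw [ambChain_topEl]
  have hlt : (plusOne P.μ).toOrderHom r < Fin.last (m + 1) :=
    Fin.lt_last_iff_ne_last.2 (topEl_pos hr ▸ LFY.pos_incl_ne_last c)
  refine ⟨Or.inl (LabChain.right_mem _ 0), hlt, ?_, Or.inr ?_, ?_⟩
  · rintro t (ht | ⟨t, ht, rfl⟩) hle
    · exact Or.inl (le_antisymm (LabChain.le_right _ ht) hle)
    · exact (hT t ht).imp (congrArg _) fun h => (congrArg _ h).trans (plusOne_last P.μ)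
  · exact ⟨⟨r, Thick.left_mem T 0, rfl⟩, hlt, BouquetObj.ends_ne (plusOne P.μ) (s := r)
      (t := Fin.last _) (hlt.trans_eq (plusOne_last P.μ).symm), rfl⟩
  · rintro y t (ht | ⟨t, -, rfl⟩) hle
    -- The first factor ends at the cut, so all it contributes from there on is the cut, the image
    -- of `r`.
    · exact ⟨r, le_antisymm hle (LabChain.le_right _ ht)⟩
    · exact ⟨t, rfl⟩

lemma exists_isBracketChain (v : ((straighteningSide m hY i).obj P).obj d) :
    ∃ x t, IsBracketChain P (ambChain ((straighteningDesc hY i P).app d v)) x t := by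
  obtain ⟨x, c, w, r, s, hr, hs, T, rfl, hT⟩ := exists_topEl hY v
  obtain rfl := topEl_last hs
  exact ⟨x, _, isBracketChain_topEl hY x w hr hs T hT⟩

lemma plusOne_injective {p q : SimplexCategory} {ν : p ⟶ q} (h : Function.Injective ν.toOrderHom) :
    Function.Injective (plusOne ν).toOrderHom := by
  intro i j hij
  induction i using Fin.lastCases with
  | last => exact (plusOne_eq_last ν (hij.symm.trans (plusOne_last ν))).symm
  | cast i =>
    induction j using Fin.lastCases with
    | last => exact plusOne_eq_last ν (hij.trans (plusOne_last ν))
    | cast j =>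
      rw [plusOne_castSucc, plusOne_castSucc] at hij
      rw [h (Fin.castSucc_injective _ hij)]

lemma dLast_injective (p : SimplexCategory) : Function.Injective (dLast p).toOrderHom :=
  fun i j h => Fin.castSucc_injective _ ((dLast_apply p i).symm.trans (h.trans (dLast_apply p j)))

/-- The chain determines `x` and the position of its last joint, hence `r` by injectivity of `μ + 1`
and `c` by its position. Cancelling at this joint separates the chains of `w` and `T`; the cover of
`L F[m, Y]` recovers the former, injectivity of `μ + 1` the latter. -/
lemma straighteningDesc_injective :
    Function.Injective ((straighteningDesc hY i P).app d) := by
  intro v v' h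
  obtain ⟨x, c, w, r, s, hr, hs, T, rfl, hT⟩ := exists_topEl hY v
  obtain ⟨x', c', w', r', s', hr', hs', T', rfl, hT'⟩ := exists_topEl hY v'
  obtain rfl := topEl_last hs
  obtain rfl := topEl_last hs'
  have hB := isBracketChain_topEl hY x w hr hs T hT
  obtain ⟨h₁, rfl⟩ := hB.unique (h ▸ isBracketChain_topEl hY x' w' hr' hs' T' hT')
  obtain rfl := plusOne_injective P.property.1 h₁
  have hC := LFY.cover (M := m + 1) hY (dLast ⦋m⦌) (dLast_injective _) d
  obtain rfl : c = c' := hC.u_inj ((topEl_pos hr).trans (topEl_pos hr').symm)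
  have h₂ := (ambChain_topEl hY x w hr hs T).symm.trans
    ((congrArg ambChain h).trans (ambChain_topEl hY x w' hr' hs' T'))
  obtain ⟨h₃, h₄⟩ := LabChain.comp_inj h₂
  obtain rfl := hC.chainOf_inj h₃
  obtain rfl : T = T' := Thick.ext fun y => (plusOne_injective P.property.1).image_injective
    (congrFun (congrArg LabChain.S h₄) y)
  rfl

/-- Cut the chain at `t`. The lower part stays in `[m]` and is realised in `L F[m, Y]`. The upper
part has no inner joints, lies on `μ + 1` and has label `f x`, so it is a face of the simplex added
over `x`. -/
lemma exists_straightening (D : LabChain (m + 1) (Y.obj d) (op d.unop.2) i.castSucc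
    (Fin.last (m + 1))) {x : P.X.obj d} {t : Fin (m + 1 + 1)} (h : IsBracketChain P D x t) :
    ∃ v, ambChain ((straighteningDesc hY i P).app d v) = D := by
  obtain ⟨r, rfl⟩ := h.range 0 t h.mem le_rfl
  obtain ⟨j, rfl⟩ : ∃ j, Fin.castSucc j = r :=
    ⟨r.castPred fun e => h.lt.ne ((congrArg _ e).trans (plusOne_last P.μ)),
      Fin.castSucc_castPred _ _⟩
  obtain ⟨c, hc⟩ := Cone.exists_ι_of_vertex_cell (bracketLift (topArrow P d x)) (𝟙 d.unop) j
  have hr (r : Fin (m + 1 + 1)) (hr : r ≤ (plusOne P.μ).toOrderHom j.castSucc) :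
      ∃ r', (dLast ⦋m⦌).toOrderHom r' = r :=
    ⟨r.castPred (hr.trans_lt h.lt).ne, (dLast_apply _ _).trans (Fin.castSucc_castPred _ _)⟩
  -- Nothing obstructs the lower part: each label `y` indexes a full copy of `Δ[m]`, which contains
  -- all positions up to `t`.
  have hgood : (LFY.cover (M := m + 1) hY (dLast ⦋m⦌) (dLast_injective _) d).Good
      (D.cutL _ h.mem) := by
    rintro t y ⟨hL, hlt⟩
    obtain ⟨s, rfl⟩ := hr t (le_of_lt hlt)
    obtain ⟨s', hs'⟩ := hr _ le_rfl
    refine ⟨y, rfl, s, s', ?_, rfl, ?_, ?_⟩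
    · exact (dLast ⦋m⦌).toOrderHom.monotone.reflect_lt (hlt.trans_eq hs'.symm)
    · exact ⟨hs' ▸ h.mem, hs'.le⟩
    · exact fun x r hr' _ hle => hr r (hle.trans hs'.le)
  obtain ⟨w, hw⟩ := (LFY.cover (M := m + 1) hY (dLast ⦋m⦌) (dLast_injective _) d).exists_chainOf
    (pos_incl_vertexLFY hY i) (topEl_pos hc) (D.cutL _ h.mem) hgood (by
      rintro t ⟨-, ht⟩
      have ht' : t < Fin.last (m + 1) := lt_of_le_of_lt ht h.lt
      exact ⟨vertexLFY m hY (t.castPred ht'.ne), (pos_incl_vertexLFY hY _).trans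
        (Fin.castSucc_castPred _ _)⟩)
  obtain ⟨T, hT⟩ := (D.cutR _ h.mem).exists_ofSimplex (p := ⦋P.obj.1.left.len + 1⦌)
    (plusOne P.μ) (plusOne_injective P.property.1) (P.f.app d x) (s := j.castSucc)
    (t := Fin.last _) rfl (plusOne_last P.μ) h.lt ⟨h.lab, le_rfl⟩
    (fun r hr => h.last r hr.1 hr.2) (fun y r hr => h.range y r hr.1 hr.2)
  refine ⟨topEl hY x w hc (Cone.vertex_cell_last _) T, ?_⟩
  exact (ambChain_topEl hY x w hc (Cone.vertex_cell_last _) T).trans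
    ((congrArg₂ LabChain.comp hw hT).trans (D.cut _ h.mem))

end

/-! ### Necklaces in a simplex -/

namespace Necklace

variable (T : Necklace)

/-- An edge of the spine of a necklace lies on a bead. -/
lemma exists_bead {v : ℕ} (hv : v < T.total) :
    ∃ j : T.Bead, T.joint j ≤ v ∧ v < T.joint (j + 1) := by
  have h : ∃ j, v < T.joint (j + 1) := ⟨T.t, hv.trans_eq T.joint_last.symm⟩
  classical
  refine ⟨⟨Nat.find h, ?_⟩, ?_, Nat.find_spec h⟩
  · exact Nat.lt_succ_of_le (Nat.find_min' h (hv.trans_eq T.joint_last.symm))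
  · rcases Nat.eq_zero_or_pos (Nat.find h) with h0 | h0
    · change T.joint (Nat.find h) ≤ v
      rw [h0, T.joint_zero]
      exact Nat.zero_le v
    · have := Nat.find_min h (Nat.sub_lt h0 one_pos)
      rw [show Nat.find h - 1 + 1 = Nat.find h from Nat.sub_add_cancel h0] at this
      exact not_lt.1 this

lemma exists_on_vertex (v : Fin (T.total + 1)) :
    ∃ j : T.Bead, T.joint j ≤ v ∧ v ≤ T.joint (j + 1) := by
  rcases lt_or_eq_of_le (Nat.lt_succ_iff.1 v.2) with h | h
  · obtain ⟨j, h1, h2⟩ := T.exists_bead h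
    exact ⟨j, h1, h2.le⟩
  · exact ⟨T.lastBead, (T.joint_le_total _).trans_eq h.symm, (h.trans T.joint_last.symm).le⟩

/-- The vertex of a necklace with a given position. -/
def vtx (v : Fin (T.total + 1)) : T.toSSet.obj (op ⦋0⦌) :=
  ⟨⟨fun _ => v, fun _ _ _ => le_rfl⟩, (T.exists_on_vertex v).imp fun _ h _ => h⟩

lemma exists_vtx (s : T.toSSet.obj (op ⦋0⦌)) : ∃ v, T.vtx v = s :=
  ⟨s.1 0, Subtype.ext (OrderHom.ext _ _ (funext fun x =>
    congrArg s.1 (Subsingleton.elim (α := Fin 1) 0 x)))⟩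

end Necklace

namespace TndNec

variable {m : ℕ} {i : Fin (m + 1)} {U T : TndNecTo m i}

/-- The simplex of `Δ[m + 1]` under a simplex of a necklace. -/
def hom (T : TndNecTo m i) {q : SimplexCategory} (s : T.T.toSSet.obj (op q)) : q ⟶ ⦋m + 1⦌ :=
  SSet.stdSimplex.objEquiv (T.p.app (op q) s)

lemma hom_map {q r : SimplexCategory} (α : r ⟶ q) (s : T.T.toSSet.obj (op q)) :
    T.hom (T.T.toSSet.map α.op s) = α ≫ T.hom s :=
  congrArg SSet.stdSimplex.objEquiv (T.p.naturality_apply α.op s)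

/-- The position in `[m + 1]` of a vertex of a necklace. -/
def vpos (T : TndNecTo m i) (v : Fin (T.T.total + 1)) : Fin (m + 1 + 1) :=
  (T.hom (T.T.vtx v)).toOrderHom 0

lemma hom_apply {q : SimplexCategory} (s : T.T.toSSet.obj (op q)) (x : Fin (q.len + 1)) :
    (T.hom s).toOrderHom x = T.vpos (s.1 x) :=
  (congrArg (fun f : ⦋0⦌ ⟶ ⦋m + 1⦌ => f.toOrderHom 0)
    (hom_map (SimplexCategory.const ⦋0⦌ q x) s)).symm

lemma hom_bead_strictMono (j : T.T.Bead) : StrictMono (T.hom (T.T.bead j)).toOrderHom :=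
  (SSet.stdSimplex.mem_nonDegenerate_iff_strictMono _).1 (T.tnd j)

/-- An edge of the spine lies on a bead, and a non-degenerate simplex of `Δ[m + 1]` is strictly
increasing. -/
lemma vpos_lt_succ (v : Fin T.T.total) : T.vpos v.castSucc < T.vpos v.succ := by
  obtain ⟨j, h1, h2⟩ := T.T.exists_bead v.2
  have h3 := T.T.joint_succ j
  have h := hom_bead_strictMono j (a := ⟨v - T.T.joint j, by change _ < T.T.dims j + 1; omega⟩)
    (b := ⟨v + 1 - T.T.joint j, by change _ < T.T.dims j + 1; omega⟩)
    (Fin.mk_lt_mk.2 (by omega))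
  rw [hom_apply, hom_apply] at h
  have e1 : (T.T.bead j).1 ⟨v - T.T.joint j, by change _ < T.T.dims j + 1; omega⟩ = v.castSucc :=
    Fin.ext (Nat.add_sub_cancel' h1)
  have e2 : (T.T.bead j).1 ⟨v + 1 - T.T.joint j, by change _ < T.T.dims j + 1; omega⟩ = v.succ :=
    Fin.ext (Nat.add_sub_cancel' (by omega))
  rwa [e1, e2] at h

lemma vpos_strictMono (T : TndNecTo m i) : StrictMono T.vpos :=
  Fin.strictMono_iff_lt_succ.2 vpos_lt_succ

lemma vpos_zero (T : TndNecTo m i) : T.vpos 0 = i.castSucc :=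
  congrArg (fun s => (SSet.stdSimplex.objEquiv s).toOrderHom 0) T.p_α

lemma vpos_last (T : TndNecTo m i) : T.vpos (Fin.last _) = Fin.last (m + 1) :=
  congrArg (fun s => (SSet.stdSimplex.objEquiv s).toOrderHom 0) T.p_ω

/-! ### The map to a bouquet given by labels on the beads -/

variable {Y : ThetaSpace n} {d e : (Cell n)ᵒᵖ}

/-- A simplex of a necklace as a simplex of the bouquet, given labels on the beads. -/
def simplexOf (T : TndNecTo m i) {Y : Type} (y : T.T.Bead → Y) {q : SimplexCategory}
    (s : T.T.toSSet.obj (op q)) : BouquetObj (m + 1) Y q where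
  κ := T.hom s
  lab _ := y s.2.choose

lemma on_unique {q : SimplexCategory} (s : T.T.toSSet.obj (op q)) {j j' : T.T.Bead}
    (hj : T.T.On s.1 j) (hj' : T.T.On s.1 j')
    (h : (T.hom s).toOrderHom 0 ≠ (T.hom s).toOrderHom (Fin.last q.len)) : j = j' := by
  by_contra hne
  exact h ((hom_apply s _).trans ((congrArg T.vpos (T.T.eq_of_on hj hj' hne _ _)).trans
    (hom_apply s _).symm))

lemma simplexOf_eq (T : TndNecTo m i) {Y : Type} (y : T.T.Bead → Y) {q : SimplexCategory}
    (s : T.T.toSSet.obj (op q)) {j : T.T.Bead} (hj : T.T.On s.1 j) :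
    T.simplexOf y s = BouquetObj.ofHom (T.hom s) (y j) :=
  BouquetObj.ext rfl fun h _ => congrArg y (on_unique s s.2.choose_spec hj h)

lemma simplexOf_map (T : TndNecTo m i) {Y : Type} (y : T.T.Bead → Y) {q r : SimplexCategory}
    (α : r ⟶ q) (s : T.T.toSSet.obj (op q)) :
    T.simplexOf y (T.T.toSSet.map α.op s) = (T.simplexOf y s).res α := by
  obtain ⟨j, hj⟩ := s.2
  rw [T.simplexOf_eq y s hj, T.simplexOf_eq y (T.T.toSSet.map α.op s) (j := j) fun x => hj _,
    hom_map]
  rfl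

/-- The map from a necklace to the bouquets given by labels on the beads. -/
def toBouquet (T : TndNecTo m i) (y : T.T.Bead → Y.obj d) :
    T.T.labelled ⟶ labObj (bouquetPcat (m + 1) Y) d where
  f :=
    { app := fun q => ↾T.simplexOf (q := q.unop) y
      naturality := fun q r α => ConcreteCategory.hom_ext _ _ fun s =>
        show T.simplexOf y (T.T.toSSet.map α s) =
          ((T.simplexOf y s).res α.unop).map (Y.map (𝟙 d)) by
          refine (T.simplexOf_map y α.unop s).trans ?_
          exact BouquetObj.ext rfl fun _ _ => (ConcreteCategory.congr_hom (Y.map_id _) _).symm }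
  u s := bouquetPt (m + 1) Y ((T.hom s).toOrderHom 0)
  hu _ := BouquetObj.ext_zero (M := m + 1) (Y := Y.obj d) rfl

lemma toBouquet_α (y : T.T.Bead → Y.obj d) :
    (T.toBouquet y).u T.T.α = bouquetPt (m + 1) Y i.castSucc :=
  congrArg (bouquetPt (m + 1) Y) T.vpos_zero

lemma toBouquet_ω (y : T.T.Bead → Y.obj d) :
    (T.toBouquet y).u T.T.ω = bouquetPt (m + 1) Y (Fin.last (m + 1)) :=
  congrArg (bouquetPt (m + 1) Y) T.vpos_last

lemma hom_g (g : U ⟶ T) {q : SimplexCategory} (s : U.T.toSSet.obj (op q)) :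
    T.hom (g.g.app (op q) s) = U.hom s :=
  congrArg SSet.stdSimplex.objEquiv (g_p_apply g s)

/-- A map of necklaces sends simplices on a bead `j` to simplices on `B g j`, so labels pull back
along the bead functor. -/
lemma labMap_toBouquet (g : U ⟶ T) (y : T.T.Bead → Y.obj d) :
    labMap g ≫ T.toBouquet y = U.toBouquet fun b => y (B g b) := by
  refine Labelled.Hom.ext ?_ (funext fun s =>
    congrArg (fun f : ⦋0⦌ ⟶ ⦋m + 1⦌ => bouquetPt (m + 1) Y (f.toOrderHom 0)) (hom_g g s))
  refine NatTrans.ext (funext fun q => ConcreteCategory.hom_ext _ _ fun s => ?_)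
  obtain ⟨j, hj⟩ := s.2
  refine (T.simplexOf_eq y (q := q.unop) (g.g.app q s) (on_B_of_on g j s hj)).trans
    (Eq.trans ?_ (U.simplexOf_eq (q := q.unop) (fun b => y (B g b)) s hj).symm)
  exact congrArg (BouquetObj.ofHom · _) (hom_g g s)

lemma toBouquet_lab_map (φ : d ⟶ e) (y : T.T.Bead → Y.obj d) :
    T.toBouquet y ≫ (lab (bouquetPcat (m + 1) Y)).map φ = T.toBouquet fun b => Y.map φ (y b) :=
  Labelled.Hom.ext (NatTrans.ext (funext fun q => ConcreteCategory.hom_ext _ _ fun s =>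
    show ((T.simplexOf (q := q.unop) y s).res (𝟙 _)).map (Y.map φ) =
        T.simplexOf (q := q.unop) (fun b => Y.map φ (y b)) s by
      refine BouquetObj.ext (Category.id_comp _) fun _ _ => rfl)) rfl

/-- The cover of a necklace by its beads. -/
def cover (T : TndNecTo m i) (y : T.T.Bead → Y.obj d) :
    Cover T.T.labelled (T.toBouquet y ≫ bouquetCol (m + 1) Y d) where
  Λ := T.T.Bead
  y := y
  p j := ⦋T.T.dims j⦌
  e j := T.T.bead j
  κ j := T.hom (T.T.bead j)
  κ_inj j := (hom_bead_strictMono j).injective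
  g_e j := T.simplexOf_eq y (T.T.bead j) (T.T.on_beadHom j)
  cov s := by
    obtain ⟨j, hj⟩ := s.2
    exact ⟨j, T.T.exists_map_bead s j hj⟩
  -- Distinct beads occupy intervals of vertices with at most one point in common, so two common
  -- vertices force equality whatever the labels are.
  sep {l l' i₁ j₁ i₂ j₂} _ hij hi hj := by
    rw [hom_apply, hom_apply] at hi hj
    have hi' := congrArg Fin.val (T.vpos_strictMono.injective hi)
    have hj' := congrArg Fin.val (T.vpos_strictMono.injective hj)
    change T.T.joint l + (i₁ : ℕ) = T.T.joint l' + (i₂ : ℕ) at hi'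
    change T.T.joint l + (j₁ : ℕ) = T.T.joint l' + (j₂ : ℕ) at hj'
    have h1 := T.T.joint_succ l
    have h2 := T.T.joint_succ l'
    have h3 : (i₁ : ℕ) < j₁ := hij
    have h4 : (j₁ : ℕ) < T.T.dims l + 1 := j₁.2
    have h5 : (j₂ : ℕ) < T.T.dims l' + 1 := j₂.2
    rcases lt_trichotomy l l' with h | h | h
    · have := T.T.joint_mono (show (l : ℕ) + 1 ≤ l' from h)
      omega
    · exact h
    · have := T.T.joint_mono (show (l' : ℕ) + 1 ≤ l from h)
      omega
  u_inj a b h := by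
    obtain ⟨v, rfl⟩ := T.T.exists_vtx a
    obtain ⟨v', rfl⟩ := T.T.exists_vtx b
    exact congrArg _ (T.vpos_strictMono.injective h)
  v_bij := Function.bijective_id

end TndNec

/-! ### Joints, maps and spines of necklaces in a simplex -/

namespace TndNec

variable {m : ℕ} {i : Fin (m + 1)} {U T : TndNecTo m i}

/-- The positions in `[m + 1]` of the joints of a necklace. -/
def jpos (T : TndNecTo m i) (j : ℕ) : Fin (m + 1 + 1) :=
  T.vpos ⟨T.T.joint j, Nat.lt_succ_of_le (T.T.joint_le_total j)⟩

lemma jpos_mono (T : TndNecTo m i) : Monotone T.jpos :=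
  fun _ _ h => T.vpos_strictMono.monotone (T.T.joint_mono h)

lemma jpos_lt (T : TndNecTo m i) (j : T.T.Bead) : T.jpos j < T.jpos (j + 1) := by
  have h := T.T.joint_succ j
  have h' := T.dims_pos j
  exact T.vpos_strictMono (Fin.mk_lt_mk.2 (by omega))

lemma jpos_last (T : TndNecTo m i) : T.jpos (T.T.t + 1) = Fin.last (m + 1) :=
  (congrArg T.vpos (Fin.ext T.T.joint_last)).trans T.vpos_last

lemma jpos_lt_last (T : TndNecTo m i) (j : T.T.Bead) : T.jpos j < Fin.last (m + 1) :=
  (T.jpos_lt j).trans_le (Fin.le_last _)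

lemma hom_bead_zero (T : TndNecTo m i) (j : T.T.Bead) :
    (T.hom (T.T.bead j)).toOrderHom 0 = T.jpos j :=
  hom_apply _ _

lemma hom_bead_last (T : TndNecTo m i) (j : T.T.Bead) :
    (T.hom (T.T.bead j)).toOrderHom (Fin.last (T.T.dims j)) = T.jpos (j + 1) :=
  (hom_apply _ _).trans (congrArg T.vpos (Fin.ext (T.T.joint_succ j).symm))

lemma vpos_mem_range {j : T.T.Bead} {v : Fin (T.T.total + 1)} (h : T.jpos j ≤ T.vpos v)
    (h' : T.vpos v ≤ T.jpos (j + 1)) : T.vpos v ∈ Set.range (T.hom (T.T.bead j)).toOrderHom := by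
  have h1 : T.T.joint j ≤ v := T.vpos_strictMono.le_iff_le.1 h
  have h2 : v ≤ T.T.joint (j + 1) := T.vpos_strictMono.le_iff_le.1 h'
  have h3 := T.T.joint_succ j
  refine ⟨⟨v - T.T.joint j, by change _ < T.T.dims j + 1; omega⟩, (hom_apply _ _).trans ?_⟩
  exact congrArg T.vpos (Fin.ext (Nat.add_sub_cancel' h1))

lemma jpos_le_of_lt {j : T.T.Bead} {j' : ℕ} (h : T.jpos j < T.jpos j') :
    T.jpos (j + 1) ≤ T.jpos j' :=
  T.jpos_mono (Nat.succ_le_of_lt (T.jpos_mono.reflect_lt h))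

lemma on_of_range_subset {q : SimplexCategory} {s : T.T.toSSet.obj (op q)} {l : T.T.Bead}
    (h : Set.range (T.hom s).toOrderHom ⊆ Set.range (T.hom (T.T.bead l)).toOrderHom) :
    T.T.On s.1 l := by
  intro x
  obtain ⟨y, hy⟩ := h ⟨x, rfl⟩
  rw [hom_apply, hom_apply] at hy
  rw [← T.vpos_strictMono.injective hy]
  exact T.T.on_beadHom l y

/-- A map over `Δ[m + 1]` preserves positions, and these are injective on each necklace; so the
image of a bead is located by its positions alone. -/
lemma B_eq (g : U ⟶ T) {j : U.T.Bead} {l : T.T.Bead}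
    (h : Set.range (U.hom (U.T.bead j)).toOrderHom ⊆
      Set.range (T.hom (T.T.bead l)).toOrderHom) : B g j = l :=
  bead_unique g j (on_B g j) (on_of_range_subset (by rwa [hom_g]))

/-- There is a map of necklaces if each bead of the first one is a face of a bead of the second
one. -/
lemma nonempty_hom (h : ∀ j : U.T.Bead, ∃ l : T.T.Bead,
    Set.range (U.hom (U.T.bead j)).toOrderHom ⊆ Set.range (T.hom (T.T.bead l)).toOrderHom) :
    Nonempty (U ⟶ T) := by
  -- The map has no freedom: a vertex must go to the vertex with the same position.
  have hφ (v : Fin (U.T.total + 1)) : ∃ v', T.vpos v' = U.vpos v := by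
    obtain ⟨j, hj⟩ := U.T.exists_on_vertex v
    obtain ⟨l, hl⟩ := h j
    obtain ⟨x, hx⟩ := hl (vpos_mem_range (j := j) (U.vpos_strictMono.monotone hj.1)
      (U.vpos_strictMono.monotone hj.2))
    exact ⟨_, (hom_apply _ x).symm.trans hx⟩
  choose φ hφ using hφ
  let Φ : Fin (U.T.total + 1) →o Fin (T.T.total + 1) := ⟨φ, fun v w hvw =>
    T.vpos_strictMono.le_iff_le.1 (by rw [hφ, hφ]; exact U.vpos_strictMono.monotone hvw)⟩
  have hon {q : ℕ} (s : Fin (q + 1) →o Fin (U.T.total + 1)) (hs : ∃ j, U.T.On s j) :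
      ∃ l, T.T.On (Φ.comp s) l := by
    obtain ⟨j, hj⟩ := hs
    obtain ⟨l, hl⟩ := h j
    refine ⟨l, fun x => ?_⟩
    obtain ⟨y, hy⟩ := hl (vpos_mem_range (j := j) (v := s x) (U.vpos_strictMono.monotone (hj x).1)
      (U.vpos_strictMono.monotone (hj x).2))
    rw [hom_apply, ← hφ] at hy
    have e : (T.T.bead l).1 y = φ (s x) := T.vpos_strictMono.injective hy
    have h1 := T.T.on_beadHom l y
    change T.T.joint l ≤ φ (s x) ∧ (φ (s x) : ℕ) ≤ T.T.joint (l + 1)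
    rw [← e]
    exact h1
  refine ⟨⟨⟨fun _ => ↾fun s => ⟨Φ.comp s.1, hon s.1 s.2⟩, fun _ _ _ => rfl⟩, ?_, ?_, ?_⟩⟩
  · refine NatTrans.ext (funext fun k => ConcreteCategory.hom_ext _ _ fun s => ?_)
    refine SSet.stdSimplex.objEquiv.injective (hom_ext_fin fun x => ?_)
    exact (hom_apply (T := T) (q := k.unop) _ x).trans ((hφ _).trans
      (hom_apply (T := U) (q := k.unop) s x).symm)
  · refine congrArg T.T.vtx (T.vpos_strictMono.injective ((hφ 0).trans ?_))
    exact U.vpos_zero.trans T.vpos_zero.symm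
  · refine congrArg T.T.vtx (T.vpos_strictMono.injective ((hφ (Fin.last _)).trans ?_))
    exact U.vpos_last.trans T.vpos_last.symm

/-- A necklace with given positions of its vertices. -/
def ofVertices (T : Necklace) (π : Fin (T.total + 1) → Fin (m + 1 + 1)) (hπ : StrictMono π)
    (h0 : π 0 = i.castSucc) (hl : π (Fin.last _) = Fin.last (m + 1)) : TndNecTo m i where
  T := T
  p :=
    { app := fun _ => ↾fun s => SSet.stdSimplex.objEquiv.symm
        (SimplexCategory.Hom.mk ((⟨π, hπ.monotone⟩ : _ →o _).comp s.1))
      naturality := fun _ _ _ => rfl }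
  p_α := SSet.stdSimplex.objEquiv.injective (hom_ext_fin fun _ => h0)
  p_ω := SSet.stdSimplex.objEquiv.injective (hom_ext_fin fun _ => hl)
  tnd _ := (SSet.stdSimplex.mem_nonDegenerate_iff_strictMono _).2 fun _ _ h =>
    hπ (Nat.add_lt_add_left h _)

/-- The positions of the vertices and of the joints of a necklace. -/
structure IsSpine (U : TndNecTo m i) (P Q : Set (Fin (m + 1 + 1))) : Prop where
  vertices : Set.range U.vpos = Q
  joints : U.jpos '' Set.Iic (U.T.t + 1) = P

end TndNec

/-- The necklace with prescribed positions of its joints. -/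
lemma Necklace.exists_joint {t : ℕ} (J : ℕ → ℕ) (hJ : StrictMonoOn J (Set.Iic (t + 1)))
    (h0 : J 0 = 0) : ∃ T : Necklace, T.t = t ∧ ∀ j ≤ t + 1, T.joint j = J j := by
  let T : Necklace := ⟨t, fun j => J (j + 1) - J j, fun _ j => Nat.sub_pos_of_lt
    (hJ (Set.mem_Iic.2 (by omega)) (Set.mem_Iic.2 (by omega)) (by omega))⟩
  refine ⟨T, rfl, fun j => ?_⟩
  induction j with
  | zero => exact fun _ => T.joint_zero.trans h0.symm
  | succ j ih =>
    intro hj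
    refine (T.joint_succ ⟨j, hj⟩).trans ?_
    change T.joint j + (J (j + 1) - J j) = _
    rw [ih (by omega)]
    have := hJ (a := j) (b := j + 1) (Set.mem_Iic.2 (by omega)) (Set.mem_Iic.2 hj) (by omega)
    omega

/-- The increasing enumeration of `Q` gives the positions of the vertices, and the indices in it of
the elements of `P` give the joints. Since `i` and `m + 1` belong to both sets and bound them, the
ends are right. -/
lemma TndNec.exists_isSpine {m : ℕ} {i : Fin (m + 1)} {P Q : Set (Fin (m + 1 + 1))} (hPQ : P ⊆ Q)
    (hi : i.castSucc ∈ P) (hl : Fin.last (m + 1) ∈ P) (hQ : ∀ r ∈ Q, i.castSucc ≤ r) :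
    ∃ U : TndNecTo m i, U.IsSpine P Q := by
  classical
  have hil := Fin.castSucc_lt_last i
  -- The set `P` has the two distinct elements `i` and `m + 1`; its `t + 2` elements delimit `t + 1`
  -- beads.
  have hcP : (P.toFinset.card - 2 + 1) + 1 = P.toFinset.card := by
    have : 1 < P.toFinset.card := Finset.one_lt_card.2
      ⟨_, Set.mem_toFinset.2 hi, _, Set.mem_toFinset.2 hl, hil.ne⟩
    omega
  have hcQ : (Q.toFinset.card - 1) + 1 = Q.toFinset.card :=
    Nat.sub_add_cancel (Finset.card_pos.2 ⟨_, Set.mem_toFinset.2 (hPQ hi)⟩)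
  generalize P.toFinset.card - 2 = t at hcP
  generalize Q.toFinset.card - 1 = N at hcQ
  let c := P.toFinset.orderEmbOfFin hcP.symm
  let e := Q.toFinset.orderEmbOfFin hcQ.symm
  have hce : Set.range c = P := by simp [c]
  have hee : Set.range e = Q := by simp [e]
  have hJ (j : Fin (t + 1 + 1)) : ∃ v, e v = c j := by
    have : c j ∈ Set.range e := hee ▸ hPQ (hce ▸ ⟨j, rfl⟩)
    exact this
  choose J hJ using hJ
  have hJm : StrictMono J := fun a b h => e.lt_iff_lt.1 (by rw [hJ, hJ]; exact c.lt_iff_lt.2 h)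
  have he0 : e 0 = i.castSucc := by
    obtain ⟨v, hv⟩ : i.castSucc ∈ Set.range e := hee ▸ hPQ hi
    exact le_antisymm (hv ▸ e.monotone (Fin.zero_le v)) (hQ _ (hee ▸ ⟨0, rfl⟩))
  have hel : e (Fin.last N) = Fin.last (m + 1) := by
    obtain ⟨v, hv⟩ : Fin.last (m + 1) ∈ Set.range e := hee ▸ hPQ hl
    exact le_antisymm (Fin.le_last _) (hv ▸ e.monotone (Fin.le_last v))
  have hJ0 : J 0 = 0 := by
    refine e.injective ((hJ 0).trans (he0.symm ▸ ?_))
    obtain ⟨v, hv⟩ : i.castSucc ∈ Set.range c := hce ▸ hi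
    exact le_antisymm (hv ▸ c.monotone (Fin.zero_le v)) (hQ _ (hPQ (hce ▸ ⟨0, rfl⟩)))
  have hJl : J (Fin.last _) = Fin.last N := by
    refine e.injective ((hJ _).trans (hel.symm ▸ ?_))
    obtain ⟨v, hv⟩ : Fin.last (m + 1) ∈ Set.range c := hce ▸ hl
    exact le_antisymm (Fin.le_last _) (hv ▸ c.monotone (Fin.le_last v))
  obtain ⟨T, rfl, hT⟩ := Necklace.exists_joint (t := t)
    (fun j => if h : j < t + 1 + 1 then (J ⟨j, h⟩ : ℕ) else 0) (fun a ha b hb h => by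
      have ha' : a < t + 1 + 1 := Nat.lt_succ_of_le ha
      have hb' : b < t + 1 + 1 := Nat.lt_succ_of_le hb
      simp only [ha', hb', dif_pos]
      exact hJm (Fin.mk_lt_mk.2 h)) (by simpa using congrArg Fin.val hJ0)
  have hN : T.total = N := by
    rw [← T.joint_last, hT _ le_rfl, dif_pos (Nat.lt_succ_self _)]
    exact congrArg Fin.val hJl
  subst hN
  refine ⟨TndNec.ofVertices T e e.strictMono he0 hel, hee, ?_⟩
  rw [← hce]
  have hj (j : ℕ) (hj : j < T.t + 1 + 1) :
      (TndNec.ofVertices T e e.strictMono he0 hel).jpos j = c ⟨j, hj⟩ := by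
    refine Eq.trans (congrArg e (Fin.ext ?_)) (hJ _)
    exact (hT j (Nat.lt_succ_iff.1 hj)).trans (dif_pos hj)
  ext r
  constructor
  · rintro ⟨j, hj', rfl⟩
    exact ⟨_, (hj j (Nat.lt_succ_of_le hj')).symm⟩
  · rintro ⟨j, rfl⟩
    exact ⟨j, Nat.lt_succ_iff.1 j.2, hj j j.2⟩

/-! ### The minimal necklace of a labelled chain -/

namespace TndNec

variable {m : ℕ} {i : Fin (m + 1)} {U T : TndNecTo m i} {Y : ThetaSpace n} {d : (Cell n)ᵒᵖ}
  {k : SimplexCategoryᵒᵖ}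

/-- The labelled chain of a morphism of a necklace with labels on its beads. -/
def chain (T : TndNecTo m i) (y : T.T.Bead → Y.obj d)
    (w : Ch.Hom T.T.labelled k T.T.α T.T.ω) :
    LabChain (m + 1) (Y.obj d) k i.castSucc (Fin.last (m + 1)) :=
  chainOf (T.toBouquet y ≫ bouquetCol (m + 1) Y d) T.vpos_zero T.vpos_last w

lemma chain_injective (T : TndNecTo m i) (y : T.T.Bead → Y.obj d) :
    Function.Injective (T.chain (k := k) y) :=
  fun _ _ h => (T.cover y).chainOf_inj h

/-- Moving a morphism forward along `g` has the same effect on chains as pulling the labels back. -/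
lemma chain_homMap (g : U ⟶ T) (y : T.T.Bead → Y.obj d)
    (w : Ch.Hom U.T.labelled k U.T.α U.T.ω) :
    T.chain y (Ch.homMap (labMap g) (𝟙 k) g.g_α g.g_ω w) = U.chain (fun b => y (B g b)) w := by
  have hα : (labMap g ≫ T.toBouquet y ≫ bouquetCol (m + 1) Y d).u U.T.α = i.castSucc :=
    (congrArg (T.toBouquet y ≫ bouquetCol (m + 1) Y d).u g.g_α).trans T.vpos_zero
  have hω : (labMap g ≫ T.toBouquet y ≫ bouquetCol (m + 1) Y d).u U.T.ω = Fin.last (m + 1) :=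
    (congrArg (T.toBouquet y ≫ bouquetCol (m + 1) Y d).u g.g_ω).trans T.vpos_last
  refine (chainOf_homMap (labMap g) (T.toBouquet y ≫ bouquetCol (m + 1) Y d) g.g_α g.g_ω
    T.vpos_zero T.vpos_last hα hω w).trans ?_
  have e : labMap g ≫ T.toBouquet y ≫ bouquetCol (m + 1) Y d =
      U.toBouquet (fun b => y (B g b)) ≫ bouquetCol (m + 1) Y d :=
    congrArg (· ≫ bouquetCol (m + 1) Y d) (labMap_toBouquet g y)
  unfold chain
  congr 1

variable {D : LabChain (m + 1) (Y.obj d) k i.castSucc (Fin.last (m + 1))}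

/-- A necklace with labels on its beads whose joints are the joints of a labelled chain, with the
same labels, and whose vertices are those of the largest set of the chain. -/
structure IsMinimal (U : TndNecTo m i) (y : U.T.Bead → Y.obj d)
    (D : LabChain (m + 1) (Y.obj d) k i.castSucc (Fin.last (m + 1))) : Prop
    extends U.IsSpine (D.S 0) (D.S (Fin.last _)) where
  lab : ∀ j : U.T.Bead, (U.jpos j, y j) ∈ D.L

lemma exists_isSpine_of_chain (D : LabChain (m + 1) (Y.obj d) k i.castSucc (Fin.last (m + 1))) :
    ∃ U : TndNecTo m i, U.IsSpine (D.S 0) (D.S (Fin.last _)) :=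
  exists_isSpine (D.mono (Fin.zero_le _)) (D.left_mem 0) (D.right_mem 0) fun _ h => D.left_le h

namespace IsSpine

variable {P Q : Set (Fin (m + 1 + 1))}

lemma jpos_mem (h : U.IsSpine P Q) {j : ℕ} (hj : j ≤ U.T.t + 1) : U.jpos j ∈ P :=
  h.joints ▸ ⟨j, hj, rfl⟩

lemma exists_jpos (h : U.IsSpine P Q) {r : Fin (m + 1 + 1)} (hr : r ∈ P) :
    ∃ j ≤ U.T.t + 1, U.jpos j = r := by
  rw [← h.joints] at hr
  exact hr

lemma exists_bead_of_lt (h : U.IsSpine P Q) {r : Fin (m + 1 + 1)} (hr : r ∈ P)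
    (hlt : r < Fin.last (m + 1)) : ∃ j : U.T.Bead, U.jpos j = r := by
  obtain ⟨j, hj, rfl⟩ := h.exists_jpos hr
  refine ⟨⟨j, lt_of_le_of_ne hj fun e => hlt.ne ?_⟩, rfl⟩
  exact (congrArg U.jpos e).trans U.jpos_last

lemma le_of_lt (h : U.IsSpine P Q) {r : Fin (m + 1 + 1)} (hr : r ∈ P) {j : U.T.Bead}
    (hlt : U.jpos j < r) : U.jpos (j + 1) ≤ r := by
  obtain ⟨j', -, rfl⟩ := h.exists_jpos hr
  exact jpos_le_of_lt hlt

lemma mem_range (h : U.IsSpine P Q) {r : Fin (m + 1 + 1)} (hr : r ∈ Q) {j : U.T.Bead}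
    (h1 : U.jpos j ≤ r) (h2 : r ≤ U.jpos (j + 1)) :
    r ∈ Set.range (U.hom (U.T.bead j)).toOrderHom := by
  rw [← h.vertices] at hr
  obtain ⟨v, rfl⟩ := hr
  exact vpos_mem_range h1 h2

lemma of_mem_range (h : U.IsSpine P Q) {r : Fin (m + 1 + 1)} {j : U.T.Bead}
    (hr : r ∈ Set.range (U.hom (U.T.bead j)).toOrderHom) :
    r ∈ Q ∧ U.jpos j ≤ r ∧ r ≤ U.jpos (j + 1) := by
  obtain ⟨x, rfl⟩ := hr
  refine ⟨h.vertices ▸ ⟨_, (hom_apply _ x).symm⟩, ?_, ?_⟩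
  · rw [← U.hom_bead_zero]
    exact (U.hom (U.T.bead j)).toOrderHom.monotone (Fin.zero_le x)
  · rw [← U.hom_bead_last]
    exact (U.hom (U.T.bead j)).toOrderHom.monotone (Fin.le_last (n := U.T.dims j) x)

/-- The necklace of a chain on another necklace maps to that necklace. -/
lemma exists_hom {y : T.T.Bead → Y.obj d} {w : Ch.Hom T.T.labelled k T.T.α T.T.ω}
    (h : U.IsSpine ((T.chain y w).S 0) ((T.chain y w).S (Fin.last _))) :
    ∃ g : U ⟶ T, U.IsMinimal (fun b => y (B g b)) (T.chain y w) := by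
  -- By `good_chainOf`, the chain runs on one bead `l` of `T` from this joint to some later joint.
  -- The bead `j` of `U` ends at the next joint, hence no later, so all its vertices are on `l`.
  have key (j : U.T.Bead) : ∃ l : T.T.Bead, (U.jpos j, y l) ∈ (T.chain y w).L ∧
      Set.range (U.hom (U.T.bead j)).toOrderHom ⊆ Set.range (T.hom (T.T.bead l)).toOrderHom := by
    obtain ⟨z, hz⟩ := (T.chain y w).lab_ex (h.jpos_mem j.2.le) (U.jpos_lt_last j)
    obtain ⟨l, rfl, s, s', hs, h1, h2, h3⟩ := (T.cover y).good_chainOf w _ z hz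
    refine ⟨l, hz, fun r hr => ?_⟩
    obtain ⟨h4, h5, h6⟩ := h.of_mem_range hr
    refine h3 _ r h4 h5 (h6.trans (h.le_of_lt h2 ?_))
    rw [← h1]
    exact (T.cover y).κ_mono l hs
  obtain ⟨g⟩ := nonempty_hom fun j => (key j).imp fun _ h => h.2
  refine ⟨g, h, fun j => ?_⟩
  obtain ⟨l, h1, h2⟩ := key j
  rwa [B_eq g h2]

end IsSpine

namespace IsMinimal

/-- A labelled joint starts a bead of `U` with the same label, which ends at the next joint.
Elements of the chain in between belong to its largest set, so they are vertices of that bead. -/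
lemma good {y : U.T.Bead → Y.obj d} (h : U.IsMinimal y D) : (U.cover y).Good D := by
  intro t z hz
  obtain ⟨j, rfl⟩ := h.exists_bead_of_lt (D.lab_mem hz) (D.lab_lt hz)
  refine ⟨j, D.lab_unique (h.lab j) hz, (0 : Fin (U.T.dims j + 1)), Fin.last (U.T.dims j),
    (hom_bead_strictMono j).lt_iff_lt.1 ?_, U.hom_bead_zero j, ?_, fun x r hr h1 h2 => ?_⟩
  · rw [hom_bead_zero, hom_bead_last]
    exact U.jpos_lt j
  · change (U.hom (U.T.bead j)).toOrderHom (Fin.last (U.T.dims j)) ∈ D.S 0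
    rw [hom_bead_last]
    exact h.jpos_mem (Nat.succ_le_of_lt j.2)
  · exact h.mem_range (D.mono (Fin.le_last x) hr) h1 (h2.trans_eq (U.hom_bead_last j))

lemma exists_chain {y : U.T.Bead → Y.obj d} (h : U.IsMinimal y D) :
    ∃ w, U.chain y w = D :=
  (U.cover y).exists_chainOf _ _ D h.good fun t ht => by
    have h1 : t ∈ Set.range U.vpos := h.vertices ▸ D.mono (Fin.zero_le _) ht
    obtain ⟨v, rfl⟩ := h1
    exact ⟨U.T.vtx v, rfl⟩

lemma lab_unique {y y' : U.T.Bead → Y.obj d} (h : U.IsMinimal y D) (h' : U.IsMinimal y' D) :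
    y = y' :=
  funext fun j => D.lab_unique (h.lab j) (h'.lab j)

end IsMinimal

/-- A morphism of a labelled necklace comes from the necklace of its chain. -/
lemma IsSpine.exists_homMap {y : T.T.Bead → Y.obj d} {w : Ch.Hom T.T.labelled k T.T.α T.T.ω}
    (h : U.IsSpine ((T.chain y w).S 0) ((T.chain y w).S (Fin.last _))) :
    ∃ (g : U ⟶ T) (w' : Ch.Hom U.T.labelled k U.T.α U.T.ω),
      U.IsMinimal (fun b => y (B g b)) (T.chain y w) ∧
      U.chain (fun b => y (B g b)) w' = T.chain y w ∧
      Ch.homMap (labMap g) (𝟙 k) g.g_α g.g_ω w' = w := by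
  obtain ⟨g, hg⟩ := h.exists_hom
  obtain ⟨w', hw'⟩ := hg.exists_chain
  exact ⟨g, w', hg, hw', T.chain_injective y ((chain_homMap g y w').trans hw')⟩

end TndNec

/-! ### The labels given by a point of `G` -/

section

variable {m : ℕ} {Y : ThetaSpace n} {i : Fin (m + 1)} {P P' : MonoPair m Y} {U T : TndNecTo m i}
  {d e : (Cell n)ᵒᵖ} {k : SimplexCategoryᵒᵖ}

open Classical in
/-- The labels on all beads given by a point of `G`. -/
def GObj.lab (z : GObj P T d) (b : T.T.Bead) : Y.obj d :=
  if h : b = T.T.lastBead then P.f.app d z.x else z.y ⟨b, h⟩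

lemma GObj.lab_last (z : GObj P T d) : z.lab T.T.lastBead = P.f.app d z.x := dif_pos rfl

lemma GObj.lab_of_ne (z : GObj P T d) (b : T.T.OtherBead) : z.lab b.1 = z.y b := dif_neg b.2

/-- Once the last bead is given the label `f x`, the functoriality of `G` is plain pullback of
labels along the bead functor, which preserves last beads. -/
lemma GObj.lab_res (g : U ⟶ T) (z : GObj P T d) :
    (z.res g).lab = fun b => z.lab (TndNec.B g b) := by
  funext b
  by_cases hb : b = U.T.lastBead
  · subst hb
    rw [GObj.lab_last, TndNec.B_last, GObj.lab_last]
    rfl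
  · refine ((z.res g).lab_of_ne ⟨b, hb⟩).trans ?_
    by_cases h : TndNec.B g b = T.T.lastBead
    · rw [h, GObj.lab_last]
      exact GObj.res_y_of_eq g z ⟨b, hb⟩ h
    · exact (GObj.res_y_of_ne g z ⟨b, hb⟩ h).trans (z.lab_of_ne ⟨_, h⟩).symm

lemma GObj.lab_act (φ : d ⟶ e) (z : GObj P T d) : (z.act φ).lab = fun b => Y.map φ (z.lab b) := by
  funext b
  by_cases hb : b = T.T.lastBead
  · subst hb
    rw [GObj.lab_last, GObj.lab_last]
    exact P.f.naturality_apply φ z.x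
  · exact ((z.act φ).lab_of_ne ⟨b, hb⟩).trans (congrArg (Y.map φ) (z.lab_of_ne ⟨b, hb⟩).symm)

lemma GObj.lab_map (h : P ⟶ P') (z : GObj P T d) : (z.map h).lab = z.lab := by
  funext b
  by_cases hb : b = T.T.lastBead
  · subst hb
    rw [GObj.lab_last, GObj.lab_last]
    exact ConcreteCategory.congr_hom (NatTrans.congr_app (Over.w h.hom.2) d) z.x
  · exact ((z.map h).lab_of_ne ⟨b, hb⟩).trans (z.lab_of_ne ⟨b, hb⟩).symm

/-- Only the last bead needs an argument: there `x` is recovered from `f x`, as `f` is a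
monomorphism. -/
lemma GObj.lab_injective : Function.Injective (GObj.lab (P := P) (T := T) (d := d)) := by
  intro z z' h
  have hf : Mono P.f := P.property.2.1
  refine GObj.ext (funext fun b => ?_) ?_
  · rw [← GObj.lab_of_ne, ← GObj.lab_of_ne, h]
  · refine (mono_iff_injective _).1 ((NatTrans.mono_iff_mono_app P.f).1 hf d) ?_
    have := congrFun h T.T.lastBead
    rwa [GObj.lab_last, GObj.lab_last] at this

/-- As `ν + 1` is strictly increasing, a simplex factors through it as soon as its vertices lie in
the image. -/
lemma lastBeadIn_iff (ν : P.obj.1.left ⟶ ⦋m⦌) (hν : Function.Injective ν.toOrderHom) :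
    LastBeadIn ν T ↔ Set.range (T.hom (T.T.bead T.T.lastBead)).toOrderHom ⊆
      Set.range (plusOne ν).toOrderHom := by
  constructor
  · rintro ⟨s, hs⟩ _ ⟨x, rfl⟩
    refine ⟨(SSet.stdSimplex.objEquiv s).toOrderHom x, ?_⟩
    exact congrArg (fun s => (SSet.stdSimplex.objEquiv s).toOrderHom x) hs
  · intro h
    have hm := (plusOne ν).toOrderHom.monotone.strictMono_of_injective (plusOne_injective hν)
    choose φ hφ using fun x => h ⟨x, rfl⟩
    refine ⟨SSet.stdSimplex.objEquiv.symm (SimplexCategory.Hom.mk ⟨φ, fun x x' hx => ?_⟩), ?_⟩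
    · refine hm.le_iff_le.1 ?_
      rw [hφ, hφ]
      exact (T.hom (T.T.bead T.T.lastBead)).toOrderHom.monotone hx
    · exact SSet.stdSimplex.objEquiv.injective (hom_ext_fin hφ)

/-- The chains of the points of the weighted colimit. -/
lemma TndNec.IsMinimal.isBracketChain {z : GObj P U d}
    {D : LabChain (m + 1) (Y.obj d) k i.castSucc (Fin.last (m + 1))} (h : U.IsMinimal z.lab D) :
    IsBracketChain P D z.x (U.jpos U.T.t) where
  mem := h.jpos_mem (Nat.le_succ _)
  lt := U.jpos_lt_last U.T.lastBead
  last r hr hle := by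
    rcases hle.eq_or_lt with h1 | h1
    · exact Or.inl h1.symm
    · refine Or.inr (le_antisymm (Fin.le_last r) ?_)
      rw [← U.jpos_last]
      exact h.le_of_lt (j := U.T.lastBead) hr h1
  lab := by
    rw [← z.lab_last]
    exact h.lab U.T.lastBead
  range x r hr hle := by
    refine (lastBeadIn_iff P.μ P.property.1).1 z.mem (h.mem_range (j := U.T.lastBead)
      (D.mono (Fin.le_last x) hr) hle ?_)
    exact (Fin.le_last r).trans_eq U.jpos_last.symm

/-- A chain of this form gives a point of `G`. -/
lemma IsBracketChain.exists_gObj {D : LabChain (m + 1) (Y.obj d) k i.castSucc (Fin.last (m + 1))}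
    {x : P.X.obj d} {t : Fin (m + 1 + 1)} (h : IsBracketChain P D x t)
    (hU : U.IsSpine (D.S 0) (D.S (Fin.last _))) : ∃ z : GObj P U d, U.IsMinimal z.lab D := by
  obtain ⟨j, rfl⟩ := hU.exists_bead_of_lt h.mem h.lt
  -- The bead that starts at `t` ends at the next joint, which is `m + 1`; so it is the last bead.
  have hj : j = U.T.lastBead := by
    rcases h.last _ (hU.jpos_mem (Nat.succ_le_of_lt j.2)) (U.jpos_lt j).le with h1 | h1
    · exact ((U.jpos_lt j).ne h1.symm).elim
    · by_contra hj
      have hlt : (j : ℕ) + 1 < U.T.t + 1 := Nat.succ_lt_succ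
        (lt_of_le_of_ne (Nat.lt_succ_iff.1 j.2) fun e => hj (Fin.ext e))
      exact (U.jpos_lt_last ⟨j + 1, hlt⟩).ne h1
  subst hj
  choose y hy using fun b : U.T.Bead => D.lab_ex (hU.jpos_mem b.2.le) (U.jpos_lt_last b)
  let z : GObj P U d := ⟨fun b => y b.1, x, (lastBeadIn_iff P.μ P.property.1).2 fun r hr => by
    obtain ⟨h1, h2, -⟩ := hU.of_mem_range hr
    exact h.range _ r h1 h2⟩
  refine ⟨z, hU, fun b => ?_⟩
  by_cases hb : b = U.T.lastBead
  · subst hb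
    rw [z.lab_last]
    exact h.lab
  · rw [z.lab_of_ne ⟨b, hb⟩]
    exact hy b

end

/-! ### The comparison map from the weighted colimit -/

/-- The coend is a colimit, computed valuewise, and the terms indexed by morphisms map to it through
those indexed by objects. -/
lemma coend_jointly_surjective {J : Type} [SmallCategory J] (F : Jᵒᵖ ⥤ J ⥤ SpaceValued n)
    (d : (Cell n)ᵒᵖ) (k : SimplexCategoryᵒᵖ) (x : ((coend F).obj d).obj k) :
    ∃ (j : J) (y : (((F.obj (op j)).obj j).obj d).obj k), ((coend.ι F j).app d).app k y = x := by
  let E : SpaceValued n ⥤ Type := (evaluation _ _).obj d ⋙ (evaluation _ _).obj k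
  obtain ⟨j, y, hy⟩ := Types.jointly_surjective _
    (isColimitOfPreserves E (colimit.isColimit (multispanIndexCoend F).multispan)) x
  cases j with
  | right j => exact ⟨j, y, hy⟩
  | left f =>
    refine ⟨_, ((multispanIndexCoend F).fst f |>.app d).app k y, ?_⟩
    refine Eq.trans ?_ hy
    exact ConcreteCategory.congr_hom (congrArg E.map
      (colimit.w (multispanIndexCoend F).multispan (WalkingMultispan.Hom.fst f))) y

section

variable {m : ℕ} {Y : ThetaSpace n} {i : Fin (m + 1)} {P P' : MonoPair m Y} {U T : TndNecTo m i}
  {d e : (Cell n)ᵒᵖ}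

/-- The hom spaces of the bouquets, whose diagonal is the ambient space. -/
def ambientSpace (m : ℕ) (Y : ThetaSpace n) (i : Fin (m + 1)) : SpaceValued n where
  obj d := Ch.homSSet (labObj (bouquetPcat (m + 1) Y) d) (bouquetPt (m + 1) Y i.castSucc)
    (bouquetPt (m + 1) Y (Fin.last (m + 1)))
  map φ :=
    { app := fun k => ↾Ch.homMap ((lab (bouquetPcat (m + 1) Y)).map φ) (𝟙 k) rfl rfl
      naturality := fun _ l κ => ConcreteCategory.hom_ext _ _ fun x =>
        (Ch.homMap_comp' (𝟙 _) ((lab (bouquetPcat (m + 1) Y)).map φ) κ (𝟙 l)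
          (Category.id_comp _).symm (Category.comp_id κ).symm rfl rfl rfl rfl rfl rfl x).symm.trans
        (Ch.homMap_comp' ((lab (bouquetPcat (m + 1) Y)).map φ) (𝟙 _) (𝟙 _) κ
          (Category.comp_id _).symm (Category.id_comp κ).symm rfl rfl rfl rfl rfl rfl x) }
  map_id d := NatTrans.ext (funext fun _ => ConcreteCategory.hom_ext _ _ fun x =>
    Ch.homMap_refl' ((lab (bouquetPcat (m + 1) Y)).map_id d) rfl rfl rfl x)
  map_comp φ ψ := NatTrans.ext (funext fun k => ConcreteCategory.hom_ext _ _ fun x =>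
    Ch.homMap_comp' ((lab (bouquetPcat (m + 1) Y)).map φ) ((lab (bouquetPcat (m + 1) Y)).map ψ)
      (𝟙 k) (𝟙 k) ((lab (bouquetPcat (m + 1) Y)).map_comp φ ψ) (Category.comp_id _).symm
      rfl rfl rfl rfl rfl rfl x)

/-- The diagonal of `ambientSpace`. -/
def diagAmbientSpace (m : ℕ) (Y : ThetaSpace n) (i : Fin (m + 1)) :
    (diag n).obj (ambientSpace m Y i) ⟶ Ambient m Y i where
  app _ := ↾fun x => x
  naturality _ _ f := ConcreteCategory.hom_ext _ _ fun x =>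
    (Ch.homMap_comp' ((lab (bouquetPcat (m + 1) Y)).map f) (𝟙 _) (𝟙 _) f.unop.2.op
      (Category.comp_id _).symm (Category.id_comp _).symm rfl rfl rfl rfl rfl rfl x).symm

/-- The map of hom spaces given by a necklace with labels on its beads. -/
def TndNec.homToBouquet (T : TndNecTo m i) (y : T.T.Bead → Y.obj d) {k : SimplexCategoryᵒᵖ}
    (w : Ch.Hom T.T.labelled k T.T.α T.T.ω) : ((ambientSpace m Y i).obj d).obj k :=
  Ch.homMap (T.toBouquet y) (𝟙 k) (T.toBouquet_α y) (T.toBouquet_ω y) w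

lemma TndNec.homToBouquet_map (T : TndNecTo m i) (y : T.T.Bead → Y.obj d)
    {k l : SimplexCategoryᵒᵖ} (κ : k ⟶ l) (w : Ch.Hom T.T.labelled k T.T.α T.T.ω) :
    T.homToBouquet y (Ch.homMap (𝟙 _) κ rfl rfl w) =
      ((ambientSpace m Y i).obj d).map κ (T.homToBouquet y w) :=
  (Ch.homMap_comp' (𝟙 _) (T.toBouquet y) κ (𝟙 l) (Category.id_comp _).symm
    (Category.comp_id κ).symm rfl rfl (T.toBouquet_α y) (T.toBouquet_ω y) (T.toBouquet_α y)
    (T.toBouquet_ω y) w).symm.trans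
  (Ch.homMap_comp' (T.toBouquet y) (𝟙 _) (𝟙 k) κ (Category.comp_id _).symm
    (Category.id_comp κ).symm (T.toBouquet_α y) (T.toBouquet_ω y) rfl rfl (T.toBouquet_α y)
    (T.toBouquet_ω y) w)

lemma TndNec.homToBouquet_act (T : TndNecTo m i) (y : T.T.Bead → Y.obj d) (φ : d ⟶ e)
    {k : SimplexCategoryᵒᵖ} (w : Ch.Hom T.T.labelled k T.T.α T.T.ω) :
    T.homToBouquet (fun b => Y.map φ (y b)) w =
      ((ambientSpace m Y i).map φ).app k (T.homToBouquet y w) :=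
  Ch.homMap_comp' (T.toBouquet y) ((lab (bouquetPcat (m + 1) Y)).map φ) (𝟙 k) (𝟙 k)
    (T.toBouquet_lab_map φ y).symm (Category.comp_id _).symm (T.toBouquet_α y) (T.toBouquet_ω y)
    rfl rfl _ _ w

lemma TndNec.homToBouquet_homMap (g : U ⟶ T) (y : T.T.Bead → Y.obj d)
    {k : SimplexCategoryᵒᵖ} (w : Ch.Hom U.T.labelled k U.T.α U.T.ω) :
    T.homToBouquet y (Ch.homMap (TndNec.labMap g) (𝟙 k) g.g_α g.g_ω w) =
      U.homToBouquet (fun b => y (TndNec.B g b)) w :=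
  (Ch.homMap_comp' (TndNec.labMap g) (T.toBouquet y) (𝟙 k) (𝟙 k)
    (TndNec.labMap_toBouquet g y).symm (Category.comp_id _).symm g.g_α g.g_ω (T.toBouquet_α y)
    (T.toBouquet_ω y) _ _ w).symm

/-- The bifunctor whose coend is the weighted colimit. -/
abbrev weightedBifunctor (P : MonoPair m Y) : (TndNecTo m i)ᵒᵖ ⥤ TndNecTo m i ⥤ SpaceValued n :=
  ((Functor.whiskeringRight _ _ _).obj ((curriedTensor (SpaceValued n)).flip ⋙
    (Functor.whiskeringLeft _ _ _).obj (H m i ⋙ Functor.const (Cell n)ᵒᵖ))).obj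
      ((G m Y i).obj P ⋙ ι n)

/-- The component of the comparison map at a necklace. -/
def weightedLeg (P : MonoPair m Y) (T : TndNecTo m i) :
    ((weightedBifunctor P).obj (op T)).obj T ⟶ ambientSpace m Y i where
  app d :=
    { app := fun k => ↾fun x : Ch.Hom T.T.labelled k T.T.α T.T.ω × GObj P T d =>
        T.homToBouquet x.2.lab x.1
      naturality := fun _ _ κ => ConcreteCategory.hom_ext _ _
        fun x : Ch.Hom T.T.labelled _ T.T.α T.T.ω × GObj P T d =>
          T.homToBouquet_map x.2.lab κ x.1 }
  naturality _ _ φ := NatTrans.ext (funext fun _ => ConcreteCategory.hom_ext _ _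
    fun x : Ch.Hom T.T.labelled _ T.T.α T.T.ω × GObj P T _ =>
      (congrArg (fun y => T.homToBouquet y x.1) (x.2.lab_act φ)).trans
        (T.homToBouquet_act x.2.lab φ x.1))

/-- The comparison map from the weighted colimit. -/
def weightedDesc (m : ℕ) (Y : ThetaSpace n) (i : Fin (m + 1)) (P : MonoPair m Y) :
    (weightedSide m Y i).obj P ⟶ Ambient m Y i :=
  (diag n).map (coend.desc (F := weightedBifunctor P) (weightedLeg P) fun _ _ g =>
    NatTrans.ext (funext fun _ => NatTrans.ext (funext fun _ => ConcreteCategory.hom_ext _ _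
      fun x : Ch.Hom _ _ _ _ × GObj P _ _ =>
        (congrArg (fun y => TndNec.homToBouquet _ y x.1) (x.2.lab_res g)).trans
          (TndNec.homToBouquet_homMap g x.2.lab x.1).symm))) ≫ diagAmbientSpace m Y i

/-- A pair as a point of the bifunctor. -/
def weightedPair {k : SimplexCategoryᵒᵖ} (w : Ch.Hom U.T.labelled k U.T.α U.T.ω)
    (z : GObj P T d) : ((((weightedBifunctor P).obj (op T)).obj U).obj d).obj k :=
  (w, z)

/-- The point of the weighted colimit given by a morphism of a necklace and a point of `G`. -/
def weightedEl (T : TndNecTo m i) (w : Ch.Hom T.T.labelled (op d.unop.2) T.T.α T.T.ω)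
    (z : GObj P T d) : ((weightedSide m Y i).obj P).obj d :=
  ((coend.ι (weightedBifunctor P) T).app d).app (op d.unop.2) (weightedPair w z)

lemma exists_weightedEl (v : ((weightedSide m Y i).obj P).obj d) :
    ∃ (T : TndNecTo m i) (w : Ch.Hom T.T.labelled (op d.unop.2) T.T.α T.T.ω) (z : GObj P T d),
      weightedEl T w z = v := by
  obtain ⟨T, x, hx⟩ := coend_jointly_surjective (weightedBifunctor P) d (op d.unop.2) v
  exact ⟨T, Prod.fst x, Prod.snd x, hx⟩

lemma weightedEl_res (g : U ⟶ T) (w : Ch.Hom U.T.labelled (op d.unop.2) U.T.α U.T.ω)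
    (z : GObj P T d) : weightedEl U w (z.res g) =
      weightedEl T (Ch.homMap (TndNec.labMap g) (𝟙 _) g.g_α g.g_ω w) z :=
  ConcreteCategory.congr_hom (NatTrans.congr_app (NatTrans.congr_app
    (coend.condition (weightedBifunctor P) g) d) (op d.unop.2)) (weightedPair w z)

lemma weightedDesc_weightedEl (w : Ch.Hom T.T.labelled (op d.unop.2) T.T.α T.T.ω)
    (z : GObj P T d) : (weightedDesc m Y i P).app d (weightedEl T w z) = T.homToBouquet z.lab w :=
  ConcreteCategory.congr_hom (NatTrans.congr_app (NatTrans.congr_app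
    (coend.ι_desc (F := weightedBifunctor P) (weightedLeg P) _ T) d)
      (op d.unop.2)) (weightedPair w z)

lemma weightedSide_map_weightedEl (h : P ⟶ P')
    (w : Ch.Hom T.T.labelled (op d.unop.2) T.T.α T.T.ω) (z : GObj P T d) :
    ((weightedSide m Y i).map h).app d (weightedEl T w z) = weightedEl T w (z.map h) :=
  ConcreteCategory.congr_hom (NatTrans.congr_app (NatTrans.congr_app
    (coend.ι_map (F := weightedBifunctor P) (F' := weightedBifunctor P')
      (((Functor.whiskeringRight _ _ _).obj ((curriedTensor (SpaceValued n)).flip ⋙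
        (Functor.whiskeringLeft _ _ _).obj (H m i ⋙ Functor.const (Cell n)ᵒᵖ))).map
          (Functor.whiskerRight ((G m Y i).map h) (ι n))) T) d) (op d.unop.2)) (weightedPair w z)

lemma weightedDesc_naturality (h : P ⟶ P') :
    (weightedSide m Y i).map h ≫ weightedDesc m Y i P' = weightedDesc m Y i P := by
  refine NatTrans.ext (funext fun d => ConcreteCategory.hom_ext _ _ fun v => ?_)
  obtain ⟨T, w, z, rfl⟩ := exists_weightedEl v
  refine (congrArg ((weightedDesc m Y i P').app d) (weightedSide_map_weightedEl h w z)).trans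
    ((weightedDesc_weightedEl w (z.map h)).trans ?_)
  rw [z.lab_map]
  exact (weightedDesc_weightedEl w z).symm

lemma ambChain_weightedDesc (w : Ch.Hom T.T.labelled (op d.unop.2) T.T.α T.T.ω)
    (z : GObj P T d) :
    ambChain ((weightedDesc m Y i P).app d (weightedEl T w z)) = T.chain z.lab w :=
  (congrArg ambChain (weightedDesc_weightedEl w z)).trans
    (chainOf_homMap (T.toBouquet z.lab) (bouquetCol (m + 1) Y d) (T.toBouquet_α _)
      (T.toBouquet_ω _) rfl rfl T.vpos_zero T.vpos_last w)

/-- A point of the weighted colimit is represented by the necklace of its chain. -/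
lemma exists_isMinimal (v : ((weightedSide m Y i).obj P).obj d) (U : TndNecTo m i)
    (hU : U.IsSpine ((ambChain ((weightedDesc m Y i P).app d v)).S 0)
      ((ambChain ((weightedDesc m Y i P).app d v)).S (Fin.last _))) :
    ∃ (w : _) (z : GObj P U d), weightedEl U w z = v ∧
      U.IsMinimal z.lab (ambChain ((weightedDesc m Y i P).app d v)) ∧
      U.chain z.lab w = ambChain ((weightedDesc m Y i P).app d v) := by
  obtain ⟨T, w, z, rfl⟩ := exists_weightedEl v
  have e := ambChain_weightedDesc w z
  generalize ambChain _ = D at e hU ⊢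
  subst e
  -- The morphism `w` comes from `U` along `g`, and the coend relation carries `g` over to the point
  -- of `G`.
  obtain ⟨g, w', h₁, h₂, h₃⟩ := hU.exists_homMap
  refine ⟨w', z.res g, (weightedEl_res g w' z).trans (congrArg (weightedEl T · z) h₃), ?_⟩
  rw [z.lab_res]
  exact ⟨h₁, h₂⟩

/-- Points with equal images have equal chains, so both are represented on one minimal necklace.
There the chain determines the labels, hence the point of `G`, and then the morphism. -/
lemma weightedDesc_injective : Function.Injective ((weightedDesc m Y i P).app d) := by
  intro v v' h
  obtain ⟨U, hU⟩ := TndNec.exists_isSpine_of_chain (ambChain ((weightedDesc m Y i P).app d v))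
  obtain ⟨w, z, hv, hz, hw⟩ := exists_isMinimal v U hU
  obtain ⟨w', z', hv', hz', hw'⟩ := exists_isMinimal v' U (h ▸ hU)
  rw [← h] at hz' hw'
  obtain rfl : z = z' := GObj.lab_injective (hz.lab_unique hz')
  obtain rfl : w = w' := U.chain_injective z.lab (hw.trans hw'.symm)
  exact hv.symm.trans hv'

lemma exists_isBracketChain_weighted (v : ((weightedSide m Y i).obj P).obj d) :
    ∃ x t, IsBracketChain P (ambChain ((weightedDesc m Y i P).app d v)) x t := by
  obtain ⟨U, hU⟩ := TndNec.exists_isSpine_of_chain (ambChain ((weightedDesc m Y i P).app d v))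
  obtain ⟨w, z, -, hz, -⟩ := exists_isMinimal v U hU
  exact ⟨_, _, hz.isBracketChain⟩

/-- The necklace with joints `D.S 0` and vertices the largest set of `D` carries `D`, and the
condition on `D` makes its labels a point of `G`. -/
lemma exists_weighted (D : LabChain (m + 1) (Y.obj d) (op d.unop.2) i.castSucc
    (Fin.last (m + 1))) {x : P.X.obj d} {t : Fin (m + 1 + 1)} (h : IsBracketChain P D x t) :
    ∃ v, ambChain ((weightedDesc m Y i P).app d v) = D := by
  obtain ⟨U, hU⟩ := TndNec.exists_isSpine_of_chain D
  obtain ⟨z, hz⟩ := h.exists_gObj hU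
  obtain ⟨w, hw⟩ := hz.exists_chain
  exact ⟨weightedEl U w z, (ambChain_weightedDesc w z).trans hw⟩

end

/-! ### The comparison -/

/-- Functors with monomorphisms to a constant functor are isomorphic if the monomorphisms have the
same ranges. -/
lemma nonempty_iso_of_range_eq {C D : Type*} [Category* C] [Category* D] {A B : C ⥤ D ⥤ Type}
    {Z : D ⥤ Type} (a : ∀ P, A.obj P ⟶ Z) (b : ∀ P, B.obj P ⟶ Z)
    (ha : ∀ {P P'} (h : P ⟶ P'), A.map h ≫ a P' = a P)
    (hb : ∀ {P P'} (h : P ⟶ P'), B.map h ≫ b P' = b P)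
    (ha' : ∀ P d, Function.Injective ((a P).app d))
    (hb' : ∀ P d, Function.Injective ((b P).app d))
    (hab : ∀ P d, Set.range ((a P).app d) = Set.range ((b P).app d)) : Nonempty (A ≅ B) := by
  have h₁ (P d) (x : (A.obj P).obj d) : ∃ y, (b P).app d y = (a P).app d x :=
    (hab P d).subset ⟨x, rfl⟩
  have h₂ (P d) (y : (B.obj P).obj d) : ∃ x, (a P).app d x = (b P).app d y :=
    (hab P d).superset ⟨y, rfl⟩
  choose f hf using h₁
  choose g hg using h₂
  let e (P : C) : A.obj P ≅ B.obj P := NatIso.ofComponents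
    (fun d => Equiv.toIso ⟨f P d, g P d, fun x => ha' P d (by rw [hg, hf]),
      fun y => hb' P d (by rw [hf, hg])⟩)
    fun {d d'} φ => ConcreteCategory.hom_ext _ _ fun x => hb' P d' <| by
      refine (hf P d' _).trans (((a P).naturality_apply φ x).trans ?_)
      exact (congrArg (Z.map φ) (hf P d x).symm).trans ((b P).naturality_apply φ _).symm
  refine ⟨NatIso.ofComponents e fun {P P'} h => NatTrans.ext (funext fun d =>
    ConcreteCategory.hom_ext _ _ fun x => hb' P' d ?_)⟩
  refine (hf P' d _).trans ((ConcreteCategory.congr_hom (NatTrans.congr_app (ha h) d) x).trans ?_)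
  exact (hf P d x).symm.trans (ConcreteCategory.congr_hom (NatTrans.congr_app (hb h) d) _).symm

/-- Both images in the ambient space consist of the points whose chain satisfies `IsBracketChain`
for some `x` and `t`. -/
lemma nonempty_straighteningSide_iso (n m : ℕ) (Y : ThetaSpace n) (hY : Y.Connected)
    (i : Fin (m + 1)) : Nonempty (straighteningSide m hY i ≅ weightedSide m Y i) := by
  refine nonempty_iso_of_range_eq (straighteningDesc hY i) (weightedDesc m Y i)
    (straighteningDesc_naturality hY i) weightedDesc_naturality
    (fun P d => straighteningDesc_injective hY) (fun P d => weightedDesc_injective) fun P d => ?_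
  ext z
  constructor
  · rintro ⟨v, rfl⟩
    obtain ⟨x, t, h⟩ := exists_isBracketChain hY v
    obtain ⟨v', hv'⟩ := exists_weighted _ h
    exact ⟨v', ambChain_injective hY hv'⟩
  · rintro ⟨v, rfl⟩
    obtain ⟨x, t, h⟩ := exists_isBracketChain_weighted v
    obtain ⟨v', hv'⟩ := exists_straightening hY _ h
    exact ⟨v', ambChain_injective hY hv'⟩

end

end StNec

theorem proposition3p8 (n m : ℕ) (Y : StNec.ThetaSpace n) (hY : Y.Connected) (i : Fin (m + 1)) :
    Nonempty (StNec.straighteningSide m hY i ≅ StNec.weightedSide m Y i) :=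
  StNec.nonempty_straighteningSide_iso n m Y hY i
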